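/- Let $\mathbb F_q$ be a finite field, let $F_1\subsetneq\cdots\subsetneq F_\lambda\subseteq\mathbb F_q$ be distinct nested subfields ($\lambda\ge 1$), let $\mu_1,\dots,\mu_\lambda$ be positive integers, and put $s_0=0$, $s_t=\mu_1+\cdots+\mu_t$, $m=s_\lambda$. For $1\le k\le m$ let $t_k$ be the unique integer with $s_{t_k-1}<k\le s_{t_k}$, and put $A_k=F_{t_k}$, $d_k=|A_k|$, $$\mathcal A=A_1\times\cdots\times A_m=F_1^{\mu_1}\times\cdots\times F_\lambda^{\mu_\lambda}\subseteq\mathbb F_q^m,\qquad K=\sum_{i=1}^m(d_i-1).$$ For $u\ge 0$ let $\mathrm{AC}_q(u,\mathcal A)$ be the linear code of all words $c_f=(f(P))_{P\in\mathcal A}$, where $f\in\mathbb F_q[X_1,\dots,X_m]$, $\deg f\le u$ and $\deg_{X_i}f<d_i$ for all $i$, and let $\mathcal N_q(u,\mathcal A)$ be the set of its nonzero codewords of minimum Hamming weight. Write $\genfrac{[}{]}{0pt}{}{a}{b}_{Q}$ for the Gaussian binomial coefficient, i.e. the number of $b$-dimensional linear subspaces of $\mathbb F_Q^a$. Let $\mathrm{Aff}(\mathcal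 A)$ be the set of maps of $\mathcal A$ onto $\mathcal A$ that are restrictions of maps $x\mapsto Mx+b$ with $M\in\mathrm{GL}(m,\mathbb F_q)$, $b\in\mathbb F_q^m$. Then $|\mathcal N_q(0,\mathcal A)|=q-1$. Let $1\le u\le K$. There are unique integers $j,\ell$ with $u=\sum_{i=1}^{j}(d_i-1)+\ell$, $0\le j<m$ and $0<\ell\le d_{j+1}-1$. Put $r=t_{j+1}$. (1) If $\ell=d_{j+1}-1$, then $$|\mathcal N_q(u,\mathcal A)|=(q-1)\Big(\prod_{i=1}^{j+1}d_i\Big)\genfrac{[}{]}{0pt}{}{\mu_r}{j+1-s_{r-1}}_{d_{j+1}}.$$ (2) If $\ell<d_{j+1}-1$, let $k_0$ be the least $k\in\{1,\dots,j+1\}$ with $d_k\ge d_{j+1}-\ell$. For $1\le k\le j+1$ with $d_k\ge d_{j+1}-\ell$ let $\mathcal N_q^{(k)}(u,\mathcal A)$ be the set of all words $\big(\gamma\,h(\sigma(P))\big)_{P\in\mathcal A}$, where $\gamma\in\mathbb F_q^*$, $\sigma\in\mathrm{Aff}(\mathcal A)$ and $h=\prod_{1\le i\le j+1,\,i\ne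 k}(1-X_i^{d_i-1})\prod_{\omega\in\Omega}(X_k-\omega)$ for some $\Omega\subseteq A_k$ with $|\Omega|=d_k-(d_{j+1}-\ell)$. Then $$|\mathcal N_q(u,\mathcal A)|=|\mathcal N_q^{(j+1)}(u,\mathcal A)|+\sum_{t=t_{k_0}}^{r-1}|\mathcal N_q^{(s_t)}(u,\mathcal A)|,$$ and for every $1\le k\le j+1$ with $d_k\ge d_{j+1}-\ell$: if $t_k=r$, then $$|\mathcal N_q^{(k)}(u,\mathcal A)|=(q-1)\Big(\prod_{\substack{1\le i\le j+1\\ i\ne k}}d_i\Big)\genfrac{[}{]}{0pt}{}{\mu_r}{j-s_{r-1}}_{d_{j+1}}\genfrac{[}{]}{0pt}{}{s_r-j}{1}_{d_k}\binom{d_k}{d_{j+1}-\ell};$$ if $t_k<r$, then $$|\mathcal N_q^{(k)}(u,\mathcal A)|=(q-1)\Big(\prod_{\substack{1\le i\le j+1\\ i\ne k}}d_i\Big)\Big(\prod_{i=s_{t_k}+1}^{j+1}d_i\Big)\genfrac{[}{]}{0pt}{}{\mu_r}{j+1-s_{r-1}}_{d_{j+1}}\genfrac{[}{]}{0pt}{}{\mu_{t_k}}{1}_{d_k}\binom{d_k}{d_{j+1}-\ell}.$$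 -/

import Mathlib

noncomputable section

namespace AffineCartesian

/-! ### Affine Cartesian codes of arbitrary Cartesian products -/

section General

variable {F : Type*} [Field F] {m : ℕ}

/-- The Cartesian product `A₁ × ⋯ × A_m` as a subset of `F ^ m`. -/
def points (A : Fin m → Set F) : Set (Fin m → F) := Set.univ.pi A

/-- `d_i`, the number of elements of `A_i`. -/
def size (A : Fin m → Set F) (i : Fin m) : ℕ := (A i).ncard

/-- The space of polynomials of total degree at most `u` and of degree less than `d_i` in the
`i`-th variable (see `mem_reducedPoly`). -/
def reducedPoly (A : Fin m → Set F) (u : ℕ) : Submodule F (MvPolynomial (Fin m) F) :=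
  MvPolynomial.restrictTotalDegree (Fin m) F u ⊓
    MvPolynomial.restrictSupport F {n : Fin m →₀ ℕ | ∀ i, n i < size A i}

theorem mem_reducedPoly (A : Fin m → Set F) (hA : ∀ i, 0 < size A i) (u : ℕ)
    (f : MvPolynomial (Fin m) F) :
    f ∈ reducedPoly A u ↔ f.totalDegree ≤ u ∧ ∀ i, f.degreeOf i < size A i := by
  unfold reducedPoly
  rw [Submodule.mem_inf, MvPolynomial.mem_restrictTotalDegree,
    MvPolynomial.mem_restrictSupport_iff]
  refine and_congr_right fun _ => ?_
  simp only [MvPolynomial.degreeOf_lt_iff (hA _)]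
  exact ⟨fun h i n hn => h hn i, fun h n hn i => h i n hn⟩

/-- The evaluation map `f ↦ c_f = (f(P))_{P ∈ A}`; coordinates of codewords are indexed by the
points of the Cartesian product themselves. -/
def evalMap (A : Fin m → Set F) : MvPolynomial (Fin m) F →ₗ[F] (points A → F) :=
  LinearMap.pi fun P => (MvPolynomial.aeval (P : Fin m → F)).toLinearMap

theorem evalMap_apply (A : Fin m → Set F) (f : MvPolynomial (Fin m) F) (P : points A) :
    evalMap A f P = MvPolynomial.eval (P : Fin m → F) f := by
  simp [evalMap, MvPolynomial.aeval_eq_eval]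

/-- The affine Cartesian code of order `u`. -/
def code (A : Fin m → Set F) (u : ℕ) : Submodule F (points A → F) :=
  (reducedPoly A u).map (evalMap A)

/-- The Hamming weight of a word. -/
def weight {ι : Type*} (c : ι → F) : ℕ := (Function.support c).ncard

/-- The set of minimum weight codewords of a linear code: the nonzero codewords whose weight is
least among the nonzero codewords. -/
def minWeightWords {ι : Type*} (C : Submodule F (ι → F)) : Set (ι → F) :=
  {c | c ∈ C ∧ c ≠ 0 ∧ ∀ c' ∈ C, c' ≠ 0 → weight c ≤ weight c'}

/-- The affine group of the Cartesian product: the maps `φ` of the product onto itself which are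
restrictions of maps `x ↦ M x + b` with `M` an invertible matrix over `F` and `b ∈ F ^ m`. -/
def affineGroup (A : Fin m → Set F) : Set (points A → points A) :=
  {φ | (∃ (M : GL (Fin m) F) (b : Fin m → F), ∀ P : points A,
      (φ P : Fin m → F) = (M : Matrix (Fin m) (Fin m) F).mulVec P + b) ∧
    Function.Surjective φ}

/-- The polynomial `∏_{i ≤ j, i ≠ k} (1 - X_i ^ (d_i - 1)) * ∏_{ω ∈ Ω} (X_k - ω)`. -/
def hPoly (A : Fin m → Set F) (j k : Fin m) (Ω : Finset F) : MvPolynomial (Fin m) F :=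
  (∏ i ∈ (Finset.Iic j).erase k, (1 - MvPolynomial.X i ^ (size A i - 1))) *
    ∏ ω ∈ Ω, (MvPolynomial.X k - MvPolynomial.C ω)

/-- The words `γ • (h ∘ σ)`, where `γ` is a nonzero scalar, `σ` lies in the affine group and
`h = hPoly A j k Ω`. -/
def orbitWordsOf (A : Fin m → Set F) (j k : Fin m) (Ω : Finset F) : Set (points A → F) :=
  {c | ∃ γ : F, γ ≠ 0 ∧ ∃ σ ∈ affineGroup A, c = γ • (evalMap A (hPoly A j k Ω) ∘ σ)}

/-- The set `N^(k)` of all words `γ • (h ∘ σ)` as above with `Ω ⊆ A_k` of size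
`d_k - (d_j - ℓ)`. Only used for `d_j - ℓ ≤ d_k` and `ℓ ≤ d_j`. -/
def orbitWords (A : Fin m → Set F) (j : Fin m) (ℓ : ℕ) (k : Fin m) : Set (points A → F) :=
  ⋃ Ω ∈ {Ω : Finset F | (Ω : Set F) ⊆ A k ∧ Ω.card = size A k - (size A j - ℓ)},
    orbitWordsOf A j k Ω

end General

/-- The Gaussian binomial coefficient `[n, k]_{|L|}` of a finite field `L`: the number of
`k`-dimensional subspaces of `L ^ n`. -/
def gaussBinom (L : Type*) [Field L] (n k : ℕ) : ℕ :=
  Nat.card {W : Submodule L (Fin n → L) // Module.finrank L W = k}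

/-! ### Block structure: `μ_t` consecutive coordinates in block `t`

Blocks and coordinates are numbered from `0`. -/

section Blocks

variable {l : ℕ}

/-- The number of coordinates in the first `n` blocks. -/
def partialSum (μ : Fin l → ℕ) (n : ℕ) : ℕ := ∑ t : Fin l with t.val < n, μ t

/-- The block containing the coordinate `k` (see `block_spec`). -/
def block (μ : Fin l → ℕ) (k : Fin (∑ t, μ t)) : Fin l := (finSigmaFinEquiv.symm k).1

theorem partialSum_eq (μ : Fin l → ℕ) (t : Fin l) :
    partialSum μ t = ∑ i : Fin t.val, μ (Fin.castLE t.2.le i) := by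
  unfold partialSum
  symm
  refine Finset.sum_bij (fun i _ => Fin.castLE t.2.le i) ?_ ?_ ?_ ?_
  · intro i _
    exact Finset.mem_filter.2 ⟨Finset.mem_univ _, i.2⟩
  · intro a _ b _ h
    simpa using h
  · intro b hb
    exact ⟨⟨b.val, by simpa using hb⟩, Finset.mem_univ _, rfl⟩
  · intro i _
    rfl

theorem partialSum_succ (μ : Fin l → ℕ) (t : Fin l) :
    partialSum μ (t + 1) = partialSum μ t + μ t := by
  unfold partialSum
  have h : (Finset.univ.filter fun i : Fin l => i.val < t.val + 1) =
      insert t (Finset.univ.filter fun i : Fin l => i.val < t.val) := by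
    ext i
    simp only [Finset.mem_filter, Finset.mem_univ, true_and, Finset.mem_insert, Fin.ext_iff]
    omega
  rw [h, Finset.sum_insert (by simp), add_comm]

theorem partialSum_le (μ : Fin l → ℕ) (n : ℕ) : partialSum μ n ≤ ∑ t, μ t :=
  Finset.sum_le_sum_of_subset (Finset.filter_subset _ _)

theorem block_spec (μ : Fin l → ℕ) (k : Fin (∑ t, μ t)) :
    partialSum μ (block μ k) ≤ k ∧ k < partialSum μ (block μ k + 1) := by
  obtain ⟨p, rfl⟩ := finSigmaFinEquiv.surjective k
  rw [partialSum_succ, block, Equiv.symm_apply_apply, partialSum_eq, finSigmaFinEquiv_apply]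
  have := p.2.2
  omega

/-- The last coordinate of the block `t`. -/
def blockEnd (μ : Fin l → ℕ) (hμ : ∀ t, 0 < μ t) (t : Fin l) : Fin (∑ t, μ t) :=
  ⟨partialSum μ (t + 1) - 1, by
    have h₁ := partialSum_le μ (t + 1)
    have h₂ := partialSum_succ μ t
    have h₃ := hμ t
    omega⟩

/-- The factors `A_i` of the product `E₁ ^ μ₁ × ⋯ × E_l ^ μ_l`. -/
def factors {F : Type*} [Field F] (E : Fin l → Subfield F) (μ : Fin l → ℕ) :
    Fin (∑ t, μ t) → Set F :=
  fun i => (E (block μ i) : Set F)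

end Blocks

end AffineCartesian

end

/-! Write K i for the field of the coordinate i (an increasing chain) and d i for its size. Reducing
exponents by x ^ d = x shows that the codewords are the values on the box ∏ K i of polynomial
functions of degree at most u (`mem_code_iff`). Two minimum weight words with the same support are
proportional, since otherwise a suitable difference would be shorter. So every count is q - 1 times
a number of supports (`ncard_eq_mul_ncard_supports`).

Minimum weight. If f is nonzero on only w of the slices x a = c, it is divisible by d a - w linear
factors, and what remains has degree u - (d a - w) on each slice. By induction the weight is at
least the least product of integers 1 ≤ P i ≤ d i with ∑ (d i - P i) ≤ u
(`PolyFun.minProd_le_card`). Shifting a unit from a smaller to a larger entry lowers the product.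
Hence all optimal tuples are permutations of (1, …, 1, d j - ℓ, d (j+1), …)
(`optimal_thresholdTuple`, `Optimal.exists_perm_eq`).

Shape of the supports. For a minimal support all nonempty slices in a direction have the same size
and are minimal themselves. If the support is not the whole box, a double count over shears shows
that some coordinate of some automorphism misses a value (`eq_box_of_equidistributed`). Induction
over slices then makes the support, up to an automorphism, a product of sets whose sizes form an
optimal tuple (`PolyFun.hasProductSupport`). This puts it in one of the orbits defining N^(k).

Counting. The supports in the orbit of k are the unions of w = d j - ℓ parallel cosets x + τ • δ +
H, τ ∈ T ⊆ K k. Here H runs over certain K j-subspaces and δ over directions of level k, because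
linear automorphisms act transitively on such pairs up to H (`orbitSupports_eq_cosetSupports`). The
groups H correspond to subspaces of K j ^ μ of fixed dimension, which gives a Gaussian binomial. H
can be recovered from the support, and for w ≥ 2 the triple (x, δ, T) is unique up to affine
reparametrisation of the line and shifts by H (`card_image_cosets`). Levels with different fields
give disjoint families (`disjoint_cosetSupports`), whence the sum over blocks. For w = 1 the
direction is invisible and all k give the same supports. -/

namespace AffineCartesian

/-! ### Minimising a product of bounded integers with given total deficiency. -/

section Products

/-- `P` is a tuple with `1 ≤ P i ≤ d i` and total deficiency `∑ (d i - P i)` at most `u`. -/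
def Feasible {n : ℕ} (d : Fin n → ℕ) (u : ℕ) (P : Fin n → ℕ) : Prop :=
  (∀ i, 1 ≤ P i ∧ P i ≤ d i) ∧ ∑ i, d i ≤ ∑ i, P i + u

/-- The least product of a feasible tuple. -/
noncomputable def minProd {n : ℕ} (d : Fin n → ℕ) (u : ℕ) : ℕ :=
  sInf {N | ∃ P, Feasible d u P ∧ ∏ i, P i = N}

/-- `P` is a feasible tuple of least product. -/
def Optimal {n : ℕ} (d : Fin n → ℕ) (u : ℕ) (P : Fin n → ℕ) : Prop :=
  Feasible d u P ∧ ∏ i, P i = minProd d u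

variable {n : ℕ} {d P Q : Fin n → ℕ} {u : ℕ}

theorem Feasible.minProd_le (h : Feasible d u P) : minProd d u ≤ ∏ i, P i :=
  Nat.sInf_le ⟨P, h, rfl⟩

theorem exists_optimal (hd : ∀ i, 1 ≤ d i) (u : ℕ) : ∃ P, Optimal d u P := by
  have : {N | ∃ P, Feasible d u P ∧ ∏ i, P i = N}.Nonempty :=
    ⟨_, d, ⟨fun i => ⟨hd i, le_rfl⟩, by omega⟩, rfl⟩
  obtain ⟨P, hP, h⟩ := Nat.sInf_mem this
  exact ⟨P, hP, h⟩

theorem Feasible.optimal (h : Feasible d u P) (hQ : Optimal d u Q) (hPQ : ∏ i, P i ≤ ∏ i, Q i) :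
    Optimal d u P :=
  ⟨h, le_antisymm (hPQ.trans hQ.2.le) h.minProd_le⟩

theorem Optimal.minProd_pos (h : Optimal d u P) : 0 < minProd d u := by
  rw [← h.2]
  exact Finset.prod_pos fun i _ => (h.1.1 i).1

theorem Feasible.comp (h : Feasible d u P) (π : Equiv.Perm (Fin n)) :
    Feasible (d ∘ π) u (P ∘ π) := by
  refine ⟨fun i => h.1 _, ?_⟩
  simp only [Function.comp_apply, Equiv.sum_comp π d, Equiv.sum_comp π P]
  exact h.2

theorem minProd_comp (d : Fin n → ℕ) (u : ℕ) (π : Equiv.Perm (Fin n)) :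
    minProd (d ∘ π) u = minProd d u := by
  unfold minProd
  congr 1
  ext N
  constructor
  · rintro ⟨P, hP, rfl⟩
    refine ⟨P ∘ π.symm, ?_, Equiv.prod_comp π.symm P⟩
    have := hP.comp π.symm
    rwa [Function.comp_assoc, Equiv.self_comp_symm, Function.comp_id] at this
  · rintro ⟨P, hP, rfl⟩
    exact ⟨P ∘ π, hP.comp π, Equiv.prod_comp π P⟩

theorem Optimal.comp (h : Optimal d u P) (π : Equiv.Perm (Fin n)) :
    Optimal (d ∘ π) u (P ∘ π) :=
  ⟨h.1.comp π, by rw [minProd_comp, ← h.2]; exact Equiv.prod_comp π P⟩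

/-- Shifting a unit from a smaller to a larger entry lowers the product, so in an optimal tuple
the larger of two nontrivial entries is as large as it can be. -/
theorem Optimal.eq_of_le (h : Optimal d u P) {a b : Fin n} (hab : a ≠ b) (ha : 1 < P a)
    (hle : P a ≤ P b) : P b = d b := by
  by_contra hb
  have hlt : P b < d b := lt_of_le_of_ne (h.1.1 b).2 hb
  set Q : Fin n → ℕ := Function.update (Function.update P a (P a - 1)) b (P b + 1) with hQ
  have hQa : Q a = P a - 1 := by simp [hQ, hab]
  have hQb : Q b = P b + 1 := by simp [hQ]
  have hQc : ∀ c, c ≠ a → c ≠ b → Q c = P c := fun c h1 h2 => by simp [hQ, h1, h2]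
  have hba : b ∈ Finset.univ.erase a := by simp [hab.symm]
  have hrest : ∀ c ∈ (Finset.univ.erase a).erase b, Q c = P c := fun c hc =>
    hQc c (by simp at hc; tauto) (by simp at hc; tauto)
  have hsum : ∑ i, Q i = ∑ i, P i := by
    rw [← Finset.add_sum_erase _ Q (Finset.mem_univ a), ← Finset.add_sum_erase _ Q hba,
      ← Finset.add_sum_erase _ P (Finset.mem_univ a), ← Finset.add_sum_erase _ P hba,
      Finset.sum_congr rfl hrest, hQa, hQb]
    have key : ∀ s, P a - 1 + (P b + 1 + s) = P a + (P b + s) := fun s => by omega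
    exact key _
  have hfeas : Feasible d u Q := by
    refine ⟨fun c => ?_, by rw [hsum]; exact h.1.2⟩
    have hc := h.1.1 c
    by_cases h1 : c = a
    · subst h1; rw [hQa]; omega
    · by_cases h2 : c = b
      · subst h2; rw [hQb]; omega
      · rw [hQc c h1 h2]; exact hc
  have hpos : 0 < ∏ c ∈ (Finset.univ.erase a).erase b, P c :=
    Finset.prod_pos fun i _ => (h.1.1 i).1
  have hprod : ∏ i, Q i < ∏ i, P i := by
    rw [← Finset.mul_prod_erase _ Q (Finset.mem_univ a), ← Finset.mul_prod_erase _ Q hba,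
      ← Finset.mul_prod_erase _ P (Finset.mem_univ a), ← Finset.mul_prod_erase _ P hba,
      Finset.prod_congr rfl hrest, hQa, hQb, ← mul_assoc, ← mul_assoc]
    refine Nat.mul_lt_mul_of_pos_right ?_ hpos
    obtain ⟨x, hx⟩ : ∃ x, P a = x + 1 := ⟨P a - 1, by omega⟩
    rw [hx] at hle ⊢
    simp only [Nat.add_sub_cancel]
    -- With P a = x + 1 the claim is x * (P b + 1) < (x + 1) * P b, that is, x < P b.
    nlinarith
  exact absurd (hfeas.minProd_le) (by rw [← h.2]; omega)

/-- Every entry but the first nontrivial one is trivial or as large as it can be. -/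
def Threshold (d P : Fin n → ℕ) : Prop := ∀ a b, a < b → 1 < P a → P b = d b

theorem Optimal.threshold (h : Optimal d u P) (hP : Monotone P) : Threshold d P :=
  fun _ _ hab ha => h.eq_of_le hab.ne ha (hP hab.le)

/-- Suppose P exceeds Q at i. If Q exceeded P at an earlier b, then Q b > 1 would make Q i = d i ≥ P
i. After i, P is maximal because P i > 1. -/
theorem Threshold.le_total (hP : Threshold d P) (hQ : Threshold d Q)
    (hP' : ∀ i, 1 ≤ P i ∧ P i ≤ d i) (hQ' : ∀ i, 1 ≤ Q i ∧ Q i ≤ d i) : P ≤ Q ∨ Q ≤ P := by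
  by_cases h : P ≤ Q
  · exact Or.inl h
  · right
    simp only [Pi.le_def, not_forall, not_le] at h
    obtain ⟨i, hi⟩ := h
    intro b
    change Q b ≤ P b
    rcases lt_trichotomy b i with hb | rfl | hb
    · by_contra hlt
      have := hQ b i hb (by have := hP' b; omega)
      have := hP' i
      omega
    · exact hi.le
    · rw [hP i b hb (by have := hQ' i; omega)]
      exact (hQ' b).2

theorem eq_of_le_of_prod_le (hP : ∀ i, 1 ≤ P i) (hle : P ≤ Q)
    (h : ∏ i, Q i ≤ ∏ i, P i) : P = Q := by
  by_contra hne
  obtain ⟨i, hi⟩ : ∃ i, P i ≠ Q i := Function.ne_iff.1 hne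
  have := Finset.prod_lt_prod (fun i _ => hP i) (fun i _ => hle i)
    ⟨i, Finset.mem_univ i, lt_of_le_of_ne (hle i) hi⟩
  omega

/-- Sorted optimal tuples have the threshold shape, so they are comparable. Comparable tuples of
positive integers with equal products coincide. -/
theorem Optimal.eq_of_monotone (hP : Optimal d u P) (hQ : Optimal d u Q) (hPm : Monotone P)
    (hQm : Monotone Q) : P = Q := by
  rcases (hP.threshold hPm).le_total (hQ.threshold hQm) hP.1.1 hQ.1.1 with h | h
  · exact eq_of_le_of_prod_le (fun i => (hP.1.1 i).1) h (by rw [hP.2, hQ.2])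
  · exact (eq_of_le_of_prod_le (fun i => (hQ.1.1 i).1) h (by rw [hP.2, hQ.2])).symm

/-- If the sorted entry at i exceeded d i, all entries sorted to i or later would come from
positions strictly beyond i, and there is one position too few. -/
theorem sort_le_of_le (hd : Monotone d) (h : P ≤ d) : P ∘ Tuple.sort P ≤ d := by
  intro i
  by_contra hlt
  rw [not_le] at hlt
  have hsub : (Finset.Ici i).image (Tuple.sort P) ⊆ Finset.Ioi i := by
    intro x hx
    obtain ⟨k, hk, rfl⟩ := Finset.mem_image.1 hx
    rw [Finset.mem_Ioi]
    by_contra hle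
    have h1 := Tuple.monotone_sort P (Finset.mem_Ici.1 hk)
    have h2 := h (Tuple.sort P k)
    have h3 := hd (not_lt.1 hle)
    simp only [Function.comp_apply] at *
    omega
  have := Finset.card_le_card hsub
  rw [Finset.card_image_of_injective _ (Equiv.injective _), Fin.card_Ici, Fin.card_Ioi] at this
  omega

theorem Optimal.sort (h : Optimal d u P) (hd : Monotone d) :
    Optimal d u (P ∘ Tuple.sort P) := by
  refine ⟨⟨fun i => ⟨(h.1.1 _).1, sort_le_of_le hd (fun i => (h.1.1 i).2) i⟩, ?_⟩, ?_⟩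
  · simp only [Function.comp_apply, Equiv.sum_comp _ P]
    exact h.1.2
  · rw [← h.2]
    exact Equiv.prod_comp _ P

/-- Optimal tuples are permutations of each other. -/
theorem Optimal.exists_perm (hP : Optimal d u P) (hQ : Optimal d u Q) :
    ∃ τ : Equiv.Perm (Fin n), P = Q ∘ τ := by
  -- Permuting d and the tuple simultaneously preserves optimality, so d may be sorted first. Then
  -- each tuple can be sorted on its own without violating the bounds.
  set π := Tuple.sort d
  have hP' := (hP.comp π).sort (Tuple.monotone_sort d)
  have hQ' := (hQ.comp π).sort (Tuple.monotone_sort d)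
  have h := hP'.eq_of_monotone hQ' (Tuple.monotone_sort _) (Tuple.monotone_sort _)
  set α := Tuple.sort (P ∘ π)
  set β := Tuple.sort (Q ∘ π)
  refine ⟨π.symm.trans (α.symm.trans (β.trans π)), ?_⟩
  ext i
  have := congrFun h (α.symm (π.symm i))
  simpa using this

/-- A nontrivial entry of an optimal tuple is at least as large as every entry that is neither
trivial nor maximal, even of another optimal tuple. -/
theorem Optimal.eq_one_or_le (hP : Optimal d u P) (hQ : Optimal d u Q) {a : Fin n}
    (ha : P a < d a) (b : Fin n) : Q b = 1 ∨ P a ≤ Q b := by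
  obtain ⟨τ, rfl⟩ := hQ.exists_perm hP
  by_contra h
  push Not at h
  simp only [Function.comp_apply] at h
  have h1 := (hP.1.1 (τ b)).1
  have hne : τ b ≠ a := by
    intro h'
    rw [h'] at h
    omega
  have := hP.eq_of_le hne (by omega) h.2.le
  omega

/-- An optimal tuple has at most one entry that is neither trivial nor maximal: of two such entries
the smaller would force the larger to be maximal. -/
theorem Optimal.eq_one_of_lt (hP : Optimal d u P) {a b : Fin n} (hab : a ≠ b) (ha₁ : 1 < P a)
    (ha : P a < d a) (hb : P b < d b) : P b = 1 := by
  by_contra h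
  have h1 := (hP.1.1 b).1
  rcases le_total (P a) (P b) with h' | h'
  · exact absurd (hP.eq_of_le hab ha₁ h') hb.ne
  · exact absurd (hP.eq_of_le hab.symm (by omega) h') ha.ne

/-- The numerical side of slicing. A tuple for the slices, in which the coordinate a is trivial, is
completed by the number w of nonempty slices; the d a - w empty slices use the rest of the budget u.
-/
theorem Feasible.update {a : Fin n} {v : ℕ} (hP : Feasible (Function.update d a 1) v P)
    {w : ℕ} (hw : 1 ≤ w) (hwd : w ≤ d a) (hv : v + (d a - w) = u) :
    Feasible d u (Function.update P a w) ∧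
      ∏ i, Function.update P a w i = w * ∏ i, P i := by
  have hPa : P a = 1 := by
    have := hP.1 a
    rw [Function.update_self] at this
    omega
  refine ⟨⟨fun i => ?_, ?_⟩, ?_⟩
  · by_cases h : i = a
    · subst h
      simp [hw, hwd]
    · have := hP.1 i
      simpa [h] using this
  · have h := hP.2
    rw [Finset.sum_update_of_mem (Finset.mem_univ a)] at h ⊢
    rw [← Finset.add_sum_erase _ P (Finset.mem_univ a), hPa] at h
    rw [← Finset.add_sum_erase _ d (Finset.mem_univ a)]
    simp only [Finset.sdiff_singleton_eq_erase] at h ⊢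
    omega
  · rw [Finset.prod_update_of_mem (Finset.mem_univ a),
      ← Finset.mul_prod_erase _ P (Finset.mem_univ a), hPa, one_mul,
      Finset.sdiff_singleton_eq_erase]

/-- The tuple which is trivial before `j`, has entry `w` at `j` and is maximal after `j`. -/
def thresholdTuple (d : Fin n → ℕ) (j : Fin n) (w : ℕ) (i : Fin n) : ℕ :=
  if i < j then 1 else if i = j then w else d i

/-- A sorted optimal tuple is comparable with this one. If it is entrywise at least as large, the
product here is no larger. It cannot be strictly smaller, because the deficiency here is already
exactly u. -/
theorem optimal_thresholdTuple (hd : Monotone d) (hd₁ : ∀ i, 1 ≤ d i) (j : Fin n) {ℓ : ℕ}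
    (hℓ : ℓ < d j) (hu : u = ∑ i ∈ Finset.Iio j, (d i - 1) + ℓ) :
    Optimal d u (thresholdTuple d j (d j - ℓ)) := by
  set D := thresholdTuple d j (d j - ℓ) with hD
  have hD₁ : ∀ i, 1 ≤ D i ∧ D i ≤ d i := by
    intro i
    have := hd₁ i
    simp only [hD, thresholdTuple]
    split_ifs with h1 h2
    · omega
    · subst h2; omega
    · omega
  have hsum : ∑ i, d i = ∑ i, D i + u := by
    have h1 : ∀ i, d i = D i + (d i - D i) := fun i => by have := hD₁ i; omega
    rw [Finset.sum_congr rfl fun i _ => h1 i, Finset.sum_add_distrib, hu]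
    congr 1
    have h2 : ∀ i, d i - D i = (if i < j then d i - 1 else 0) + if i = j then ℓ else 0 := by
      intro i
      simp only [hD, thresholdTuple]
      split_ifs with h1 h2 h2
      · subst h2; exact absurd h1 (lt_irrefl _)
      · rfl
      · subst h2; omega
      · omega
    rw [Finset.sum_congr rfl fun i _ => h2 i, Finset.sum_add_distrib]
    simp only [Finset.sum_ite_eq', Finset.mem_univ, if_true]
    rw [← Finset.sum_filter]
    congr 2
    ext i
    simp
  have hfeas : Feasible d u D := ⟨hD₁, hsum.le⟩
  have hthr : Threshold d D := by
    intro a b hab ha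
    simp only [hD, thresholdTuple] at ha ⊢
    split_ifs at ha with h1 h2
    · omega
    · subst h2
      rw [if_neg hab.not_gt, if_neg hab.ne']
    · rw [if_neg (by order), if_neg (by order)]
  obtain ⟨Q, hQ⟩ := exists_optimal hd₁ u
  have hQ' := hQ.sort hd
  rcases hthr.le_total (hQ'.threshold (Tuple.monotone_sort Q)) hD₁ hQ'.1.1 with h | h
  · exact hfeas.optimal hQ' (Finset.prod_le_prod' fun i _ => h i)
  · have heq : Q ∘ Tuple.sort Q = D := by
      by_contra hne
      obtain ⟨i, hi⟩ := Function.ne_iff.1 hne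
      have := Finset.sum_lt_sum (fun i _ => h i) ⟨i, Finset.mem_univ i, lt_of_le_of_ne (h i) hi⟩
      have := hQ'.1.2
      omega
    rwa [heq] at hQ'

/-- Up to a permutation preserving `d`, every optimal tuple is a threshold tuple whose exceptional
entry is moved from `j` to some `k ≤ j`. -/
theorem Optimal.exists_perm_eq (hd : Monotone d) (hd₁ : ∀ i, 1 ≤ d i) (j : Fin n)
    {ℓ : ℕ} (hℓ₀ : 0 < ℓ) (hℓ : ℓ < d j) (hu : u = ∑ i ∈ Finset.Iio j, (d i - 1) + ℓ)
    (hP : Optimal d u P) :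
    ∃ π : Equiv.Perm (Fin n), d ∘ π = d ∧ ∃ k ≤ j, d j - ℓ ≤ d k ∧
      ∀ i, P (π i) = if i ≤ j then (if i = k then d j - ℓ else 1) else d i := by
  have hD := optimal_thresholdTuple hd hd₁ j hℓ hu
  set D := thresholdTuple d j (d j - ℓ) with hDdef
  obtain ⟨τ, rfl⟩ := hP.exists_perm hD
  have hDlt : ∀ i, i < j → D i = 1 := fun i hi => by simp [hDdef, thresholdTuple, hi]
  have hDj : D j = d j - ℓ := by simp [hDdef, thresholdTuple]
  have hDgt : ∀ i, j < i → D i = d i := fun i hi => by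
    simp [hDdef, thresholdTuple, hi.not_gt, hi.ne']
  have hcount : ∀ x, (Finset.univ.filter fun i => x ≤ D (τ i)).card =
      (Finset.univ.filter fun i => x ≤ D i).card := by
    intro x
    refine Finset.card_bij (fun i _ => τ i) ?_ (fun _ _ _ _ h => τ.injective h) ?_
    · intro a ha; simpa using ha
    · intro b hb; exact ⟨τ.symm b, by simpa using hb, by simp⟩
  have hDle : ∀ x, d j ≤ x → ∀ i, x ≤ D i → j < i := by
    intro x hx i hi
    by_contra h
    rcases lt_or_eq_of_le (not_lt.1 h) with h | rfl
    · rw [hDlt i h] at hi; omega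
    · rw [hDj] at hi; omega
  -- Since D ∘ τ ≤ d, its entries of size at least d i sit at positions b with d b ≥ d i > d j.
  -- These lie beyond j, where D is maximal too. Both tuples have equally many such entries, so the
  -- two sets of positions agree.
  have hbig : ∀ i, d j < d i → D (τ i) = d i := by
    intro i hi
    have hsub : (Finset.univ.filter fun b => d i ≤ D (τ b)) ⊆
        Finset.univ.filter fun b => d i ≤ D b := by
      intro b hb
      simp only [Finset.mem_filter, Finset.mem_univ, true_and] at hb ⊢
      have h1 := (hP.1.1 b).2
      simp only [Function.comp_apply] at h1
      rw [hDgt b (by by_contra h; have := hd (not_lt.1 h); omega)]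
      omega
    have heq := Finset.eq_of_subset_of_card_le hsub (hcount _).ge
    have : i ∈ Finset.univ.filter fun b => d i ≤ D b := by
      simp only [Finset.mem_filter, Finset.mem_univ, true_and]
      rw [hDgt i (by by_contra h; have := hd (not_lt.1 h); omega)]
    rw [← heq] at this
    simp only [Finset.mem_filter, Finset.mem_univ, true_and] at this
    exact le_antisymm (hP.1.1 i).2 this
  have hfull : ∀ i, d j ≤ D (τ i) → D (τ i) = d i := by
    intro i hi
    rcases lt_or_ge (d j) (d i) with h | h
    · exact hbig i h
    · exact le_antisymm (hP.1.1 i).2 (h.trans hi)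
  -- Sorting by g sorts by d first and, among equal values of d, puts the positions with large
  -- entries last. As d is already sorted, the permutation preserves it.
  set g : Fin n → ℕ := fun i => 2 * d i + if d j ≤ D (τ i) then 1 else 0 with hg
  set π := Tuple.sort g with hπ
  have hgm : Monotone (g ∘ π) := Tuple.monotone_sort g
  have hgd : ∀ i, g i / 2 = d i := by
    intro i
    simp only [hg]
    split_ifs <;> omega
  have hdπ : d ∘ π = d := by
    have h1 : Monotone (d ∘ π) := by
      intro a b hab
      simp only [Function.comp_apply, ← hgd]
      exact Nat.div_le_div_right (hgm hab)
    have h2 : Monotone (d ∘ (Equiv.refl (Fin n))) := by simpa using hd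
    have := Tuple.unique_monotone h1 h2
    simpa using this
  have hup : ∀ a b, a ≤ b → d j ≤ D (τ (π a)) → d j ≤ D (τ (π b)) := by
    intro a b hab ha
    by_contra hb
    have h1 := hgm hab
    simp only [Function.comp_apply, hg, if_pos ha, if_neg hb] at h1
    have h2 := (hP.1.1 (π a)).2
    simp only [Function.comp_apply] at h2
    exact hb (by rw [hbig (π b) (by omega)]; omega)
  have hU : (Finset.univ.filter fun i => d j ≤ D (τ (π i))) = Finset.Ioi j := by
    have hcard : (Finset.univ.filter fun i => d j ≤ D (τ (π i))).card = (Finset.Ioi j).card := by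
      have h1 : (Finset.univ.filter fun i => d j ≤ D (τ (π i))).card =
          (Finset.univ.filter fun i => d j ≤ D i).card := by
        rw [← hcount]
        refine Finset.card_bij (fun i _ => π i) ?_ (fun _ _ _ _ h => π.injective h) ?_
        · intro a ha; simpa using ha
        · intro b hb; exact ⟨π.symm b, by simpa using hb, by simp⟩
      rw [h1]
      congr 1
      ext i
      simp only [Finset.mem_filter, Finset.mem_univ, true_and, Finset.mem_Ioi]
      exact ⟨hDle _ le_rfl i, fun h => by rw [hDgt i h]; exact hd h.le⟩
    refine Finset.eq_of_subset_of_card_le ?_ hcard.ge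
    intro a ha
    rw [Finset.mem_Ioi]
    by_contra haj
    simp only [Finset.mem_filter, Finset.mem_univ, true_and] at ha
    have hsub : Finset.Ici a ⊆ Finset.univ.filter fun i => d j ≤ D (τ (π i)) := by
      intro b hb
      simp only [Finset.mem_filter, Finset.mem_univ, true_and]
      exact hup a b (Finset.mem_Ici.1 hb) ha
    have := Finset.card_le_card hsub
    rw [hcard, Fin.card_Ici, Fin.card_Ioi] at this
    have : a ≤ j := not_lt.1 haj
    omega
  have hmem : ∀ i, d j ≤ D (τ (π i)) ↔ j < i := by
    intro i
    have : i ∈ (Finset.univ.filter fun i => d j ≤ D (τ (π i))) ↔ i ∈ Finset.Ioi j := by rw [hU]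
    simpa using this
  have hkj : D (τ (π (π.symm (τ.symm j)))) = d j - ℓ := by simp [hDj]
  refine ⟨π, hdπ, π.symm (τ.symm j), ?_, ?_, ?_⟩
  · by_contra h
    have := (hmem _).2 (not_le.1 h)
    omega
  · rw [← hkj]
    have h1 := (hP.1.1 (π (π.symm (τ.symm j)))).2
    have h2 := congrFun hdπ (π.symm (τ.symm j))
    simp only [Function.comp_apply] at h1 h2
    rwa [h2] at h1
  · intro i
    simp only [Function.comp_apply]
    split_ifs with h1 h2
    · rw [h2, hkj]
    · have h3 : ¬ d j ≤ D (τ (π i)) := by rw [hmem]; exact not_lt.2 h1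
      refine hDlt _ ?_
      rcases lt_trichotomy (τ (π i)) j with h | h | h
      · exact h
      · exact absurd (by rw [← h]; simp) h2
      · rw [hDgt _ h] at h3
        exact absurd (hd h.le) h3
    · rw [hfull _ ((hmem i).2 (not_le.1 h1))]
      exact congrFun hdπ i

end Products

end AffineCartesian

namespace AffineCartesian

/-! ### Polynomial functions of bounded degree. -/

section PolyFun

open MvPolynomial

variable {F : Type*} [Field F] {n : ℕ}

/-- The functions on `F ^ n` given by polynomials of total degree at most `u`. -/
def PolyFun (u : ℕ) (φ : (Fin n → F) → F) : Prop :=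
  ∃ p : MvPolynomial (Fin n) F, p.totalDegree ≤ u ∧ ∀ x, eval x p = φ x

namespace PolyFun

variable {u v : ℕ} {φ ψ : (Fin n → F) → F}

theorem mono (h : PolyFun u φ) (huv : u ≤ v) : PolyFun v φ := by
  obtain ⟨p, hp, h⟩ := h
  exact ⟨p, hp.trans huv, h⟩

theorem const (c : F) : PolyFun u fun _ : Fin n → F => c :=
  ⟨C c, by simp, by simp⟩

theorem coord (i : Fin n) : PolyFun 1 fun x : Fin n → F => x i :=
  ⟨X i, by simp, by simp⟩

theorem add (hφ : PolyFun u φ) (hψ : PolyFun u ψ) : PolyFun u fun x => φ x + ψ x := by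
  obtain ⟨p, hp, hp'⟩ := hφ
  obtain ⟨q, hq, hq'⟩ := hψ
  exact ⟨p + q, (totalDegree_add p q).trans (max_le hp hq), by simp [hp', hq']⟩

theorem sub (hφ : PolyFun u φ) (hψ : PolyFun u ψ) : PolyFun u fun x => φ x - ψ x := by
  obtain ⟨p, hp, hp'⟩ := hφ
  obtain ⟨q, hq, hq'⟩ := hψ
  exact ⟨p - q, (totalDegree_sub p q).trans (max_le hp hq), by simp [hp', hq']⟩

theorem mul (hφ : PolyFun u φ) (hψ : PolyFun v ψ) : PolyFun (u + v) fun x => φ x * ψ x := by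
  obtain ⟨p, hp, hp'⟩ := hφ
  obtain ⟨q, hq, hq'⟩ := hψ
  exact ⟨p * q, (totalDegree_mul p q).trans (add_le_add hp hq), by simp [hp', hq']⟩

theorem const_mul (hφ : PolyFun u φ) (c : F) : PolyFun u fun x => c * φ x := by
  simpa using (const (u := 0) c).mul hφ

theorem pow (hφ : PolyFun u φ) (k : ℕ) : PolyFun (k * u) fun x => φ x ^ k := by
  obtain ⟨p, hp, hp'⟩ := hφ
  exact ⟨p ^ k, (totalDegree_pow p k).trans (Nat.mul_le_mul_left k hp), by simp [hp']⟩

theorem sum {κ : Type*} (s : Finset κ) (f : κ → (Fin n → F) → F)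
    (h : ∀ k ∈ s, PolyFun u (f k)) : PolyFun u fun x => ∑ k ∈ s, f k x := by
  classical
  induction s using Finset.induction_on with
  | empty => simpa using const (u := u) (n := n) (0 : F)
  | insert a s ha ih =>
    simp only [Finset.sum_insert ha]
    exact (h a (by simp)).add (ih fun k hk => h k (by simp [hk]))

theorem prod {κ : Type*} (s : Finset κ) (f : κ → (Fin n → F) → F) (e : κ → ℕ)
    (h : ∀ k ∈ s, PolyFun (e k) (f k)) : PolyFun (∑ k ∈ s, e k) fun x => ∏ k ∈ s, f k x := by
  classical
  induction s using Finset.induction_on with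
  | empty => simpa using const (u := 0) (n := n) (1 : F)
  | insert a s ha ih =>
    simp only [Finset.prod_insert ha, Finset.sum_insert ha]
    exact (h a (by simp)).mul (ih fun k hk => h k (by simp [hk]))

theorem eq_sum (h : PolyFun u φ) : ∃ p : MvPolynomial (Fin n) F,
    (∀ s ∈ p.support, ∑ i, s i ≤ u) ∧ ∀ x, φ x = ∑ s ∈ p.support, coeff s p * ∏ i, x i ^ s i := by
  obtain ⟨p, hp, h⟩ := h
  refine ⟨p, fun s hs => ?_, fun x => by rw [← h, eval_eq']⟩
  have := (le_totalDegree hs).trans hp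
  rwa [Finsupp.sum_fintype _ _ (fun _ => rfl)] at this

theorem comp {g : Fin n → (Fin n → F) → F} (h : PolyFun u φ) (hg : ∀ i, PolyFun 1 (g i)) :
    PolyFun u fun x => φ fun i => g i x := by
  obtain ⟨p, hp, h⟩ := h.eq_sum
  simp only [h]
  refine sum _ _ fun s hs => ((prod _ _ s fun i _ => ?_).mono (hp s hs)).const_mul _
  simpa using (hg i).pow (s i)

/-- The coordinates of an affine map have degree at most one. This invariance is what permits every
later normalisation by automorphisms. -/
theorem comp_affineEquiv (h : PolyFun u φ) (σ : (Fin n → F) ≃ᵃ[F] (Fin n → F)) :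
    PolyFun u fun x => φ (σ x) := by
  refine h.comp (g := fun i x => σ x i) fun i => ?_
  have h1 : ∀ x : Fin n → F, σ x i =
      (∑ b, σ.linear (Pi.single b 1) i * x b) + σ 0 i := by
    intro x
    have h2 : σ x = σ.linear x + σ 0 := by
      have := σ.map_vadd 0 x
      simpa using this
    have h3 := LinearMap.pi_apply_eq_sum_univ σ.linear.toLinearMap x
    rw [LinearEquiv.coe_coe] at h3
    rw [h2, Pi.add_apply, h3]
    simp only [Finset.sum_apply, Pi.smul_apply, smul_eq_mul]
    congr 1
    refine Finset.sum_congr rfl fun b _ => ?_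
    have h4 : (fun k => if b = k then (1 : F) else 0) = Pi.single b 1 := by
      ext k
      simp [Pi.single_apply, eq_comm]
    rw [mul_comm, h4]
  rw [funext h1]
  exact (sum _ _ fun b _ => (coord b).const_mul _).add (const _)

theorem eq_const (h : PolyFun 0 φ) (x y : Fin n → F) : φ x = φ y := by
  obtain ⟨p, hp, h⟩ := h
  rw [← h, ← h, totalDegree_eq_zero_iff_eq_C.1 (Nat.le_zero.1 hp)]
  simp

/-- Division with remainder by `X_a - c`. -/
theorem exists_div (h : PolyFun (u + 1) φ) (a : Fin n) (c : F) :
    ∃ ψ : (Fin n → F) → F, PolyFun u ψ ∧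
      ∀ x, φ x = (x a - c) * ψ x + φ (Function.update x a c) := by
  obtain ⟨p, hp, h⟩ := h.eq_sum
  -- Monomial by monomial, x ^ e - c ^ e = (x - c) * ∑ x ^ m * c ^ (e - 1 - m), which costs one
  -- degree.
  refine ⟨fun x => ∑ s ∈ p.support, coeff s p *
    ((∑ m ∈ Finset.range (s a), x a ^ m * c ^ (s a - 1 - m)) *
      ∏ i ∈ Finset.univ.erase a, x i ^ s i), ?_, ?_⟩
  · refine sum _ _ fun s hs => const_mul ?_ _
    rcases Nat.eq_zero_or_pos (s a) with h0 | h0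
    · simp only [h0, Finset.range_zero, Finset.sum_empty, zero_mul]
      exact const 0
    · have h1 : PolyFun (s a - 1) fun x : Fin n → F =>
          ∑ m ∈ Finset.range (s a), x a ^ m * c ^ (s a - 1 - m) := by
        refine sum _ _ fun m hm => ?_
        have := ((coord (F := F) a).pow m).mul (const (u := 0) (c ^ (s a - 1 - m)))
        exact this.mono (by have := Finset.mem_range.1 hm; omega)
      have h2 : PolyFun (∑ i ∈ Finset.univ.erase a, s i) fun x : Fin n → F =>
          ∏ i ∈ Finset.univ.erase a, x i ^ s i :=
        prod _ _ _ fun i _ => by simpa using (coord (F := F) i).pow (s i)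
      refine (h1.mul h2).mono ?_
      have := hp s hs
      rw [← Finset.add_sum_erase _ _ (Finset.mem_univ a)] at this
      omega
  · intro x
    rw [h, h, Finset.mul_sum, ← Finset.sum_add_distrib]
    refine Finset.sum_congr rfl fun s _ => ?_
    have h1 : ∏ i ∈ Finset.univ.erase a, Function.update x a c i ^ s i =
        ∏ i ∈ Finset.univ.erase a, x i ^ s i :=
      Finset.prod_congr rfl fun i hi => by rw [Function.update_of_ne (Finset.ne_of_mem_erase hi)]
    rw [← Finset.mul_prod_erase _ _ (Finset.mem_univ a),
      ← Finset.mul_prod_erase _ _ (Finset.mem_univ a), h1, Function.update_self]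
    have h2 := geom_sum₂_mul (x a) c (s a)
    linear_combination (-coeff s p * ∏ i ∈ Finset.univ.erase a, x i ^ s i) * h2

end PolyFun

end PolyFun

end AffineCartesian

namespace AffineCartesian

/-! ### Translations and shears. -/

section AffineMaps

variable {F : Type*} [Field F] {n : ℕ}

theorem inv_apply_self (σ : (Fin n → F) ≃ᵃ[F] (Fin n → F)) (x : Fin n → F) : σ⁻¹ (σ x) = x :=
  σ.symm_apply_apply x

theorem apply_inv_self (σ : (Fin n → F) ≃ᵃ[F] (Fin n → F)) (x : Fin n → F) : σ (σ⁻¹ x) = x :=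
  σ.apply_symm_apply x

/-- Translation in the direction of a coordinate. -/
def transl (a : Fin n) (c : F) : (Fin n → F) ≃ᵃ[F] (Fin n → F) :=
  AffineEquiv.constVAdd F (Fin n → F) (Pi.single a c)

theorem transl_apply (a : Fin n) (c : F) (x : Fin n → F) : transl a c x = Pi.single a c + x := rfl

theorem transl_apply_self (a : Fin n) (c : F) (x : Fin n → F) : transl a c x a = c + x a := by
  simp [transl_apply]

theorem transl_apply_of_ne {a i : Fin n} (h : i ≠ a) (c : F) (x : Fin n → F) :
    transl a c x i = x i := by
  simp [transl_apply, h]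

theorem transl_zero (a : Fin n) (x : Fin n → F) : transl a (0 : F) x = x := by
  simp [transl_apply]

/-- The linear map adding a combination `∑ w b * x b` of the other coordinates to the
coordinate `a`. -/
def shear (a : Fin n) (w : Fin n → F) (hw : w a = 0) : (Fin n → F) ≃ᵃ[F] (Fin n → F) :=
  LinearEquiv.toAffineEquiv
    { toFun := fun x => x + Pi.single a (∑ b, w b * x b)
      invFun := fun x => x - Pi.single a (∑ b, w b * x b)
      map_add' := fun x y => by
        ext i
        simp only [Pi.add_apply, Pi.single_apply, mul_add, Finset.sum_add_distrib]
        split_ifs <;> ring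
      map_smul' := fun c x => by
        ext i
        simp only [Pi.add_apply, Pi.smul_apply, Pi.single_apply, smul_eq_mul, RingHom.id_apply,
          mul_left_comm, mul_add]
        split_ifs <;> simp [Finset.mul_sum]
      left_inv := fun x => by
        have h : ∑ b, w b * ((x + Pi.single a (∑ b, w b * x b) : Fin n → F) b) = ∑ b, w b * x b := by
          simp [mul_add, Finset.sum_add_distrib, Pi.single_apply, hw]
        simp only [h]
        abel
      right_inv := fun x => by
        have h : ∑ b, w b * ((x - Pi.single a (∑ b, w b * x b) : Fin n → F) b) = ∑ b, w b * x b := by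
          simp [mul_sub, Finset.sum_sub_distrib, Pi.single_apply, hw]
        simp only [h]
        abel }

theorem shear_apply (a : Fin n) (w : Fin n → F) (hw : w a = 0) (x : Fin n → F) :
    shear a w hw x = x + Pi.single a (∑ b, w b * x b) := rfl

theorem shear_apply_self (a : Fin n) (w : Fin n → F) (hw : w a = 0) (x : Fin n → F) :
    shear a w hw x a = x a + ∑ b, w b * x b := by
  simp [shear_apply]

theorem shear_apply_of_ne {a i : Fin n} (h : i ≠ a) (w : Fin n → F) (hw : w a = 0)
    (x : Fin n → F) : shear a w hw x i = x i := by
  simp [shear_apply, h]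

end AffineMaps

/-! ### Boxes, their automorphisms, and slices of supports. -/

section Box

open scoped Classical in
/-- The elements of a subfield of a finite field. -/
noncomputable def elems {F : Type*} [Field F] [Fintype F] (k : Subfield F) : Finset F :=
  Finset.univ.filter (· ∈ k)

open scoped Classical in
/-- The points of the product of the subfields `K i` whose coordinates outside `I` vanish. -/
noncomputable def box {F : Type*} [Field F] [Fintype F] {n : ℕ} (K : Fin n → Subfield F)
    (I : Finset (Fin n)) : Finset (Fin n → F) :=
  Fintype.piFinset fun i => if i ∈ I then elems (K i) else {0}

/-- The sizes of the factors of `box K I`. -/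
noncomputable def dims {F : Type*} [Field F] [Fintype F] {n : ℕ} (K : Fin n → Subfield F)
    (I : Finset (Fin n)) (i : Fin n) : ℕ := if i ∈ I then (elems (K i)).card else 1

open scoped Classical in
/-- The support of a function on `box K I`. -/
noncomputable def supp {F : Type*} [Field F] [Fintype F] {n : ℕ} (K : Fin n → Subfield F)
    (I : Finset (Fin n)) (f : (Fin n → F) → F) : Finset (Fin n → F) :=
  (box K I).filter (f · ≠ 0)

variable {F : Type*} [Field F] [Fintype F] {n : ℕ} {K : Fin n → Subfield F}
  {I J : Finset (Fin n)} {u : ℕ} {f : (Fin n → F) → F}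

@[simp] theorem mem_elems {k : Subfield F} {x : F} : x ∈ elems k ↔ x ∈ k := by simp [elems]

theorem one_lt_card_elems (k : Subfield F) : 1 < (elems k).card :=
  Finset.one_lt_card.2 ⟨0, by simp [k.zero_mem], 1, by simp [k.one_mem], zero_ne_one⟩

theorem mem_box {x : Fin n → F} : x ∈ box K I ↔ ∀ i, x i ∈ K i ∧ (i ∉ I → x i = 0) := by
  rw [box, Fintype.mem_piFinset]
  refine forall_congr' fun i => ?_
  split_ifs with h
  · simp [h]
  · simp only [Finset.mem_singleton, h, not_false_eq_true, forall_const]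
    exact ⟨fun h => ⟨h ▸ (K i).zero_mem, h⟩, fun h => h.2⟩

theorem mem_box_univ {x : Fin n → F} : x ∈ box K Finset.univ ↔ ∀ i, x i ∈ K i := by
  simp [mem_box]

theorem card_box : (box K I).card = ∏ i, dims K I i := by
  rw [box, Fintype.card_piFinset]
  refine Finset.prod_congr rfl fun i _ => ?_
  unfold dims
  split_ifs <;> simp

theorem box_mono (h : I ⊆ J) : box K I ⊆ box K J := fun x hx => by
  rw [mem_box] at *
  exact fun i => ⟨(hx i).1, fun hi => (hx i).2 fun h' => hi (h h')⟩

theorem one_le_dims (i : Fin n) : 1 ≤ dims K I i := by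
  unfold dims
  split_ifs
  · exact (one_lt_card_elems _).le
  · rfl

theorem dims_of_mem {i : Fin n} (h : i ∈ I) : dims K I i = (elems (K i)).card := if_pos h

theorem dims_erase (a : Fin n) : dims K (I.erase a) = Function.update (dims K I) a 1 := by
  ext i
  by_cases h : i = a
  · subst h
    simp [dims]
  · simp [dims, h]

theorem mem_supp {x : Fin n → F} : x ∈ supp K I f ↔ x ∈ box K I ∧ f x ≠ 0 := by simp [supp]

theorem zero_mem_box : (0 : Fin n → F) ∈ box K I :=
  mem_box.2 fun i => ⟨(K i).zero_mem, fun _ => rfl⟩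

theorem update_mem_box {x : Fin n → F} (hx : x ∈ box K I) {a : Fin n} (ha : a ∈ I) {c : F}
    (hc : c ∈ K a) : Function.update x a c ∈ box K I := by
  rw [mem_box] at *
  intro i
  by_cases h : i = a
  · subst h
    simp [hc, ha]
  · simpa [h] using hx i

/-- The affine automorphisms of the product of the `K i` which preserve the coordinates
outside `J`. -/
def boxAut (K : Fin n → Subfield F) (J : Finset (Fin n)) :
    Subgroup ((Fin n → F) ≃ᵃ[F] (Fin n → F)) where
  carrier := {σ | (∀ x, σ x ∈ box K Finset.univ ↔ x ∈ box K Finset.univ) ∧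
    ∀ x, ∀ i, i ∉ J → σ x i = x i}
  mul_mem' := by
    intro σ τ hσ hτ
    exact ⟨fun x => (hσ.1 _).trans (hτ.1 x), fun x i hi => (hσ.2 _ i hi).trans (hτ.2 x i hi)⟩
  one_mem' := ⟨fun _ => Iff.rfl, fun _ _ _ => rfl⟩
  inv_mem' := by
    intro σ hσ
    have h : ∀ x, σ (σ⁻¹ x) = x := fun x => σ.apply_symm_apply x
    refine ⟨fun x => ?_, fun x i hi => ?_⟩
    · rw [← hσ.1, h]
    · have := hσ.2 (σ⁻¹ x) i hi
      rw [h] at this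
      exact this.symm

theorem boxAut_mono (h : I ⊆ J) : boxAut K I ≤ boxAut K J :=
  fun _ hσ => ⟨hσ.1, fun x i hi => hσ.2 x i fun h' => hi (h h')⟩

theorem apply_mem_box_iff {σ : (Fin n → F) ≃ᵃ[F] (Fin n → F)} (hσ : σ ∈ boxAut K I)
    {x : Fin n → F} : σ x ∈ box K I ↔ x ∈ box K I := by
  have h : ∀ y : Fin n → F, y ∈ box K I ↔ y ∈ box K Finset.univ ∧ ∀ i, i ∉ I → y i = 0 := by
    intro y
    rw [mem_box, mem_box_univ]
    exact forall_and
  rw [h, h, hσ.1]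
  refine and_congr_right fun _ => forall₂_congr fun i hi => ?_
  rw [hσ.2 x i hi]

theorem apply_mem_supp_iff {σ : (Fin n → F) ≃ᵃ[F] (Fin n → F)} (hσ : σ ∈ boxAut K I)
    {x : Fin n → F} : σ x ∈ supp K I f ↔ x ∈ supp K I fun x => f (σ x) := by
  rw [mem_supp, mem_supp, apply_mem_box_iff hσ]

theorem card_supp_comp {σ : (Fin n → F) ≃ᵃ[F] (Fin n → F)} (hσ : σ ∈ boxAut K I) :
    (supp K I fun x => f (σ x)).card = (supp K I f).card := by
  refine Finset.card_bij (fun x _ => σ x) (fun x hx => (apply_mem_supp_iff hσ).2 hx)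
    (fun _ _ _ _ h => σ.injective h) fun y hy => ⟨σ⁻¹ y, ?_, apply_inv_self σ y⟩
  rw [← apply_mem_supp_iff hσ, apply_inv_self]
  exact hy

theorem transl_mem {a : Fin n} {c : F} (hc : c ∈ K a) (ha : a ∈ J) : transl a c ∈ boxAut K J := by
  refine ⟨fun x => ?_, fun x i hi => transl_apply_of_ne (by rintro rfl; exact hi ha) c x⟩
  rw [mem_box_univ, mem_box_univ]
  refine forall_congr' fun i => ?_
  by_cases h : i = a
  · subst h
    rw [transl_apply_self]
    exact (K i).toAddSubgroup.add_mem_cancel_left hc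
  · rw [transl_apply_of_ne h]

/-- Coordinates from smaller fields may be added to a coordinate with a larger field, so that ∑ w b
* x b stays in K a. This asymmetry is where the order of the chain enters. -/
theorem shear_mem {a : Fin n} {w : Fin n → F} (hw : w a = 0) (ha : a ∈ J)
    (h : ∀ b, w b ∈ K a ∧ (w b ≠ 0 → K b ≤ K a)) : shear a w hw ∈ boxAut K J := by
  refine ⟨fun x => ?_, fun x i hi => shear_apply_of_ne (by rintro rfl; exact hi ha) w hw x⟩
  have key : (∀ b, b ≠ a → x b ∈ K b) → ∑ b, w b * x b ∈ K a := by
    intro hx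
    refine (K a).sum_mem fun b _ => ?_
    by_cases h0 : w b = 0
    · rw [h0, zero_mul]
      exact (K a).zero_mem
    · exact (K a).mul_mem (h b).1 ((h b).2 h0 (hx b (by rintro rfl; exact h0 hw)))
  rw [mem_box_univ, mem_box_univ]
  constructor
  · intro hx
    have h1 : ∀ b, b ≠ a → x b ∈ K b := fun b hb => by
      have := hx b
      rwa [shear_apply_of_ne hb] at this
    intro i
    by_cases hi : i = a
    · subst hi
      have := hx i
      rw [shear_apply_self] at this
      exact ((K i).toAddSubgroup.add_mem_cancel_right (key h1)).1 this
    · exact h1 i hi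
  · intro hx i
    by_cases hi : i = a
    · subst hi
      rw [shear_apply_self]
      exact (K i).add_mem (hx i) (key fun b _ => hx b)
    · rw [shear_apply_of_ne hi]
      exact hx i

/-- A function vanishing on some of the slices `x a = c` of a box is divisible by the
corresponding linear factors. -/
theorem PolyFun.exists_eq_prod_mul {a : Fin n} (ha : a ∈ I) (Z : Finset F) :
    ∀ (u : ℕ) (f : (Fin n → F) → F), PolyFun u f → Z ⊆ elems (K a) →
      (∀ x ∈ box K I, x a ∈ Z → f x = 0) → (supp K I f).Nonempty →
      ∃ v ψ, PolyFun v ψ ∧ v + Z.card = u ∧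
        ∀ x ∈ box K I, f x = (∏ c ∈ Z, (x a - c)) * ψ x := by
  classical
  induction Z using Finset.induction_on with
  | empty => exact fun u f hf _ _ _ => ⟨u, f, hf, by simp, by simp⟩
  | insert c Z hc ih =>
    intro u f hf hZ hvan hne
    have hcK : c ∈ K a := by simpa using hZ (Finset.mem_insert_self c Z)
    obtain ⟨x₀, hx₀⟩ := hne
    rw [mem_supp] at hx₀
    have hz : ∀ x ∈ box K I, f (Function.update x a c) = 0 := fun x hx =>
      hvan _ (update_mem_box hx ha hcK) (by simp)
    -- In degree 0 the function would be constant with a zero on the box, against its nonempty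
    -- support. So each linear factor can be paid for by one degree.
    obtain _ | u := u
    · exact absurd ((hf.eq_const _ _).trans (hz x₀ hx₀.1)) hx₀.2
    obtain ⟨g, hg, hfg⟩ := hf.exists_div a c
    have hfg' : ∀ x ∈ box K I, f x = (x a - c) * g x := fun x hx => by
      rw [hfg, hz x hx, add_zero]
    have hgx₀ : g x₀ ≠ 0 := by
      intro h
      rw [hfg' x₀ hx₀.1, h, mul_zero] at hx₀
      exact hx₀.2 rfl
    obtain ⟨v, ψ, hψ, hv, h⟩ := ih u g hg ((Finset.subset_insert c Z).trans hZ) (by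
      intro x hx hxa
      have h1 := hvan x hx (Finset.mem_insert_of_mem hxa)
      rw [hfg' x hx] at h1
      refine (mul_eq_zero.1 h1).resolve_left fun h2 => hc ?_
      rwa [← sub_eq_zero.1 h2]) ⟨x₀, mem_supp.2 ⟨hx₀.1, hgx₀⟩⟩
    refine ⟨v, ψ, hψ, by rw [Finset.card_insert_of_notMem hc]; omega, fun x hx => ?_⟩
    rw [hfg' x hx, h x hx, Finset.prod_insert hc, mul_assoc]

open scoped Classical in
/-- The values of the coordinate `a` on the support of `f`. -/
noncomputable def suppValues (K : Fin n → Subfield F) (I : Finset (Fin n)) (f : (Fin n → F) → F)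
    (a : Fin n) : Finset F := (supp K I f).image (· a)

open scoped Classical in
/-- The part of the support of `f` where the coordinate `a` has the value `c`. -/
noncomputable def suppSlice (K : Fin n → Subfield F) (I : Finset (Fin n)) (f : (Fin n → F) → F)
    (a : Fin n) (c : F) : Finset (Fin n → F) := (supp K I f).filter (· a = c)

theorem mem_suppValues {a : Fin n} {c : F} :
    c ∈ suppValues K I f a ↔ ∃ x ∈ supp K I f, x a = c := by simp [suppValues]

theorem mem_suppSlice {a : Fin n} {c : F} {x : Fin n → F} :
    x ∈ suppSlice K I f a c ↔ x ∈ supp K I f ∧ x a = c := by simp [suppSlice]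

theorem suppValues_subset (a : Fin n) : suppValues K I f a ⊆ elems (K a) := by
  intro c hc
  obtain ⟨x, hx, rfl⟩ := mem_suppValues.1 hc
  rw [mem_elems]
  exact (mem_box.1 (mem_supp.1 hx).1 a).1

theorem card_supp_eq_sum (a : Fin n) :
    (supp K I f).card = ∑ c ∈ suppValues K I f a, (suppSlice K I f a c).card := by
  classical
  refine Finset.card_eq_sum_card_fiberwise fun x hx => ?_
  exact mem_suppValues.2 ⟨x, hx, rfl⟩

theorem transl_mem_box_iff {a : Fin n} (ha : a ∈ I) {c : F} (hc : c ∈ K a) {x : Fin n → F} :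
    x ∈ box K (I.erase a) ↔ transl a c x ∈ box K I ∧ transl a c x a = c := by
  rw [apply_mem_box_iff (transl_mem hc ha), transl_apply_self, add_eq_left, mem_box, mem_box]
  constructor
  · intro h
    exact ⟨fun i => ⟨(h i).1, fun hi => (h i).2 fun h' => hi (Finset.mem_of_mem_erase h')⟩,
      (h a).2 (by simp)⟩
  · rintro ⟨h, h0⟩ i
    refine ⟨(h i).1, fun hi => ?_⟩
    by_cases hia : i = a
    · rw [hia, h0]
    · exact (h i).2 fun h' => hi (Finset.mem_erase.2 ⟨hia, h'⟩)

theorem card_suppSlice {a : Fin n} (ha : a ∈ I) {c : F} (hc : c ∈ K a) :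
    (suppSlice K I f a c).card = (supp K (I.erase a) fun x => f (transl a c x)).card := by
  symm
  refine Finset.card_bij (fun x _ => transl a c x) ?_ (fun _ _ _ _ h => (transl a c).injective h) ?_
  · intro x hx
    rw [mem_supp, transl_mem_box_iff ha hc] at hx
    exact mem_suppSlice.2 ⟨mem_supp.2 ⟨hx.1.1, hx.2⟩, hx.1.2⟩
  · intro y hy
    rw [mem_suppSlice, mem_supp] at hy
    refine ⟨(transl a c)⁻¹ y, ?_, apply_inv_self _ y⟩
    rw [mem_supp, transl_mem_box_iff ha hc, apply_inv_self]
    exact ⟨⟨hy.1.1, hy.2⟩, hy.1.2⟩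

/-- The empty slices split off as linear factors. On the nonempty slices these factors do not
vanish, so there f and the quotient ψ of lower degree have the same support. -/
theorem PolyFun.exists_slices (hf : PolyFun u f) (hne : (supp K I f).Nonempty) {a : Fin n}
    (ha : a ∈ I) :
    ∃ v ψ, PolyFun v ψ ∧ v + (dims K I a - (suppValues K I f a).card) = u ∧
      (∀ c ∈ suppValues K I f a, ∀ x ∈ box K (I.erase a),
        (f (transl a c x) ≠ 0 ↔ ψ (transl a c x) ≠ 0)) ∧
      ∀ c ∈ suppValues K I f a, (suppSlice K I f a c).card =
        (supp K (I.erase a) fun x => ψ (transl a c x)).card := by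
  classical
  obtain ⟨v, ψ, hψ, hv, h⟩ := PolyFun.exists_eq_prod_mul ha
    (elems (K a) \ suppValues K I f a) u f hf Finset.sdiff_subset (by
      intro x hx hxa
      by_contra h0
      exact (Finset.mem_sdiff.1 hxa).2 (mem_suppValues.2 ⟨x, mem_supp.2 ⟨hx, h0⟩, rfl⟩)) hne
  have key : ∀ c ∈ suppValues K I f a, ∀ x ∈ box K (I.erase a),
      (f (transl a c x) ≠ 0 ↔ ψ (transl a c x) ≠ 0) := by
    intro c hc x hx
    have hcK : c ∈ K a := by simpa using suppValues_subset a hc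
    have hx' := (transl_mem_box_iff ha hcK).1 hx
    rw [h _ hx'.1, hx'.2, mul_ne_zero_iff, and_iff_right]
    refine Finset.prod_ne_zero_iff.2 fun e he h0 => (Finset.mem_sdiff.1 he).2 ?_
    rwa [← sub_eq_zero.1 h0]
  refine ⟨v, ψ, hψ, ?_, key, fun c hc => ?_⟩
  · rw [dims_of_mem ha, ← Finset.card_sdiff_of_subset (suppValues_subset a), hv]
  · rw [card_suppSlice ha (by simpa using suppValues_subset a hc)]
    congr 1
    ext x
    rw [mem_supp, mem_supp]
    exact and_congr_right fun hx => key c hc x hx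

theorem suppSlice_nonempty {a : Fin n} {c : F} (hc : c ∈ suppValues K I f a) :
    (suppSlice K I f a c).Nonempty := by
  obtain ⟨x, hx, rfl⟩ := mem_suppValues.1 hc
  exact ⟨x, mem_suppSlice.2 ⟨hx, rfl⟩⟩

theorem card_suppValues_pos (hne : (supp K I f).Nonempty) (a : Fin n) :
    1 ≤ (suppValues K I f a).card := by
  obtain ⟨x, hx⟩ := hne
  exact Finset.card_pos.2 ⟨x a, mem_suppValues.2 ⟨x, hx, rfl⟩⟩

theorem card_suppValues_le {a : Fin n} (ha : a ∈ I) : (suppValues K I f a).card ≤ dims K I a := by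
  rw [dims_of_mem ha]
  exact Finset.card_le_card (suppValues_subset a)

/-- The minimum distance bound. -/
theorem PolyFun.minProd_le_card (hf : PolyFun u f) (hne : (supp K I f).Nonempty) :
    minProd (dims K I) u ≤ (supp K I f).card := by
  induction hI : I.card generalizing I u f with
  | zero =>
    have h1 : ∀ i, dims K I i = 1 := fun i => by
      rw [Finset.card_eq_zero.1 hI]
      simp [dims]
    have : Feasible (dims K I) u (dims K I) :=
      ⟨fun i => ⟨one_le_dims i, le_rfl⟩, by omega⟩
    refine this.minProd_le.trans ?_
    simp only [h1, Finset.prod_const_one]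
    exact Finset.card_pos.2 hne
  | succ N ih =>
    obtain ⟨a, ha⟩ : I.Nonempty := Finset.card_pos.1 (by omega)
    obtain ⟨v, ψ, hψ, hv, -, hcard⟩ := hf.exists_slices hne ha
    have hle : ∀ c ∈ suppValues K I f a,
        minProd (dims K (I.erase a)) v ≤ (suppSlice K I f a c).card := by
      intro c hc
      rw [hcard c hc]
      refine ih (hψ.comp_affineEquiv _) ?_ (by rw [Finset.card_erase_of_mem ha]; omega)
      rw [← Finset.card_pos, ← hcard c hc]
      exact Finset.card_pos.2 (suppSlice_nonempty hc)
    obtain ⟨P, hP⟩ := exists_optimal (d := dims K (I.erase a)) (fun i => one_le_dims i) v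
    rw [dims_erase] at hP
    obtain ⟨h1, h2⟩ := hP.1.update (card_suppValues_pos hne a) (card_suppValues_le ha) hv
    -- The weight is at least the number of nonempty slices times the inductive bound, and that
    -- product belongs to a feasible tuple.
    refine h1.minProd_le.trans ?_
    rw [h2, hP.2, card_supp_eq_sum a, ← smul_eq_mul]
    rw [← dims_erase]
    exact Finset.card_nsmul_le_sum _ _ _ hle

theorem supp_nonempty_of_card_eq (h : (supp K I f).card = minProd (dims K I) u) :
    (supp K I f).Nonempty := by
  obtain ⟨P, hP⟩ := exists_optimal (d := dims K I) (fun i => one_le_dims i) u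
  rw [← Finset.card_pos, h]
  exact hP.minProd_pos

/-- If the support of `f` is as small as possible, then all its nonempty slices in a coordinate
direction have the same size, and they are themselves as small as possible. -/
theorem PolyFun.exists_minimal_slices (hf : PolyFun u f)
    (hmin : (supp K I f).card = minProd (dims K I) u) {a : Fin n} (ha : a ∈ I) :
    (∀ c ∈ suppValues K I f a,
      (suppValues K I f a).card * (suppSlice K I f a c).card = (supp K I f).card) ∧
    ∃ v ψ, PolyFun v ψ ∧
      (∀ c ∈ suppValues K I f a, ∀ x ∈ box K (I.erase a),
        (f (transl a c x) ≠ 0 ↔ ψ (transl a c x) ≠ 0)) ∧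
      (∀ c ∈ suppValues K I f a, (supp K (I.erase a) fun x => ψ (transl a c x)).card =
        minProd (dims K (I.erase a)) v) ∧
      ∀ P, Optimal (dims K (I.erase a)) v P →
        Optimal (dims K I) u (Function.update P a (suppValues K I f a).card) := by
  have hne := supp_nonempty_of_card_eq hmin
  obtain ⟨v, ψ, hψ, hv, hiff, hcard⟩ := hf.exists_slices hne ha
  set T := suppValues K I f a with hT
  have hle : ∀ c ∈ T, minProd (dims K (I.erase a)) v ≤ (suppSlice K I f a c).card := by
    intro c hc
    rw [hcard c hc]
    refine (hψ.comp_affineEquiv _).minProd_le_card ?_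
    rw [← Finset.card_pos, ← hcard c hc]
    exact Finset.card_pos.2 (suppSlice_nonempty hc)
  have hup : ∀ P, Optimal (dims K (I.erase a)) v P →
      Feasible (dims K I) u (Function.update P a T.card) ∧
        ∏ i, Function.update P a T.card i = T.card * minProd (dims K (I.erase a)) v := by
    intro P hP
    rw [← hP.2]
    rw [dims_erase] at hP
    exact hP.1.update (card_suppValues_pos hne a) (card_suppValues_le ha) hv
  have hsum := card_supp_eq_sum (K := K) (I := I) (f := f) a
  rw [← hT] at hsum
  have hsum' := Finset.card_nsmul_le_sum _ _ _ hle
  rw [smul_eq_mul, ← hsum] at hsum'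
  obtain ⟨P₀, hP₀⟩ := exists_optimal (d := dims K (I.erase a)) (fun i => one_le_dims i) v
  -- The bound slice by slice and the feasibility of the completed tuple squeeze the cardinality, so
  -- equality holds in every slice.
  have hge : (supp K I f).card ≤ T.card * minProd (dims K (I.erase a)) v := by
    rw [hmin, ← (hup P₀ hP₀).2]
    exact (hup P₀ hP₀).1.minProd_le
  have heq : (supp K I f).card = T.card * minProd (dims K (I.erase a)) v := le_antisymm hge hsum'
  have hslice : ∀ c ∈ T, minProd (dims K (I.erase a)) v = (suppSlice K I f a c).card := by
    have h1 : ∑ c ∈ T, minProd (dims K (I.erase a)) v = ∑ c ∈ T, (suppSlice K I f a c).card := by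
      rw [← hsum, heq]
      simp
    exact (Finset.sum_eq_sum_iff_of_le hle).1 h1
  refine ⟨fun c hc => by rw [← hslice c hc, heq], v, ψ, hψ, hiff,
    fun c hc => by rw [hslice c hc, hcard c hc], fun P hP => ⟨(hup P hP).1, ?_⟩⟩
  rw [(hup P hP).2, ← heq, hmin]

end Box

end AffineCartesian

namespace AffineCartesian

/-! ### A double count over shears. -/

section Equidistribution

variable {F : Type*} [Field F] [Fintype F] {n : ℕ} {K : Fin n → Subfield F}
  {I : Finset (Fin n)}

open scoped Classical in
/-- The vectors with coordinates in `K a` supported on the coordinates before `a`. -/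
noncomputable def lowerVectors (K : Fin n → Subfield F) (a : Fin n) : Finset (Fin n → F) :=
  Fintype.piFinset fun b => if b < a then elems (K a) else {0}

theorem mem_lowerVectors {a : Fin n} {w : Fin n → F} :
    w ∈ lowerVectors K a ↔ ∀ b, w b ∈ K a ∧ (¬ b < a → w b = 0) := by
  rw [lowerVectors, Fintype.mem_piFinset]
  refine forall_congr' fun i => ?_
  split_ifs with h
  · simp [h]
  · simp only [Finset.mem_singleton, h, not_false_eq_true, forall_const]
    exact ⟨fun h => ⟨h ▸ (K a).zero_mem, h⟩, fun h => h.2⟩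

open scoped Classical in
-- Adding c / v b to the entry w b shifts the value v a + ∑ w i * v i by c. Hence each element of K
-- a is attained by equally many w.
theorem card_lowerVectors_fiber (hK : Monotone K) {a : Fin n} {v : Fin n → F}
    (hv : ∀ i, v i ∈ K i) {b : Fin n} (hb : b < a) (hvb : v b ≠ 0) :
    (elems (K a)).card * ((lowerVectors K a).filter fun w => v a + ∑ i, w i * v i = 0).card =
      (lowerVectors K a).card := by
  have hmem : ∀ w ∈ lowerVectors K a, v a + ∑ i, w i * v i ∈ elems (K a) := by
    intro w hw
    rw [mem_lowerVectors] at hw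
    rw [mem_elems]
    refine (K a).add_mem (hv a) ((K a).sum_mem fun i _ => ?_)
    by_cases hi : i < a
    · exact (K a).mul_mem (hw i).1 (hK hi.le (hv i))
    · rw [(hw i).2 hi, zero_mul]
      exact (K a).zero_mem
  rw [Finset.card_eq_sum_card_fiberwise hmem, ← smul_eq_mul, ← Finset.sum_const]
  refine Finset.sum_congr rfl fun c hc => ?_
  have hshift : ∀ (w : Fin n → F) (e : F), v a + ∑ i, (w + Pi.single b e : Fin n → F) i * v i =
      (v a + ∑ i, w i * v i) + e * v b := by
    intro w e
    simp [add_mul, Finset.sum_add_distrib, Pi.single_apply, add_assoc]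
  have hcl : ∀ w ∈ lowerVectors K a, ∀ e ∈ K a,
      (w + Pi.single b e : Fin n → F) ∈ lowerVectors K a := by
    intro w hw e he
    rw [mem_lowerVectors] at hw ⊢
    intro i
    by_cases hi : i = b
    · subst hi
      refine ⟨by simpa using (K a).add_mem (hw i).1 he, fun h => absurd hb h⟩
    · simpa [hi] using hw i
  have hce : c / v b ∈ K a := (K a).div_mem (by simpa using hc) (hK hb.le (hv b))
  refine Finset.card_bij (fun w _ => w + Pi.single b (c / v b)) ?_ ?_ ?_
  · intro w hw
    rw [Finset.mem_filter] at hw ⊢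
    refine ⟨hcl w hw.1 _ hce, ?_⟩
    rw [hshift, hw.2, zero_add, div_mul_cancel₀ _ hvb]
  · intro w _ w' _ h
    exact add_right_cancel h
  · intro w hw
    rw [Finset.mem_filter] at hw
    refine ⟨w + Pi.single b (-(c / v b)), ?_, ?_⟩
    · rw [Finset.mem_filter]
      refine ⟨hcl w hw.1 _ ((K a).neg_mem hce), ?_⟩
      rw [hshift, hw.2, neg_mul, div_mul_cancel₀ _ hvb, add_neg_cancel]
    · rw [add_assoc, ← Pi.single_add, neg_add_cancel, Pi.single_zero, add_zero]

open scoped Classical in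
-- Count the pairs (w, x), x ∈ S, for which x a + ∑ w b * x b has the same value at x and at p. A
-- point x differing from p before a occurs for a fraction 1 / |K a| of all w. A point agreeing with
-- p up to and including a occurs for all w, and one agreeing before a but not at a for none.
-- Comparing with the count supplied by the hypothesis gives the claim.
theorem card_agree_eq_mul (hK : Monotone K) {S : Finset (Fin n → F)} (hS : S ⊆ box K I)
    {a : Fin n}
    (h : ∀ w ∈ lowerVectors K a, ∀ c ∈ K a,
      (elems (K a)).card * (S.filter fun x => x a + ∑ b, w b * x b = c).card = S.card)
    {p : Fin n → F} (hp : p ∈ S) :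
    (S.filter fun x => ∀ b < a, x b = p b).card =
      (elems (K a)).card * (S.filter fun x => ∀ b ≤ a, x b = p b).card := by
  set Q := (elems (K a)).card
  set Λ := lowerVectors K a with hΛ
  have hK' : ∀ x ∈ S, ∀ i, x i ∈ K i := fun x hx i => (mem_box.1 (hS hx) i).1
  have hΛpos : 0 < Λ.card := Finset.card_pos.2
    ⟨0, mem_lowerVectors.2 fun b => ⟨(K a).zero_mem, fun _ => rfl⟩⟩
  have h1 : ∑ w ∈ Λ, Q * (S.filter fun x => x a + ∑ b, w b * x b = p a + ∑ b, w b * p b).card =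
      Λ.card * S.card := by
    rw [← smul_eq_mul (Λ.card), ← Finset.sum_const]
    refine Finset.sum_congr rfl fun w hw => h w hw _ ?_
    have hw' := mem_lowerVectors.1 hw
    refine (K a).add_mem (hK' p hp a) ((K a).sum_mem fun i _ => ?_)
    by_cases hi : i < a
    · exact (K a).mul_mem (hw' i).1 (hK hi.le (hK' p hp i))
    · rw [(hw' i).2 hi, zero_mul]
      exact (K a).zero_mem
  have h2 : ∑ x ∈ S, Q * (Λ.filter fun w => x a + ∑ b, w b * x b = p a + ∑ b, w b * p b).card =
      Λ.card * S.card := by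
    rw [← h1, ← Finset.mul_sum, ← Finset.mul_sum]
    congr 1
    simp only [Finset.card_filter]
    exact Finset.sum_comm
  have hx : ∀ x ∈ S, Q * (Λ.filter fun w => x a + ∑ b, w b * x b = p a + ∑ b, w b * p b).card =
      (if ∀ b < a, x b = p b then 0 else Λ.card) +
        Λ.card * (Q * if ∀ b ≤ a, x b = p b then 1 else 0) := by
    intro x hx
    have hsub : ∀ w : Fin n → F, (x a + ∑ b, w b * x b = p a + ∑ b, w b * p b) ↔
        ((x - p) a + ∑ b, w b * (x - p) b = 0) := by
      intro w
      rw [← sub_eq_zero]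
      simp only [Pi.sub_apply, mul_sub, Finset.sum_sub_distrib]
      rw [show x a + ∑ b, w b * x b - (p a + ∑ b, w b * p b) =
        x a - p a + (∑ b, w b * x b - ∑ b, w b * p b) by ring]
    by_cases hlt : ∀ b < a, x b = p b
    · have hw0 : ∀ w ∈ Λ, ∑ b, w b * (x - p) b = 0 := by
        intro w hw
        refine Finset.sum_eq_zero fun b _ => ?_
        by_cases hb : b < a
        · simp [hlt b hb]
        · rw [(mem_lowerVectors.1 hw b).2 hb, zero_mul]
      rw [if_pos hlt, zero_add]
      by_cases hax : x a = p a
      · rw [if_pos fun b hb => (lt_or_eq_of_le hb).elim (hlt b) (by rintro rfl; exact hax),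
          Finset.filter_true_of_mem, mul_one, mul_comm]
        intro w hw
        rw [hsub, hw0 w hw]
        simp [hax]
      · rw [if_neg fun h => hax (h a le_rfl), Finset.filter_false_of_mem]
        · simp
        · intro w hw
          rw [hsub, hw0 w hw, add_zero, Pi.sub_apply, sub_eq_zero]
          exact hax
    · rw [if_neg hlt, if_neg fun h => hlt fun b hb => h b hb.le]
      simp only [mul_zero, add_zero, hsub]
      push Not at hlt
      obtain ⟨b, hb, hne⟩ := hlt
      exact card_lowerVectors_fiber hK
        (fun i => (K i).sub_mem (hK' x hx i) (hK' p hp i)) hb (sub_ne_zero.2 hne)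
  rw [Finset.sum_congr rfl hx, Finset.sum_add_distrib, ← Finset.mul_sum, ← Finset.mul_sum,
    ← Finset.card_filter, Finset.sum_ite, Finset.sum_const_zero, zero_add, Finset.sum_const,
    smul_eq_mul, mul_comm, ← mul_add] at h2
  have h3 := Nat.eq_of_mul_eq_mul_left hΛpos h2
  have h4 := Finset.card_filter_add_card_filter_not (s := S) (fun x => ∀ b < a, x b = p b)
  omega

/-- A nonempty set meeting the level sets of every shear in equally many points is the whole
box. -/
theorem eq_box_of_equidistributed (hK : Monotone K) {S : Finset (Fin n → F)} (hS : S ⊆ box K I)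
    (hne : S.Nonempty)
    (h : ∀ a ∈ I, ∀ w ∈ lowerVectors K a, ∀ c ∈ K a, ∀ [DecidableEq F],
      (elems (K a)).card * (S.filter fun x => x a + ∑ b, w b * x b = c).card = S.card) :
    S = box K I := by
  classical
  -- Induction on the number m of last coordinates that may be changed freely without leaving S.
  have key : ∀ m ≤ n, ∀ p ∈ S, ∀ x ∈ box K I, (∀ b : Fin n, b.val < n - m → x b = p b) →
      x ∈ S := by
    intro m
    induction m with
    | zero =>
      intro _ p hp x _ hxp
      rwa [show x = p from funext fun b => hxp b (by simp)]
    | succ m ih =>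
      intro hm p hp x hx hxp
      set a : Fin n := ⟨n - (m + 1), by omega⟩ with ha
      have hlt : ∀ b : Fin n, b.val < n - (m + 1) ↔ b < a := fun b => Iff.rfl
      have hle : ∀ b : Fin n, b.val < n - m ↔ b ≤ a := fun b => by
        rw [Fin.le_def]
        simp only [ha]
        omega
      by_cases haI : a ∈ I
      · have h1 := card_agree_eq_mul hK hS (fun w hw c hc => h a haI w hw c hc) hp
        set B₀ := (box K I).filter fun x => ∀ b ≤ a, x b = p b with hB₀
        set B₁ := (box K I).filter fun x => ∀ b < a, x b = p b with hB₁
        have h2 : (S.filter fun x => ∀ b ≤ a, x b = p b) = B₀ := by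
          ext y
          simp only [hB₀, Finset.mem_filter]
          exact ⟨fun hy => ⟨hS hy.1, hy.2⟩, fun hy => ⟨ih (by omega) p hp y hy.1
            fun b hb => hy.2 b ((hle b).1 hb), hy.2⟩⟩
        -- Resetting the coordinate a to p a maps B₁ to B₀ with fibres of size at most |K a|. The
        -- double count shows that the part of S in B₁ is at least this large, so it is all of B₁.
        have h3 : B₁.card ≤ (elems (K a)).card * B₀.card := by
          refine Finset.card_le_mul_card_image_of_maps_to
            (f := fun y => Function.update y a (p a)) ?_ _ ?_
          · intro y hy
            simp only [hB₁, hB₀, Finset.mem_filter] at hy ⊢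
            refine ⟨update_mem_box hy.1 haI (mem_box.1 (hS hp) a).1, fun b hb => ?_⟩
            by_cases hba : b = a
            · subst hba; simp
            · rw [Function.update_of_ne hba]
              exact hy.2 b (lt_of_le_of_ne hb hba)
          · intro z _
            refine Finset.card_le_card_of_injOn (fun y => y a) ?_ ?_
            · intro y hy
              have hy := (Finset.mem_filter.1 (Finset.mem_filter.1 hy).1).1
              simpa using (mem_box.1 hy a).1
            · intro y hy y' hy' hyy
              have e1 := (Finset.mem_filter.1 hy).2
              have e2 := (Finset.mem_filter.1 hy').2
              funext i
              by_cases hi : i = a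
              · subst hi; exact hyy
              · have := congrFun (e1.trans e2.symm) i
                simpa [hi] using this
        rw [h2] at h1
        have hsub : (S.filter fun x => ∀ b < a, x b = p b) ⊆ B₁ :=
          Finset.filter_subset_filter _ hS
        have heq := Finset.eq_of_subset_of_card_le hsub (h3.trans h1.ge)
        have : x ∈ B₁ := Finset.mem_filter.2 ⟨hx, fun b hb => hxp b hb⟩
        rw [← heq] at this
        exact (Finset.mem_filter.1 this).1
      · refine ih (by omega) p hp x hx fun b hb => ?_
        rcases lt_or_eq_of_le ((hle b).1 hb) with hb | rfl
        · exact hxp b hb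
        · rw [(mem_box.1 hx _).2 haI, (mem_box.1 (hS hp) _).2 haI]
  obtain ⟨p, hp⟩ := hne
  exact Finset.Subset.antisymm hS fun x hx => key n le_rfl p hp x hx fun b hb => by omega

end Equidistribution

end AffineCartesian

namespace AffineCartesian

/-! ### Minimal supports are products up to automorphism. -/

section Classification

variable {F : Type*} [Field F] [Fintype F] {n : ℕ} {K : Fin n → Subfield F}
  {I : Finset (Fin n)} {u : ℕ} {f : (Fin n → F) → F}

theorem suppValues_comp {σ : (Fin n → F) ≃ᵃ[F] (Fin n → F)} (hσ : σ ∈ boxAut K I) {a : Fin n}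
    (h : ∀ x, σ x a = x a) : suppValues K I (fun x => f (σ x)) a = suppValues K I f a := by
  ext c
  rw [mem_suppValues, mem_suppValues]
  constructor
  · rintro ⟨x, hx, rfl⟩
    exact ⟨σ x, (apply_mem_supp_iff hσ).2 hx, h x⟩
  · rintro ⟨x, hx, rfl⟩
    refine ⟨σ⁻¹ x, ?_, ?_⟩
    · rw [← apply_mem_supp_iff hσ, apply_inv_self]
      exact hx
    · rw [← h (σ⁻¹ x), apply_inv_self]

theorem PolyFun.exists_optimal_suppValues (hf : PolyFun u f)
    (hmin : (supp K I f).card = minProd (dims K I) u) {a : Fin n} (ha : a ∈ I) :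
    ∃ P, Optimal (dims K I) u P ∧ P a = (suppValues K I f a).card := by
  obtain ⟨-, v, -, -, -, -, h⟩ := hf.exists_minimal_slices hmin ha
  obtain ⟨P, hP⟩ := exists_optimal (d := dims K (I.erase a)) (fun i => one_le_dims i) v
  exact ⟨_, h P hP, by simp⟩

/-- After moving by σ the set X lies in a single slice in direction b, and all nonempty slices in
that direction have the same size. -/
theorem PolyFun.card_suppValues_mul_le (hf : PolyFun u f)
    (hmin : (supp K I f).card = minProd (dims K I) u)
    {σ : (Fin n → F) ≃ᵃ[F] (Fin n → F)} (hσ : σ ∈ boxAut K I) {b : Fin n} (hb : b ∈ I) {c : F}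
    {X : Finset (Fin n → F)} (hX : X ⊆ supp K I f) (hne : X.Nonempty) (hc : ∀ x ∈ X, σ x b = c) :
    (suppValues K I (fun x => f (σ⁻¹ x)) b).card * X.card ≤ (supp K I f).card := by
  classical
  have hσ' := (boxAut K I).inv_mem hσ
  have hmem : ∀ x ∈ X, σ x ∈ suppSlice K I (fun x => f (σ⁻¹ x)) b c := by
    intro x hx
    refine mem_suppSlice.2 ⟨?_, hc x hx⟩
    rw [← apply_mem_supp_iff hσ', inv_apply_self]
    exact hX hx
  obtain ⟨x, hx⟩ := hne
  have h1 := ((hf.comp_affineEquiv σ⁻¹).exists_minimal_slices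
    ((card_supp_comp hσ').trans hmin) hb).1 c (mem_suppValues.2
      ⟨σ x, (mem_suppSlice.1 (hmem x hx)).1, hc x hx⟩)
  rw [card_supp_comp hσ'] at h1
  rw [← h1]
  refine Nat.mul_le_mul_left _ (Finset.card_le_card_of_injOn σ hmem ?_)
  exact σ.injective.injOn

/-- If a coordinate `a` takes `w` values on the support of `f`, where `1 < w < d a`, and a set
with more points than a slice in direction `a` lies in a slice in the direction of another
coordinate of the same type, then this other coordinate is constant on the support. -/
theorem PolyFun.card_suppValues_eq_one (hf : PolyFun u f)
    (hmin : (supp K I f).card = minProd (dims K I) u) {a : Fin n} (ha : a ∈ I)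
    (hw : (suppValues K I f a).card < dims K I a) {c₀ : F} (hc₀ : c₀ ∈ suppValues K I f a)
    {σ : (Fin n → F) ≃ᵃ[F] (Fin n → F)} (hσ : σ ∈ boxAut K I) {b : Fin n} (hb : b ∈ I) {c : F}
    (hc : ∀ x ∈ suppSlice K I f a c₀, σ x b = c) {p : Fin n → F} (hp : p ∈ supp K I f)
    (hpa : p a ≠ c₀) (hpc : σ p b = c) :
    (suppValues K I (fun x => f (σ⁻¹ x)) b).card = 1 := by
  classical
  have h1 := (hf.exists_minimal_slices hmin ha).1 c₀ hc₀
  have hpn : p ∉ suppSlice K I f a c₀ := fun h => hpa (mem_suppSlice.1 h).2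
  have h2 := hf.card_suppValues_mul_le hmin hσ hb (c := c)
    (X := insert p (suppSlice K I f a c₀))
    (Finset.insert_subset hp fun x hx => (mem_suppSlice.1 hx).1) (Finset.insert_nonempty _ _)
    (by
      intro x hx
      rcases Finset.mem_insert.1 hx with rfl | hx
      · exact hpc
      · exact hc x hx)
  rw [Finset.card_insert_of_notMem hpn, ← h1] at h2
  obtain ⟨P, hP, hPa⟩ := hf.exists_optimal_suppValues hmin ha
  have hσ' := (boxAut K I).inv_mem hσ
  obtain ⟨Q, hQ, hQb⟩ := (hf.comp_affineEquiv σ⁻¹).exists_optimal_suppValues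
    ((card_supp_comp hσ').trans hmin) hb
  -- Otherwise the direction b has at least as many nonempty slices as the direction a. One of them
  -- has more points than a slice in direction a, so together they exceed the size of the support.
  rcases hP.eq_one_or_le hQ (a := a) (by omega) b with h | h
  · rw [← hQb, h]
  · rw [hPa, hQb] at h
    exfalso
    have h3 := Nat.mul_le_mul_right ((suppSlice K I f a c₀).card + 1) h
    have h4 : 0 < (suppValues K I f a).card := Finset.card_pos.2 ⟨c₀, hc₀⟩
    rw [mul_add, mul_one] at h3
    omega

/-- Up to an automorphism, the support of `f` on `box K I` is a product of sets whose sizes form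
an optimal tuple. -/
def HasProductSupport (K : Fin n → Subfield F) (I : Finset (Fin n)) (u : ℕ)
    (f : (Fin n → F) → F) : Prop :=
  ∃ σ ∈ boxAut K I, ∃ T : Fin n → Finset F, (∀ i, T i ⊆ elems (K i)) ∧
    (∀ i, i ∉ I → T i = {0}) ∧ Optimal (dims K I) u (fun i => (T i).card) ∧
    ∀ x ∈ box K I, f (σ x) ≠ 0 ↔ ∀ i, x i ∈ T i

theorem HasProductSupport.of_comp {τ : (Fin n → F) ≃ᵃ[F] (Fin n → F)} (hτ : τ ∈ boxAut K I)
    (h : HasProductSupport K I u fun x => f (τ x)) : HasProductSupport K I u f := by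
  obtain ⟨σ, hσ, T, h1, h2, h3, h4⟩ := h
  exact ⟨τ * σ, (boxAut K I).mul_mem hτ hσ, T, h1, h2, h3, h4⟩

/-- The slice x a = 0 is minimal for the quotient ψ, so the induction hypothesis describes it. The
number of nonempty slices then completes its tuple to an optimal one. -/
theorem PolyFun.exists_slice_zero (hf : PolyFun u f)
    (hmin : (supp K I f).card = minProd (dims K I) u) {a : Fin n} (ha : a ∈ I)
    (h0 : 0 ∈ suppValues K I f a)
    (ih : ∀ v (g : (Fin n → F) → F), PolyFun v g →
      (supp K (I.erase a) g).card = minProd (dims K (I.erase a)) v →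
      HasProductSupport K (I.erase a) v g) :
    ∃ σ ∈ boxAut K (I.erase a), ∃ T : Fin n → Finset F, (∀ i, T i ⊆ elems (K i)) ∧
      (∀ i, i ∉ I.erase a → T i = {0}) ∧
      Optimal (dims K I) u
        (Function.update (fun i => (T i).card) a (suppValues K I f a).card) ∧
      ∀ x ∈ box K (I.erase a), f (σ x) ≠ 0 ↔ ∀ i, x i ∈ T i := by
  obtain ⟨-, v, ψ, hψ, h1, h2, h3⟩ := hf.exists_minimal_slices hmin ha
  have h1 := h1 0 h0
  have h2 := h2 0 h0
  simp only [transl_zero] at h1 h2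
  obtain ⟨σ, hσ, T, hT, hT0, hopt, hiff⟩ := ih v ψ hψ h2
  refine ⟨σ, hσ, T, hT, hT0, h3 _ hopt, fun x hx => ?_⟩
  rw [h1 _ ((apply_mem_box_iff hσ).2 hx)]
  exact hiff x hx

theorem mem_box_erase_iff {a : Fin n} {x : Fin n → F} :
    x ∈ box K (I.erase a) ↔ x ∈ box K I ∧ x a = 0 := by
  rw [mem_box, mem_box]
  constructor
  · intro h
    exact ⟨fun i => ⟨(h i).1, fun hi => (h i).2 fun h' => hi (Finset.mem_of_mem_erase h')⟩,
      (h a).2 (by simp)⟩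
  · rintro ⟨h, h0⟩ i
    refine ⟨(h i).1, fun hi => ?_⟩
    by_cases hia : i = a
    · rw [hia, h0]
    · exact (h i).2 fun h' => hi (Finset.mem_erase.2 ⟨hia, h'⟩)

/-- The whole support lies in x a = 0, so the product description of this slice already describes
all of it. -/
theorem PolyFun.hasProductSupport_of_card_eq_one (hf : PolyFun u f)
    (hmin : (supp K I f).card = minProd (dims K I) u) {a : Fin n} (ha : a ∈ I)
    (hone : suppValues K I f a = {0})
    (ih : ∀ v (g : (Fin n → F) → F), PolyFun v g →
      (supp K (I.erase a) g).card = minProd (dims K (I.erase a)) v →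
      HasProductSupport K (I.erase a) v g) : HasProductSupport K I u f := by
  obtain ⟨σ, hσ, T, hT, hT0, hopt, hiff⟩ := hf.exists_slice_zero hmin ha (by simp [hone]) ih
  have hσI := boxAut_mono (K := K) (Finset.erase_subset a I) hσ
  have hTa : T a = {0} := hT0 a (by simp)
  refine ⟨σ, hσI, T, hT, fun i hi => hT0 i fun h => hi (Finset.mem_of_mem_erase h), ?_, ?_⟩
  · convert hopt using 1
    ext i
    by_cases h : i = a
    · subst h
      simp [hTa, hone]
    · simp [h]
  · intro x hx
    by_cases hxa : x a = 0
    · exact hiff x (mem_box_erase_iff.2 ⟨hx, hxa⟩)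
    · refine iff_of_false (fun h => hxa ?_) fun h => hxa (by simpa [hTa] using h a)
      have h1 : σ x ∈ supp K I f := mem_supp.2 ⟨(apply_mem_box_iff hσI).2 hx, h⟩
      have h2 : σ x a ∈ suppValues K I f a := mem_suppValues.2 ⟨_, h1, rfl⟩
      rw [hone, Finset.mem_singleton, hσ.2 x a (by simp)] at h2
      exact h2

theorem suppValues_transl {a : Fin n} (ha : a ∈ I) {c : F} (hc : c ∈ K a) {e : F} :
    e ∈ suppValues K I (fun x => f (transl a c x)) a ↔ c + e ∈ suppValues K I f a := by
  have hσ := transl_mem (K := K) (J := I) hc ha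
  rw [mem_suppValues, mem_suppValues]
  constructor
  · rintro ⟨x, hx, rfl⟩
    exact ⟨transl a c x, (apply_mem_supp_iff hσ).2 hx, transl_apply_self a c x⟩
  · rintro ⟨x, hx, hxe⟩
    refine ⟨(transl a c)⁻¹ x, ?_, ?_⟩
    · rw [← apply_mem_supp_iff hσ, apply_inv_self]
      exact hx
    · have := transl_apply_self a c ((transl a c)⁻¹ x)
      rw [apply_inv_self, hxe] at this
      exact (add_left_cancel this).symm

theorem card_suppValues_transl {a : Fin n} (ha : a ∈ I) {c : F} (hc : c ∈ K a) :
    (suppValues K I (fun x => f (transl a c x)) a).card = (suppValues K I f a).card := by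
  refine Finset.card_bij (fun e _ => c + e) (fun e he => (suppValues_transl ha hc).1 he)
    (fun _ _ _ _ h => add_left_cancel h) fun e he => ⟨e - c, ?_, by ring⟩
  rw [suppValues_transl ha hc]
  simpa using he

/-- The shear turns level sets of x a + ∑ w b * x b into coordinate slices. -/
theorem card_filter_shear_eq {a : Fin n} {w : Fin n → F} (hw : w a = 0)
    (hσ : shear a w hw ∈ boxAut K I) (c : F) [DecidableEq F] :
    ((supp K I f).filter fun x => x a + ∑ b, w b * x b = c).card =
      (suppSlice K I (fun x => f ((shear a w hw)⁻¹ x)) a c).card := by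
  have hσ' := (boxAut K I).inv_mem hσ
  refine Finset.card_bij (fun x _ => shear a w hw x) ?_
    (fun _ _ _ _ h => (shear a w hw).injective h) ?_
  · intro x hx
    rw [Finset.mem_filter] at hx
    rw [mem_suppSlice, ← apply_mem_supp_iff hσ', inv_apply_self, shear_apply_self]
    exact hx
  · intro y hy
    rw [mem_suppSlice, ← apply_mem_supp_iff hσ'] at hy
    refine ⟨(shear a w hw)⁻¹ y, ?_, apply_inv_self _ y⟩
    rw [Finset.mem_filter, ← shear_apply_self a w hw, apply_inv_self]
    exact hy

/-- If every coordinate took all its values after every automorphism, equality of slice sizes would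
make the support equidistributed along all shears, hence equal to the box. -/
theorem PolyFun.exists_card_suppValues_lt (hK : Monotone K) (hf : PolyFun u f)
    (hmin : (supp K I f).card = minProd (dims K I) u) (hne : supp K I f ≠ box K I) :
    ∃ τ ∈ boxAut K I, ∃ a ∈ I,
      (suppValues K I (fun x => f (τ x)) a).card < dims K I a := by
  by_contra hcon
  push Not at hcon
  refine hne (eq_box_of_equidistributed hK (fun x hx => (mem_supp.1 hx).1)
    (supp_nonempty_of_card_eq hmin) ?_)
  intro a ha w hw c hc _
  rw [mem_lowerVectors] at hw
  have hwa : w a = 0 := (hw a).2 (lt_irrefl a)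
  have hσ : shear a w hwa ∈ boxAut K I := shear_mem hwa ha fun b => ⟨(hw b).1, fun h =>
    hK (le_of_lt (by by_contra h'; exact h ((hw b).2 h')))⟩
  have hσ' := (boxAut K I).inv_mem hσ
  have h1 := hcon _ hσ' a ha
  rw [dims_of_mem ha] at h1
  have h2 := Finset.eq_of_subset_of_card_le (suppValues_subset a) h1
  rw [card_filter_shear_eq hwa hσ, ← h2, ← card_supp_comp (f := f) hσ']
  refine ((hf.comp_affineEquiv _).exists_minimal_slices
    ((card_supp_comp hσ').trans hmin) ha).1 c ?_
  rw [h2]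
  simpa using hc

/-- Some coordinate of some automorphism is constant on the support of `f`, provided some
coordinate `a` takes the value `0`, but neither only one nor all possible values there, and the
slice `x a = 0` of the support is contained in a slice in another direction. -/
theorem PolyFun.exists_card_suppValues_eq_one (hK : Monotone K) (hf : PolyFun u f)
    (hmin : (supp K I f).card = minProd (dims K I) u) {a : Fin n} (ha : a ∈ I)
    (hw : (suppValues K I f a).card < dims K I a) (h0 : 0 ∈ suppValues K I f a)
    {b : Fin n} (hb : b ∈ I) (hab : b ≠ a) {c : F} (hc : ∀ x ∈ supp K I f, x a = 0 → x b = c) :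
    ∃ τ ∈ boxAut K I, ∃ e ∈ I, (suppValues K I (fun x => f (τ x)) e).card = 1 := by
  by_cases hone : (suppValues K I f b).card = 1
  · exact ⟨1, (boxAut K I).one_mem, b, hb, hone⟩
  obtain ⟨x₀, hx₀, hx₀a⟩ := mem_suppValues.1 h0
  have hcb : c ∈ suppValues K I f b := mem_suppValues.2 ⟨x₀, hx₀, hc x₀ hx₀ hx₀a⟩
  have hcK : c ∈ K b := by simpa using suppValues_subset b hcb
  have hlt : 1 < (suppValues K I f b).card := by
    have := Finset.card_pos.2 ⟨c, hcb⟩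
    omega
  obtain ⟨c', hc', hne⟩ := Finset.exists_mem_ne hlt c
  obtain ⟨p, hp, rfl⟩ := mem_suppValues.1 hc'
  have hpa : p a ≠ 0 := fun h => hne (hc p hp h)
  have hpK : ∀ i, p i ∈ K i := fun i => (mem_box.1 (mem_supp.1 hp).1 i).1
  rcases (le_total a b).imp (fun h => hK h) (fun h => hK h) with hle | hle
  -- The added multiple of x a vanishes on the slice x a = 0 and moves p to x b = c. Thus the slice
  -- and the extra point p fall into one slice in direction b.
  · set w : Fin n → F := Pi.single a ((c - p b) / p a) with hwdef
    have hwb : w b = 0 := by simp [hwdef, hab]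
    have hval : ∀ x : Fin n → F, shear b w hwb x b = x b + (c - p b) / p a * x a := by
      intro x
      rw [shear_apply_self]
      simp [hwdef, Pi.single_apply]
    have hσ : shear b w hwb ∈ boxAut K I := by
      refine shear_mem hwb hb fun i => ?_
      by_cases hi : i = a
      · subst hi
        refine ⟨?_, fun _ => hle⟩
        simp only [hwdef, Pi.single_eq_same]
        exact (K b).div_mem ((K b).sub_mem hcK (hpK b)) (hle (hpK i))
      · simp [hwdef, hi, (K b).zero_mem]
    refine ⟨(shear b w hwb)⁻¹, (boxAut K I).inv_mem hσ, b, hb, ?_⟩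
    refine hf.card_suppValues_eq_one hmin ha hw h0 hσ hb (c := c) ?_ hp hpa ?_
    · intro x hx
      rw [mem_suppSlice] at hx
      rw [hval, hx.2, mul_zero, add_zero]
      exact hc x hx.1 hx.2
    · rw [hval, div_mul_cancel₀ _ hpa]
      ring
  -- Now only multiples of x b may be added to x a. The coefficient is chosen so that the new
  -- coordinate a has the same value at p as on the slice x a = 0.
  · have hpc : p b - c ≠ 0 := sub_ne_zero.2 hne
    set w : Fin n → F := Pi.single b (-p a / (p b - c)) with hwdef
    have hwa : w a = 0 := by simp [hwdef, hab.symm]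
    have hval : ∀ x : Fin n → F, shear a w hwa x a = x a + -p a / (p b - c) * x b := by
      intro x
      rw [shear_apply_self]
      simp [hwdef, Pi.single_apply]
    have hσ : shear a w hwa ∈ boxAut K I := by
      refine shear_mem hwa ha fun i => ?_
      by_cases hi : i = b
      · subst hi
        refine ⟨?_, fun _ => hle⟩
        simp only [hwdef, Pi.single_eq_same]
        exact (K a).div_mem ((K a).neg_mem (hpK a)) (hle ((K i).sub_mem (hpK i) hcK))
      · simp [hwdef, hi, (K a).zero_mem]
    refine ⟨(shear a w hwa)⁻¹, (boxAut K I).inv_mem hσ, a, ha, ?_⟩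
    refine hf.card_suppValues_eq_one hmin ha hw h0 hσ ha (c := -p a / (p b - c) * c) ?_ hp hpa ?_
    · intro x hx
      rw [mem_suppSlice] at hx
      rw [hval, hx.2, zero_add, hc x hx.1 hx.2]
    · rw [hval]
      field_simp
      ring

/-- Polynomial functions whose support on a box is as small as possible have product supports. -/
theorem PolyFun.hasProductSupport (hK : Monotone K) (hf : PolyFun u f)
    (hmin : (supp K I f).card = minProd (dims K I) u) : HasProductSupport K I u f := by
  classical
  induction hI : I.card generalizing I u f with
  | zero =>
    have hI' := Finset.card_eq_zero.1 hI
    subst hI'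
    refine ⟨1, Subgroup.one_mem _, fun _ => {0}, fun i => by simp [(K i).zero_mem], by simp, ?_,
      fun x hx => ?_⟩
    · obtain ⟨P, hP⟩ := exists_optimal (d := dims K ∅) (fun i => one_le_dims i) u
      convert hP using 1
      ext i
      have := hP.1.1 i
      simp only [dims, Finset.notMem_empty, if_false] at this
      simp
      omega
    · have h0 : ∀ y ∈ box K (∅ : Finset (Fin n)), y = 0 := fun y hy =>
        funext fun i => (mem_box.1 hy i).2 (by simp)
      obtain ⟨y, hy⟩ := supp_nonempty_of_card_eq hmin
      rw [mem_supp] at hy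
      rw [h0 y hy.1] at hy
      rw [h0 x hx]
      simpa using hy.2
  | succ N ih =>
    have ih' : ∀ a ∈ I, ∀ v (g : (Fin n → F) → F), PolyFun v g →
        (supp K (I.erase a) g).card = minProd (dims K (I.erase a)) v →
        HasProductSupport K (I.erase a) v g := fun a ha v g hg hg' =>
      ih hg hg' (by rw [Finset.card_erase_of_mem ha]; omega)
    by_cases hfull : supp K I f = box K I
    · refine ⟨1, Subgroup.one_mem _, fun i => if i ∈ I then elems (K i) else {0}, ?_, ?_, ?_, ?_⟩
      · intro i
        dsimp only
        split_ifs
        · exact subset_rfl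
        · simp [(K i).zero_mem]
      · intro i hi
        simp [hi]
      · have hd : (fun i => (if i ∈ I then elems (K i) else {0}).card) = dims K I := by
          ext i
          simp only [dims]
          split_ifs <;> simp
        rw [hd]
        refine ⟨⟨fun i => ⟨one_le_dims i, le_rfl⟩, by omega⟩, ?_⟩
        rw [← card_box, ← hmin, hfull]
      · intro x hx
        have h1 : f x ≠ 0 := by
          rw [← hfull] at hx
          exact (mem_supp.1 hx).2
        refine iff_of_true h1 fun i => ?_
        have h2 := mem_box.1 hx i
        dsimp only
        split_ifs with hi
        · exact mem_elems.2 h2.1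
        · simpa using h2.2 hi
    -- A coordinate that some automorphism makes constant is translated to 0 and dropped. If there
    -- is none, a coordinate a missing a value turns out to be the only restriction.
    · by_cases hex : ∃ τ ∈ boxAut K I, ∃ e ∈ I, (suppValues K I (fun x => f (τ x)) e).card = 1
      · obtain ⟨τ, hτ, e, he, hone⟩ := hex
        obtain ⟨c, hc⟩ := Finset.card_eq_one.1 hone
        have hcK : c ∈ K e := by
          have : c ∈ suppValues K I (fun x => f (τ x)) e := by simp [hc]
          simpa using suppValues_subset e this
        have ht := transl_mem (K := K) hcK he
        refine HasProductSupport.of_comp hτ (HasProductSupport.of_comp ht ?_)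
        refine PolyFun.hasProductSupport_of_card_eq_one
          ((hf.comp_affineEquiv τ).comp_affineEquiv (transl e c)) ?_ he ?_ (ih' e he)
        · rw [card_supp_comp (f := fun x => f (τ x)) ht, card_supp_comp hτ, hmin]
        · ext x
          rw [suppValues_transl (f := fun x => f (τ x)) he hcK, hc]
          simp
      · obtain ⟨τ, hτ, a, ha, hlt⟩ := hf.exists_card_suppValues_lt hK hmin hfull
        have hf₁ := hf.comp_affineEquiv τ
        have hmin₁ := (card_supp_comp (f := f) hτ).trans hmin
        obtain ⟨c, hc⟩ := Finset.card_pos.1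
          (card_suppValues_pos (supp_nonempty_of_card_eq hmin₁) a)
        have hcK : c ∈ K a := by simpa using suppValues_subset a hc
        have ht := transl_mem (K := K) hcK ha
        have hτt := (boxAut K I).mul_mem hτ ht
        set g : (Fin n → F) → F := fun x => f (τ (transl a c x)) with hg
        have hgf : PolyFun u g := hf₁.comp_affineEquiv (transl a c)
        have hgmin : (supp K I g).card = minProd (dims K I) u :=
          (card_supp_comp (f := fun x => f (τ x)) ht).trans hmin₁
        have hg0 : 0 ∈ suppValues K I g a := by
          refine (suppValues_transl (f := fun x => f (τ x)) ha hcK).2 ?_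
          simpa using hc
        have hgcard : (suppValues K I g a).card < dims K I a := by
          rw [← card_suppValues_transl (f := fun x => f (τ x)) ha hcK] at hlt
          exact hlt
        have hg1 : 1 < (suppValues K I g a).card := by
          have h1 := card_suppValues_pos (supp_nonempty_of_card_eq hgmin) a
          have h2 : (suppValues K I g a).card ≠ 1 := fun h => hex ⟨_, hτt, a, ha, h⟩
          omega
        obtain ⟨σ, hσ, T, hT, hT0, hopt, hiff⟩ := hgf.exists_slice_zero hgmin ha hg0 (ih' a ha)
        have hσI := boxAut_mono (K := K) (Finset.erase_subset a I) hσ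
        have hσa : ∀ x, σ x a = x a := fun x => hσ.2 x a (by simp)
        have hsv := suppValues_comp (f := g) hσI hσa
        -- Since a is already the one entry that is neither trivial nor maximal, a proper T b would
        -- be a single point. Then the slice x a = 0 would lie in one slice in direction b, and some
        -- coordinate could be made constant, which `hex` excludes.
        have hTfull : ∀ b ∈ I, b ≠ a → T b = elems (K b) := by
          intro b hb hba
          by_contra hTb
          have hTlt : (T b).card < (elems (K b)).card := by
            refine Finset.card_lt_card (lt_of_le_of_ne (hT b) hTb)
          have h1 := hopt.eq_one_of_lt (a := a) (b := b) hba.symm (by simpa using hg1)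
            (by simpa using hgcard) (by simpa [hba, dims_of_mem hb] using hTlt)
          rw [Function.update_of_ne hba] at h1
          obtain ⟨c', hc'⟩ := Finset.card_eq_one.1 h1
          obtain ⟨τ', hτ', e, he, h2⟩ := (hgf.comp_affineEquiv σ).exists_card_suppValues_eq_one hK
            ((card_supp_comp hσI).trans hgmin) ha (by rwa [hsv]) (by rwa [hsv]) hb hba
            (c := c') (by
              intro x hx hxa
              rw [mem_supp] at hx
              have := (hiff x (mem_box_erase_iff.2 ⟨hx.1, hxa⟩)).1 hx.2 b
              simpa [hc'] using this)
          exact hex ⟨_, (boxAut K I).mul_mem hτt ((boxAut K I).mul_mem hσI hτ'), e, he, h2⟩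
        -- The slice x a = 0 is full up to an automorphism, and all nonempty slices have the same
        -- size. So every nonempty slice is full and the support is determined by x a alone.
        have hslice : ∀ e ∈ suppValues K I g a,
            suppSlice K I g a e = (box K I).filter fun x => x a = e := by
          have hsl := (hgf.exists_minimal_slices hgmin ha).1
          have h0 : suppSlice K I (fun x => g (σ x)) a 0 = box K (I.erase a) := by
            ext x
            rw [mem_suppSlice, mem_supp, mem_box_erase_iff]
            refine ⟨fun h => ⟨h.1.1, h.2⟩, fun h => ⟨⟨h.1, ?_⟩, h.2⟩⟩
            have hx := mem_box_erase_iff.2 h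
            rw [hiff x hx]
            intro i
            have h2 := mem_box.1 hx i
            by_cases hi : i ∈ I.erase a
            · rw [hTfull i (Finset.mem_of_mem_erase hi) (Finset.ne_of_mem_erase hi)]
              exact mem_elems.2 h2.1
            · rw [hT0 i hi]
              simpa using h2.2 hi
          have hcard0 : (suppSlice K I g a 0).card = (box K (I.erase a)).card := by
            rw [← h0]
            have h1 := hsl 0 hg0
            have h2 := ((hgf.comp_affineEquiv σ).exists_minimal_slices
              ((card_supp_comp hσI).trans hgmin) ha).1 0 (by rwa [hsv])
            rw [hsv, card_supp_comp hσI, ← h1] at h2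
            exact (Nat.eq_of_mul_eq_mul_left (by omega) h2).symm
          intro e he
          have heK : e ∈ K a := by simpa using suppValues_subset a he
          have hcarde : (suppSlice K I g a e).card = (box K (I.erase a)).card := by
            rw [← hcard0]
            have h1 := hsl 0 hg0
            rw [← hsl e he] at h1
            exact (Nat.eq_of_mul_eq_mul_left (by omega) h1).symm
          refine Finset.eq_of_subset_of_card_le ?_ ?_
          · intro x hx
            rw [mem_suppSlice, mem_supp] at hx
            exact Finset.mem_filter.2 ⟨hx.1.1, hx.2⟩
          · rw [hcarde]
            refine Finset.card_le_card_of_injOn (fun x => (transl a e)⁻¹ x) ?_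
              ((transl a e)⁻¹).injective.injOn
            intro x hx
            have hx := Finset.mem_filter.1 hx
            refine (transl_mem_box_iff ha heK).2 ?_
            rw [apply_inv_self]
            exact hx
        refine HasProductSupport.of_comp hτt ⟨1, Subgroup.one_mem _,
          Function.update T a (suppValues K I g a), ?_, ?_, ?_, ?_⟩
        · intro i
          by_cases hi : i = a
          · subst hi
            simpa using suppValues_subset i
          · simpa [hi] using hT i
        · intro i hi
          have hia : i ≠ a := by rintro rfl; exact hi ha
          simpa [hia] using hT0 i fun h => hi (Finset.mem_of_mem_erase h)
        · convert hopt using 1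
          ext i
          by_cases hi : i = a
          · subst hi
            simp
          · simp [hi]
        · intro x hx
          change g x ≠ 0 ↔ _
          constructor
          · intro h i
            by_cases hi : i = a
            · subst hi
              simpa using mem_suppValues.2 ⟨x, mem_supp.2 ⟨hx, h⟩, rfl⟩
            · rw [Function.update_of_ne hi]
              by_cases hiI : i ∈ I
              · rw [hTfull i hiI hi]
                exact mem_elems.2 (mem_box.1 hx i).1
              · rw [hT0 i fun h => hiI (Finset.mem_of_mem_erase h)]
                simpa using (mem_box.1 hx i).2 hiI
          · intro h
            have hxa : x a ∈ suppValues K I g a := by simpa using h a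
            have : x ∈ suppSlice K I g a (x a) := by
              rw [hslice _ hxa]
              exact Finset.mem_filter.2 ⟨hx, rfl⟩
            exact (mem_supp.1 (mem_suppSlice.1 this).1).2

end Classification

end AffineCartesian

namespace AffineCartesian

/-! ### Gaussian binomial coefficients and extension of linear maps. -/

section Gauss

open Module

variable {L : Type*} [Field L]

/-- Annihilators give a bijection with the subspaces of complementary dimension of the dual space.
-/
theorem gaussBinom_symm {n k : ℕ} (hk : k ≤ n) : gaussBinom L n (n - k) = gaussBinom L n k := by
  unfold gaussBinom
  let e : Dual L (Fin n → L) ≃ₗ[L] (Fin n → L) := LinearEquiv.ofFinrankEq _ _ (by simp)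
  have hfin : ∀ W : Submodule L (Fin n → L),
      finrank L (W.dualAnnihilator.map e.toLinearMap) = n - finrank L W := by
    intro W
    rw [LinearEquiv.finrank_map_eq]
    have := Subspace.finrank_add_finrank_dualAnnihilator_eq W
    simp only [finrank_fin_fun] at this
    omega
  refine (Nat.card_congr (Equiv.subtypeEquiv
    ((Subspace.orderIsoFiniteDimensional (K := L) (V := Fin n → L)).toEquiv.trans
      (OrderDual.ofDual.trans (Submodule.orderIsoMapComap e).toEquiv)) fun W => ?_)).symm
  change _ ↔ finrank L (W.dualAnnihilator.map e.toLinearMap) = n - k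
  rw [hfin]
  have := Submodule.finrank_le W
  simp only [finrank_fin_fun] at this
  omega

/-- Linearly independent k-tuples in L ^ n are sorted by their span. -/
theorem gaussBinom_mul_prod [Finite L] {n k : ℕ} (hk : k ≤ n) :
    gaussBinom L n k * ∏ i : Fin k, (Nat.card L ^ k - Nat.card L ^ i.val) =
      ∏ i : Fin k, (Nat.card L ^ n - Nat.card L ^ i.val) := by
  have := Fintype.ofFinite L
  have h1 := card_linearIndependent (K := L) (V := Fin n → L) (k := k) (by simpa using hk)
  simp only [finrank_fin_fun, ← Nat.card_eq_fintype_card] at h1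
  rw [← h1]
  let Φ : (Σ W : {W : Submodule L (Fin n → L) // finrank L W = k},
      {s : Fin k → W.1 // LinearIndependent L s}) →
      {s : Fin k → (Fin n → L) // LinearIndependent L s} := fun p =>
    ⟨fun i => (p.2.1 i : Fin n → L), p.2.2.map' (Submodule.subtype _) (Submodule.ker_subtype _)⟩
  have hspan : ∀ p, Submodule.span L (Set.range (Φ p).1) = p.1.1 := by
    intro p
    refine Submodule.eq_of_le_of_finrank_eq (Submodule.span_le.2 ?_) ?_
    · rintro _ ⟨i, rfl⟩
      exact (p.2.1 i).2
    · rw [p.1.2]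
      simpa using finrank_span_eq_card (Φ p).2
  have hΦ : Function.Bijective Φ := by
    constructor
    · intro p p' hpp
      have hW : p.1.1 = p'.1.1 := by rw [← hspan, ← hspan, hpp]
      obtain ⟨⟨W, hW₁⟩, ⟨s, hs⟩⟩ := p
      obtain ⟨⟨W', hW₂⟩, ⟨s', hs'⟩⟩ := p'
      dsimp only at hW
      subst hW
      have : s = s' := funext fun i => Subtype.ext (congrFun (congrArg Subtype.val hpp) i)
      subst this
      rfl
    · intro s
      exact ⟨⟨⟨Submodule.span L (Set.range s.1), by simpa using finrank_span_eq_card s.2⟩,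
        ⟨fun i => ⟨s.1 i, Submodule.subset_span ⟨i, rfl⟩⟩,
          LinearIndependent.of_comp (Submodule.subtype _) s.2⟩⟩, rfl⟩
  rw [← Nat.card_eq_of_bijective Φ hΦ, Nat.card_sigma]
  have h2 : ∀ W : {W : Submodule L (Fin n → L) // finrank L W = k},
      Nat.card {s : Fin k → W.1 // LinearIndependent L s} =
        ∏ i : Fin k, (Nat.card L ^ k - Nat.card L ^ i.val) := by
    intro W
    have := card_linearIndependent (K := L) (V := W.1) (k := k) W.2.ge
    simpa only [W.2, ← Nat.card_eq_fintype_card] using this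
  simp only [h2]
  rw [Finset.sum_const, smul_eq_mul, Finset.card_univ, ← Nat.card_eq_fintype_card]
  rfl

theorem gaussBinom_one_mul [Finite L] {n : ℕ} (hn : 1 ≤ n) :
    gaussBinom L n 1 * (Nat.card L - 1) = Nat.card L ^ n - 1 := by
  simpa using gaussBinom_mul_prod (L := L) hn

/-- The quotient of the product formulas for k + 1 and k, stated without division. It converts the
count of groups and directions of equal level into the required form. -/
theorem gaussBinom_succ_mul [Finite L] {n k : ℕ} (hk : k + 1 ≤ n) :
    gaussBinom L n (k + 1) * (Nat.card L ^ (k + 1) - 1) =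
      gaussBinom L n k * (Nat.card L ^ (n - k) - 1) := by
  set q := Nat.card L with hq
  have hq1 : 1 < q := Finite.one_lt_card
  have h1 := gaussBinom_mul_prod (L := L) hk
  have h2 := gaussBinom_mul_prod (L := L) (n := n) (k := k) (by omega)
  rw [← hq] at h1 h2
  have h3 : ∏ i : Fin (k + 1), (q ^ (k + 1) - q ^ i.val) =
      (q ^ (k + 1) - 1) * (q ^ k * ∏ i : Fin k, (q ^ k - q ^ i.val)) := by
    rw [Fin.prod_univ_succ]
    congr 1
    have : ∀ i : Fin k, q ^ (k + 1) - q ^ (i.succ.val) = q * (q ^ k - q ^ i.val) := by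
      intro i
      rw [Fin.val_succ, pow_succ', pow_succ', Nat.mul_sub]
    simp only [this, Finset.prod_mul_distrib, Finset.prod_const, Finset.card_univ, Fintype.card_fin]
  have h4 : ∏ i : Fin (k + 1), (q ^ n - q ^ i.val) =
      (∏ i : Fin k, (q ^ n - q ^ i.val)) * (q ^ k * (q ^ (n - k) - 1)) := by
    rw [Fin.prod_univ_castSucc]
    congr 1
    rw [Nat.mul_sub, ← pow_add, mul_one, Fin.val_last]
    congr 2
    omega
  rw [h3, h4, ← h2] at h1
  have hpos : 0 < q ^ k * ∏ i : Fin k, (q ^ k - q ^ i.val) := by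
    refine Nat.mul_pos (by positivity) (Finset.prod_pos fun i _ => ?_)
    exact Nat.sub_pos_of_lt (Nat.pow_lt_pow_right hq1 i.2)
  refine Nat.eq_of_mul_eq_mul_right hpos ?_
  linear_combination h1

/-- Both families extend to bases, and the added parts have the same number of elements. -/
theorem exists_linearEquiv_apply_eq {V ι : Type*} [AddCommGroup V] [Module L V]
    [FiniteDimensional L V] [Finite ι] {v v' : ι → V} (hv : LinearIndependent L v)
    (hv' : LinearIndependent L v') : ∃ g : V ≃ₗ[L] V, ∀ i, g (v i) = v' i := by
  let b := Basis.sumExtend hv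
  let b' := Basis.sumExtend hv'
  have := FiniteDimensional.fintypeBasisIndex b
  have := FiniteDimensional.fintypeBasisIndex b'
  have : Finite (Basis.sumExtendIndex hv) := Finite.of_injective _ (Sum.inr_injective (α := ι))
  have : Finite (Basis.sumExtendIndex hv') := Finite.of_injective _ (Sum.inr_injective (α := ι))
  have hcard : Nat.card (Basis.sumExtendIndex hv) = Nat.card (Basis.sumExtendIndex hv') := by
    have h1 := finrank_eq_nat_card_basis b
    have h2 := finrank_eq_nat_card_basis b'
    rw [Nat.card_sum] at h1 h2
    omega
  obtain ⟨e⟩ := Finite.card_eq.1 hcard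
  refine ⟨b.equiv b' (Equiv.sumCongr (Equiv.refl ι) e), fun i => ?_⟩
  have h1 : b (Sum.inl i) = v i := by
    simp only [b, Basis.sumExtend, Basis.reindex_apply, Basis.extend_apply_self]
    rfl
  have h2 : b' (Sum.inl i) = v' i := by
    simp only [b', Basis.sumExtend, Basis.reindex_apply, Basis.extend_apply_self]
    rfl
  rw [← h1, Basis.equiv_apply]
  exact h2

end Gauss

/-! ### Unions of parallel cosets along a line over a subfield. -/

section Cosets

variable {F E : Type*} [Field F] [AddCommGroup E] [Module F E] [Fintype E]

open scoped Classical in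
/-- The union of the cosets `x + τ • δ + H` with `τ ∈ T`. -/
noncomputable def cosets (H : AddSubgroup E) (x δ : E) (T : Finset F) : Finset E :=
  Finset.univ.filter fun y => ∃ τ ∈ T, y - x - τ • δ ∈ H

theorem mem_cosets {H : AddSubgroup E} {x δ y : E} {T : Finset F} :
    y ∈ cosets H x δ T ↔ ∃ τ ∈ T, y - x - τ • δ ∈ H := by simp [cosets]

/-- The line k • δ meets H only in 0, so different parameters in k give different cosets. -/
theorem eq_of_sub_smul_mem {F E : Type*} [Field F] [AddCommGroup E] [Module F E]
    {k : Subfield F} {H : AddSubgroup E} (hH : ∀ c ∈ k, ∀ v ∈ H, c • v ∈ H) {δ : E} (hδ : δ ∉ H) {a b : F} (ha : a ∈ k) (hb : b ∈ k)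
    (h : (a - b) • δ ∈ H) : a = b := by
  by_contra hne
  have h0 : a - b ≠ 0 := sub_ne_zero.2 hne
  refine hδ ?_
  have := hH (a - b)⁻¹ (k.inv_mem (k.sub_mem ha hb)) _ h
  rwa [smul_smul, inv_mul_cancel₀ h0, one_smul] at this

variable [Fintype F]

theorem add_smul_mem_cosets {k : Subfield F} {H : AddSubgroup E}
    (hH : ∀ c ∈ k, ∀ v ∈ H, c • v ∈ H) {x δ : E} (hδ : δ ∉ H) {T : Finset F} (hT : T ⊆ elems k)
    {τ : F} (hτ : τ ∈ k) : x + τ • δ ∈ cosets H x δ T ↔ τ ∈ T := by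
  rw [mem_cosets]
  constructor
  · rintro ⟨a, ha, h⟩
    rw [add_sub_cancel_left, ← sub_smul] at h
    rwa [eq_of_sub_smul_mem hH hδ hτ (by simpa using hT ha) h]
  · intro h
    exact ⟨τ, h, by simp [H.zero_mem]⟩

open scoped Classical in
-- These changes of base point, direction and parameter set are invisible in the union; for at least
-- two cosets they account for all coincidences (`card_image_cosets`).
theorem cosets_change {k : Subfield F} {H : AddSubgroup E}
    (hH : ∀ c ∈ k, ∀ v ∈ H, c • v ∈ H) {x δ : E} {T : Finset F} (hT : T ⊆ elems k)
    {τ α : F} (hτ : τ ∈ k) (hα : α ∈ k) (hα0 : α ≠ 0) {h h' : E} (hh : h ∈ H) (hh' : h' ∈ H) :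
    cosets H (x + τ • δ + h) (α • δ + h') (T.image fun t => (t - τ) / α) = cosets H x δ T := by
  ext y
  rw [mem_cosets, mem_cosets, Finset.exists_mem_image]
  refine exists_congr fun t => and_congr_right fun ht => ?_
  have htk : t ∈ k := by simpa using hT ht
  have h1 : y - (x + τ • δ + h) - ((t - τ) / α) • (α • δ + h') =
      (y - x - t • δ) - (h + ((t - τ) / α) • h') := by
    rw [smul_add, smul_smul, div_mul_cancel₀ _ hα0, sub_smul]
    abel
  rw [h1]
  rw [sub_eq_add_neg]
  refine H.add_mem_cancel_right (H.neg_mem (H.add_mem hh ?_))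
  exact (hH _ (k.div_mem (k.sub_mem htk hτ) hα) _ hh')

open scoped Classical in
/-- The number of sets consisting of `w` parallel cosets of `H` along a line over `k` with
direction in `Δ`. -/
theorem card_image_cosets {k : Subfield F} {H : AddSubgroup E}
    (hH : ∀ c ∈ k, ∀ v ∈ H, c • v ∈ H) {A Δ : Finset E}
    (hA : ∀ x ∈ A, ∀ δ ∈ Δ, ∀ c ∈ k, ∀ h ∈ H, x + c • δ + h ∈ A) (hΔ : ∀ δ ∈ Δ, δ ∉ H)
    (hΔ' : ∀ δ ∈ Δ, ∀ c ∈ k, c ≠ 0 → ∀ h ∈ H, c • δ + h ∈ Δ) {w : ℕ} (hw : 2 ≤ w) :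
    ((A ×ˢ Δ ×ˢ (elems k).powersetCard w).image fun p => cosets H p.1 p.2.1 p.2.2).card *
        (((elems k).card * Nat.card H) * (((elems k).card - 1) * Nat.card H)) =
      A.card * (Δ.card * (elems k).card.choose w) := by
  set X := A ×ˢ Δ ×ˢ (elems k).powersetCard w with hX
  set Φ : E × E × Finset F → Finset E := fun p => cosets H p.1 p.2.1 p.2.2 with hΦ
  set HF : Finset E := Finset.univ.filter (· ∈ H) with hHF
  have hHF' : ∀ v, v ∈ HF ↔ v ∈ H := fun v => by simp [hHF]
  have hcardH : Nat.card H = HF.card := by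
    rw [Nat.card_eq_fintype_card, Fintype.card_subtype]
  have hXcard : X.card = A.card * (Δ.card * (elems k).card.choose w) := by
    rw [hX, Finset.card_product, Finset.card_product, Finset.card_powersetCard]
  rw [← hXcard, Finset.card_eq_sum_card_image Φ X, hcardH]
  rw [Finset.sum_const_nat]
  intro S hS
  obtain ⟨⟨x₀, δ₀, T₀⟩, hp₀, rfl⟩ := Finset.mem_image.1 hS
  simp only [hX, Finset.mem_product, Finset.mem_powersetCard] at hp₀
  obtain ⟨hx₀, hδ₀, hT₀, hT₀w⟩ := hp₀
  have hδ₀H := hΔ _ hδ₀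
  have hcard : ((elems k ×ˢ HF) ×ˢ ((elems k).erase 0 ×ˢ HF)).card =
      ((elems k).card * HF.card) * (((elems k).card - 1) * HF.card) := by
    rw [Finset.card_product, Finset.card_product, Finset.card_product,
      Finset.card_erase_of_mem (by simp [k.zero_mem])]
  rw [← hcard]
  symm
  -- Each fibre is parametrised by the new origin τ, the scale α ≠ 0 and the shifts of base point
  -- and direction by H.
  refine Finset.card_bij (fun p _ => (x₀ + p.1.1 • δ₀ + p.1.2, p.2.1 • δ₀ + p.2.2,
    T₀.image fun t => (t - p.1.1) / p.2.1)) ?_ ?_ ?_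
  · rintro ⟨⟨τ, h⟩, ⟨α, h'⟩⟩ hp
    simp only [Finset.mem_product, mem_elems, hHF', Finset.mem_erase] at hp
    obtain ⟨⟨hτ, hh⟩, ⟨hα0, hα⟩, hh'⟩ := hp
    simp only [hX, hΦ, Finset.mem_filter, Finset.mem_product, Finset.mem_powersetCard]
    refine ⟨⟨hA _ hx₀ _ hδ₀ _ hτ _ hh, hΔ' _ hδ₀ _ hα hα0 _ hh', ?_, ?_⟩,
      cosets_change hH hT₀ hτ hα hα0 hh hh'⟩
    · intro t ht
      obtain ⟨s, hs, rfl⟩ := Finset.mem_image.1 ht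
      rw [mem_elems]
      exact k.div_mem (k.sub_mem (by simpa using hT₀ hs) hτ) hα
    · rw [Finset.card_image_of_injective, hT₀w]
      intro s s' hss
      simpa [div_left_inj' hα0] using hss
  · rintro ⟨⟨τ, h⟩, ⟨α, h'⟩⟩ hp ⟨⟨τ₁, h₁⟩, ⟨α₁, h₁'⟩⟩ hp₁ heq
    simp only [Finset.mem_product, mem_elems, hHF', Finset.mem_erase] at hp hp₁
    simp only [Prod.mk.injEq] at heq
    obtain ⟨e1, e2, -⟩ := heq
    have hτ : τ = τ₁ := by
      refine eq_of_sub_smul_mem hH hδ₀H hp.1.1 hp₁.1.1 ?_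
      have : (τ - τ₁) • δ₀ = h₁ - h := by
        rw [sub_smul, sub_eq_sub_iff_add_eq_add]
        rw [add_assoc, add_assoc] at e1
        rw [add_left_cancel e1, add_comm]
      rw [this]
      exact H.sub_mem hp₁.1.2 hp.1.2
    have hα : α = α₁ := by
      refine eq_of_sub_smul_mem hH hδ₀H hp.2.1.2 hp₁.2.1.2 ?_
      have : (α - α₁) • δ₀ = h₁' - h' := by
        rw [sub_smul, sub_eq_sub_iff_add_eq_add, e2, add_comm]
      rw [this]
      exact H.sub_mem hp₁.2.2 hp.2.2
    subst hτ hα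
    rw [add_left_cancel e1, add_left_cancel e2]
  · rintro ⟨x, δ, T⟩ hp
    simp only [hX, hΦ, Finset.mem_filter, Finset.mem_product, Finset.mem_powersetCard] at hp
    obtain ⟨⟨hx, hδ, hT, hTw⟩, hS⟩ := hp
    have hδH := hΔ _ hδ
    -- Two cosets exist because 2 ≤ w. Their parameters in the two descriptions determine α and τ.
    obtain ⟨t₁, ht₁, t₂, ht₂, hne⟩ := Finset.one_lt_card.1 (by omega : 1 < T.card)
    have hk₁ : t₁ ∈ k := by simpa using hT ht₁
    have hk₂ : t₂ ∈ k := by simpa using hT ht₂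
    have m₁ := (add_smul_mem_cosets (x := x) hH hδH hT hk₁).2 ht₁
    have m₂ := (add_smul_mem_cosets (x := x) hH hδH hT hk₂).2 ht₂
    rw [hS, mem_cosets] at m₁ m₂
    obtain ⟨a₁, ha₁, m₁⟩ := m₁
    obtain ⟨a₂, ha₂, m₂⟩ := m₂
    have hak₁ : a₁ ∈ k := by simpa using hT₀ ha₁
    have hak₂ : a₂ ∈ k := by simpa using hT₀ ha₂
    have ht0 : t₁ - t₂ ≠ 0 := sub_ne_zero.2 hne
    set α := (a₁ - a₂) / (t₁ - t₂) with hα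
    have hαk : α ∈ k := k.div_mem (k.sub_mem hak₁ hak₂) (k.sub_mem hk₁ hk₂)
    have hδα : δ - α • δ₀ ∈ H := by
      have h1 : δ - α • δ₀ = (t₁ - t₂)⁻¹ • ((x + t₁ • δ - x₀ - a₁ • δ₀) -
          (x + t₂ • δ - x₀ - a₂ • δ₀)) := by
        have : (x + t₁ • δ - x₀ - a₁ • δ₀) - (x + t₂ • δ - x₀ - a₂ • δ₀) =
            (t₁ - t₂) • δ - (a₁ - a₂) • δ₀ := by
          rw [sub_smul, sub_smul]
          abel
        rw [this, smul_sub, smul_smul, smul_smul, inv_mul_cancel₀ ht0, one_smul, hα,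
          div_eq_inv_mul]
      rw [h1]
      exact hH _ (k.inv_mem (k.sub_mem hk₁ hk₂)) _ (H.sub_mem m₁ m₂)
    have hα0 : α ≠ 0 := by
      intro h0
      rw [h0, zero_smul, sub_zero] at hδα
      exact hδH hδα
    set τ := a₁ - t₁ * α with hτ
    have hτk : τ ∈ k := k.sub_mem hak₁ (k.mul_mem hk₁ hαk)
    have hxτ : x - x₀ - τ • δ₀ ∈ H := by
      have : x - x₀ - τ • δ₀ = (x + t₁ • δ - x₀ - a₁ • δ₀) - t₁ • (δ - α • δ₀) := by
        rw [hτ, sub_smul, smul_sub, smul_smul]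
        abel
      rw [this]
      exact H.sub_mem m₁ (hH _ hk₁ _ hδα)
    have ex : x₀ + τ • δ₀ + (x - x₀ - τ • δ₀) = x := by abel
    have ed : α • δ₀ + (δ - α • δ₀) = δ := by abel
    refine ⟨((τ, x - x₀ - τ • δ₀), (α, δ - α • δ₀)), ?_, ?_⟩
    · simp only [Finset.mem_product, mem_elems, hHF', Finset.mem_erase]
      exact ⟨⟨hτk, hxτ⟩, ⟨hα0, hαk⟩, hδα⟩
    · have hc := cosets_change (x := x₀) (δ := δ₀) hH hT₀ hτk hαk hα0 hxτ hδα
      simp only [ex, ed] at hc ⊢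
      have hT' : (T₀.image fun t => (t - τ) / α) ⊆ elems k := by
        intro t ht
        obtain ⟨s, hs, rfl⟩ := Finset.mem_image.1 ht
        rw [mem_elems]
        exact k.div_mem (k.sub_mem (by simpa using hT₀ hs) hτk) hαk
      congr 2
      ext t
      constructor
      · intro ht
        have htk : t ∈ k := by simpa using hT' ht
        rwa [← add_smul_mem_cosets (x := x) hH hδH hT htk, hS, ← hc,
          add_smul_mem_cosets hH hδH hT' htk]
      · intro ht
        have htk : t ∈ k := by simpa using hT ht
        rwa [← add_smul_mem_cosets (x := x) hH hδH hT' htk, hc, ← hS,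
          add_smul_mem_cosets hH hδH hT htk]

end Cosets

end AffineCartesian

namespace AffineCartesian

/-! ### Coordinates grouped by the size of their field. -/

section Levels

variable {F : Type*} [Field F] {n : ℕ} {K : Fin n → Subfield F}

open scoped Classical in
/-- The coordinates whose field contains `K a`. -/
noncomputable def upper (K : Fin n → Subfield F) (a : Fin n) : Finset (Fin n) :=
  Finset.univ.filter fun i => K a ≤ K i

open scoped Classical in
/-- The coordinates whose field strictly contains `K a`. -/
noncomputable def strictUpper (K : Fin n → Subfield F) (a : Fin n) : Finset (Fin n) :=
  Finset.univ.filter fun i => K a < K i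

@[simp] theorem mem_upper {a i : Fin n} : i ∈ upper K a ↔ K a ≤ K i := by simp [upper]

@[simp] theorem mem_strictUpper {a i : Fin n} : i ∈ strictUpper K a ↔ K a < K i := by
  simp [strictUpper]

/-- The coordinates whose field is `K a`. -/
abbrev Level (K : Fin n → Subfield F) (a : Fin n) : Type := {i : Fin n // K i = K a}

/-- The subspace of `K j`-valued vectors cut out by the coordinates of level `j` from `H`. -/
def residue (j : Fin n) (H : AddSubgroup (Fin n → F)) (hH : ∀ c ∈ K j, ∀ v ∈ H, c • v ∈ H) :
    Submodule (K j) (Level K j → K j) where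
  carrier := {w | ∃ v ∈ H, ∀ b, v b.1 = w b}
  zero_mem' := ⟨0, H.zero_mem, fun _ => rfl⟩
  add_mem' := by
    rintro w w' ⟨v, hv, h⟩ ⟨v', hv', h'⟩
    exact ⟨v + v', H.add_mem hv hv', fun b => by simp [h, h']⟩
  smul_mem' := by
    rintro c w ⟨v, hv, h⟩
    exact ⟨(c : F) • v, hH c c.2 v hv, fun b => by simp [h]⟩

theorem mem_residue {j : Fin n} {H : AddSubgroup (Fin n → F)}
    {hH : ∀ c ∈ K j, ∀ v ∈ H, c • v ∈ H} {w : Level K j → K j} :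
    w ∈ residue j H hH ↔ ∃ v ∈ H, ∀ b, v b.1 = w b := Iff.rfl

/-- The components of level `j` of a point of a box. -/
def restrict (j : Fin n) (v : Fin n → F) (hv : ∀ i, v i ∈ K i) (b : Level K j) : K j :=
  ⟨v b.1, b.2.le (hv b.1)⟩

open scoped Classical in
/-- Extension of a vector by zero. -/
noncomputable def extend (j : Fin n) (w : Level K j → K j) (i : Fin n) : F :=
  if h : K i = K j then w ⟨i, h⟩ else 0

theorem extend_level {j : Fin n} (w : Level K j → K j) (b : Level K j) :
    extend j w b.1 = w b := by
  simp [extend, b.2]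

/-- The first coordinate with a larger field starts the next level. This transfers statements about
`upper` to `strictUpper`. -/
theorem strictUpper_eq_upper (hK : Monotone K) (a : Fin n) :
    strictUpper K a = ∅ ∨ ∃ b, strictUpper K a = upper K b := by
  rcases (strictUpper K a).eq_empty_or_nonempty with h | h
  · exact Or.inl h
  · right
    refine ⟨(strictUpper K a).min' h, ?_⟩
    ext i
    rw [mem_upper]
    constructor
    · intro hi
      exact hK (Finset.min'_le _ _ hi)
    · intro hi
      exact mem_strictUpper.2 (lt_of_lt_of_le (mem_strictUpper.1 (Finset.min'_mem _ h)) hi)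

end Levels

/-! ### The groups H and their correspondence with subspaces over `K j`. -/

section Groups

open Module

variable {F : Type*} [Field F] [Fintype F] {n : ℕ} {K : Fin n → Subfield F}
  {I : Finset (Fin n)}

/-- The additive group of the points of a box. -/
def boxGroup (K : Fin n → Subfield F) (I : Finset (Fin n)) : AddSubgroup (Fin n → F) where
  carrier := {v | v ∈ box K I}
  zero_mem' := zero_mem_box
  add_mem' := by
    intro v w hv hw
    rw [Set.mem_ofPred_eq, mem_box] at *
    exact fun i => ⟨(K i).add_mem (hv i).1 (hw i).1, fun h => by
      rw [Pi.add_apply, (hv i).2 h, (hw i).2 h, add_zero]⟩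
  neg_mem' := by
    intro v hv
    rw [Set.mem_ofPred_eq, mem_box] at *
    exact fun i => ⟨(K i).neg_mem (hv i).1, fun h => by
      rw [Pi.neg_apply, (hv i).2 h, neg_zero]⟩

@[simp] theorem mem_boxGroup {v : Fin n → F} : v ∈ boxGroup K I ↔ v ∈ box K I := Iff.rfl

theorem card_box_eq_prod : (box K I).card = ∏ i ∈ I, (elems (K i)).card := by
  rw [card_box]
  simp only [dims]
  rw [Finset.prod_ite_mem, Finset.univ_inter]

theorem card_boxGroup : Nat.card (boxGroup K I) = ∏ i ∈ I, (elems (K i)).card := by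
  classical
  rw [← card_box_eq_prod, Nat.card_eq_fintype_card]
  exact Fintype.card_of_subtype (box K I) fun v => mem_boxGroup.symm

theorem smul_mem_box {a : Fin n} (hI : ∀ i ∈ I, K a ≤ K i) {c : F} (hc : c ∈ K a)
    {v : Fin n → F} (hv : v ∈ box K I) : c • v ∈ box K I := by
  rw [mem_box] at *
  intro i
  rw [Pi.smul_apply, smul_eq_mul]
  by_cases hi : i ∈ I
  · exact ⟨(K i).mul_mem (hI i hi hc) (hv i).1, fun h => absurd hi h⟩
  · rw [(hv i).2 hi, mul_zero]
    exact ⟨(K i).zero_mem, fun _ => rfl⟩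

/-- If v i ≠ 0 and both v i and c * v i lie in K i, then so does c. The right-hand side is expressed
through scalar multiplication and the full box alone, so every linear automorphism of the full box
preserves it. -/
theorem mem_box_upper {a : Fin n} {v : Fin n → F} :
    v ∈ box K (upper K a) ↔ ∀ c ∈ K a, c • v ∈ box K Finset.univ := by
  constructor
  · intro hv c hc
    exact box_mono (Finset.subset_univ _) (smul_mem_box (fun i hi => mem_upper.1 hi) hc hv)
  · intro h
    rw [mem_box]
    have h1 : ∀ i, v i ∈ K i := by
      have := h 1 (K a).one_mem
      rwa [one_smul, mem_box_univ] at this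
    refine fun i => ⟨h1 i, fun hi => ?_⟩
    by_contra h0
    refine hi (mem_upper.2 fun c hc => ?_)
    have h2 := mem_box_univ.1 (h c hc) i
    have h3 := (K i).div_mem h2 (h1 i)
    rwa [Pi.smul_apply, smul_eq_mul, mul_div_cancel_right₀ _ h0] at h3

theorem map_mem_box_upper {M : (Fin n → F) ≃ₗ[F] (Fin n → F)}
    (hM : ∀ v, M v ∈ box K Finset.univ ↔ v ∈ box K Finset.univ) (a : Fin n) (v : Fin n → F) :
    M v ∈ box K (upper K a) ↔ v ∈ box K (upper K a) := by
  rw [mem_box_upper, mem_box_upper]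
  refine forall₂_congr fun c _ => ?_
  rw [← map_smul, hM]

theorem map_mem_box_strictUpper (hK : Monotone K) {M : (Fin n → F) ≃ₗ[F] (Fin n → F)}
    (hM : ∀ v, M v ∈ box K Finset.univ ↔ v ∈ box K Finset.univ) (a : Fin n) (v : Fin n → F) :
    M v ∈ box K (strictUpper K a) ↔ v ∈ box K (strictUpper K a) := by
  rcases strictUpper_eq_upper hK a with h | ⟨b, h⟩
  · have h0 : ∀ y : Fin n → F, y ∈ box K (∅ : Finset (Fin n)) ↔ y = 0 := fun y =>
      ⟨fun hy => funext fun i => (mem_box.1 hy i).2 (by simp), fun hy => hy ▸ zero_mem_box⟩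
    rw [h, h0, h0, LinearEquiv.map_eq_zero_iff]
  · rw [h]
    exact map_mem_box_upper hM b v

/-- The possible directions of the smallest cosets in supports of minimum weight words: the groups
between `box K (strictUpper K j)` and `box K (upper K j)` which are closed under multiplication by
`K j` and have as many elements as the group of points whose coordinates vanish up to `j`. -/
def tailGroups (K : Fin n → Subfield F) (j : Fin n) : Set (AddSubgroup (Fin n → F)) :=
  {H | boxGroup K (strictUpper K j) ≤ H ∧ H ≤ boxGroup K (upper K j) ∧
    (∀ c ∈ K j, ∀ v ∈ H, c • v ∈ H) ∧ Nat.card H = ∏ i ∈ Finset.Ioi j, (elems (K i)).card}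

theorem boxGroup_Ioi_mem (hK : Monotone K) (j : Fin n) :
    boxGroup K (Finset.Ioi j) ∈ tailGroups K j := by
  refine ⟨?_, ?_, ?_, card_boxGroup⟩
  · refine box_mono fun i hi => Finset.mem_Ioi.2 ?_
    by_contra h
    exact (mem_strictUpper.1 hi).not_ge (hK (not_lt.1 h))
  · exact box_mono fun i hi => mem_upper.2 (hK (Finset.mem_Ioi.1 hi).le)
  · intro c hc v hv
    exact smul_mem_box (fun i hi => hK (Finset.mem_Ioi.1 hi).le) hc hv

theorem map_mem_tailGroups (hK : Monotone K) {M : (Fin n → F) ≃ₗ[F] (Fin n → F)}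
    (hM : ∀ v, M v ∈ box K Finset.univ ↔ v ∈ box K Finset.univ) {j : Fin n}
    {H : AddSubgroup (Fin n → F)} (hH : H ∈ tailGroups K j) :
    H.map (M : (Fin n → F) →+ (Fin n → F)) ∈ tailGroups K j := by
  obtain ⟨h1, h2, h3, h4⟩ := hH
  refine ⟨?_, ?_, ?_, ?_⟩
  · intro v hv
    refine ⟨M.symm v, h1 ?_, M.apply_symm_apply v⟩
    rw [mem_boxGroup, ← map_mem_box_strictUpper hK hM, M.apply_symm_apply]
    exact hv
  · rintro _ ⟨v, hv, rfl⟩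
    exact (map_mem_box_upper hM j v).2 (h2 hv)
  · rintro c hc _ ⟨v, hv, rfl⟩
    exact ⟨c • v, h3 c hc v hv, map_smul M c v⟩
  · rw [← h4]
    exact Nat.card_congr (H.equivMapOfInjective _ M.injective).toEquiv.symm

open scoped Classical in
/-- The directions of lines over `K k` in supports of minimum weight words. -/
noncomputable def directions (K : Fin n → Subfield F) (k : Fin n) (H : AddSubgroup (Fin n → F)) :
    Finset (Fin n → F) :=
  (box K (upper K k)).filter fun δ => δ ∉ box K (strictUpper K k) ∧ δ ∉ H

theorem mem_directions {k : Fin n} {H : AddSubgroup (Fin n → F)} {δ : Fin n → F} :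
    δ ∈ directions K k H ↔ δ ∈ box K (upper K k) ∧ δ ∉ box K (strictUpper K k) ∧ δ ∉ H := by
  simp [directions]

theorem map_mem_directions (hK : Monotone K) {M : (Fin n → F) ≃ₗ[F] (Fin n → F)}
    (hM : ∀ v, M v ∈ box K Finset.univ ↔ v ∈ box K Finset.univ) {k : Fin n}
    {H : AddSubgroup (Fin n → F)} {δ : Fin n → F} (hδ : δ ∈ directions K k H) :
    M δ ∈ directions K k (H.map (M : (Fin n → F) →+ (Fin n → F))) := by
  rw [mem_directions] at *
  rw [map_mem_box_upper hM, map_mem_box_strictUpper hK hM]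
  refine ⟨hδ.1, hδ.2.1, ?_⟩
  rintro ⟨v, hv, hvδ⟩
  exact hδ.2.2 (M.injective hvδ ▸ hv)

theorem single_mem_box {k : Fin n} (hk : k ∈ I) {c : F} (hc : c ∈ K k) :
    Pi.single k c ∈ box K I := by
  have := update_mem_box (zero_mem_box (K := K) (I := I)) hk hc
  exact this

theorem single_mem_directions {j k : Fin n} (hk : k ≤ j) :
    Pi.single k (1 : F) ∈ directions K k (boxGroup K (Finset.Ioi j)) := by
  refine mem_directions.2 ⟨single_mem_box (mem_upper.2 le_rfl) (K k).one_mem, fun h => ?_,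
    fun h => ?_⟩
  · have := (mem_box.1 h k).2 (by simp)
    simp at this
  · have := (mem_box.1 (mem_boxGroup.1 h) k).2 (by simpa using hk)
    simp at this

theorem extend_mem_box {j : Fin n} (w : Level K j → K j) : extend j w ∈ box K (upper K j) := by
  rw [mem_box]
  intro i
  by_cases h : K i = K j
  · have := extend_level w ⟨i, h⟩
    dsimp only at this
    rw [this]
    refine ⟨?_, fun h' => absurd (mem_upper.2 h.ge) h'⟩
    have h2 := (w ⟨i, h⟩).2
    rw [h]
    exact h2
  · simp [extend, h, (K i).zero_mem]

theorem sub_mem_strictUpper {j : Fin n} {v v' : Fin n → F} (hv : v ∈ box K (upper K j))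
    (hv' : v' ∈ box K (upper K j)) (h : ∀ b : Level K j, v b.1 = v' b.1) :
    v - v' ∈ box K (strictUpper K j) := by
  have hs : v - v' ∈ boxGroup K (upper K j) := (boxGroup K (upper K j)).sub_mem hv hv'
  rw [mem_boxGroup, mem_box] at hs
  rw [mem_box]
  refine fun i => ⟨(hs i).1, fun hi => ?_⟩
  by_cases h1 : K j ≤ K i
  · have h2 : K i = K j := by
      by_contra hne
      exact hi (mem_strictUpper.2 (lt_of_le_of_ne h1 (Ne.symm hne)))
    have := h ⟨i, h2⟩
    dsimp only at this
    rw [Pi.sub_apply, this, sub_self]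
  · exact (hs i).2 fun h => h1 (mem_upper.1 h)

/-- H contains everything of strictly higher level, so only the components of level j matter. -/
theorem mem_iff_mem_residue {j : Fin n} {H : AddSubgroup (Fin n → F)} (hH : H ∈ tailGroups K j)
    {v : Fin n → F} (hv : v ∈ box K (upper K j)) {w : Level K j → K j}
    (hw : ∀ b : Level K j, v b.1 = w b) : v ∈ H ↔ w ∈ residue j H hH.2.2.1 := by
  refine ⟨fun h => ⟨v, h, hw⟩, ?_⟩
  rintro ⟨v', hv', hw'⟩
  have h1 := hH.1 (sub_mem_strictUpper hv (hH.2.1 hv') fun b => (hw b).trans (hw' b).symm)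
  have := H.add_mem h1 hv'
  rwa [sub_add_cancel] at this

theorem natCard_eq_card_elems (k : Subfield F) : Nat.card k = (elems k).card := by
  classical
  rw [Nat.card_eq_fintype_card]
  exact Fintype.card_of_subtype _ fun x => mem_elems

/-- Each element of H is uniquely the extension by zero of its components of level j plus a vector
of strictly higher level. -/
theorem card_eq_pow_residue {j : Fin n} {H : AddSubgroup (Fin n → F)}
    (h₁ : boxGroup K (strictUpper K j) ≤ H) (h₂ : H ≤ boxGroup K (upper K j))
    (hH : ∀ c ∈ K j, ∀ v ∈ H, c • v ∈ H) :
    Nat.card H = (elems (K j)).card ^ finrank (K j) (residue j H hH) *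
      ∏ i ∈ strictUpper K j, (elems (K i)).card := by
  have hext : ∀ w ∈ residue j H hH, extend j w ∈ H := by
    rintro w ⟨v, hv, hw⟩
    have h := h₁ (sub_mem_strictUpper (extend_mem_box w) (h₂ hv)
      fun b => (extend_level w b).trans (hw b).symm)
    have := H.add_mem h hv
    rwa [sub_add_cancel] at this
  let Φ : residue j H hH × boxGroup K (strictUpper K j) → H := fun p =>
    ⟨extend j p.1.1 + p.2.1, H.add_mem (hext _ p.1.2) (h₁ p.2.2)⟩
  have hz : ∀ z ∈ box K (strictUpper K j), ∀ b : Level K j, z b.1 = 0 := fun z hz b =>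
    (mem_box.1 hz b.1).2 (by simp [b.2])
  have hΦ : Function.Bijective Φ := by
    constructor
    · rintro ⟨⟨w, hw⟩, ⟨z, hz₁⟩⟩ ⟨⟨w', hw'⟩, ⟨z', hz₂⟩⟩ h
      have h := congrArg Subtype.val h
      dsimp only [Φ] at h
      have hww : w = w' := by
        funext b
        have := congrFun h b.1
        rw [Pi.add_apply, Pi.add_apply, hz z hz₁, hz z' hz₂, add_zero, add_zero, extend_level,
          extend_level] at this
        exact Subtype.ext this
      subst hww
      have := add_left_cancel h
      subst this
      rfl
    · rintro ⟨v, hv⟩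
      have hvK : ∀ i, v i ∈ K i := fun i => (mem_box.1 (h₂ hv) i).1
      refine ⟨⟨⟨restrict j v hvK, v, hv, fun _ => rfl⟩, ⟨v - extend j (restrict j v hvK), ?_⟩⟩, ?_⟩
      · exact sub_mem_strictUpper (h₂ hv) (extend_mem_box _) fun b =>
          (extend_level (restrict j v hvK) b).symm
      · refine Subtype.ext ?_
        simp only [Φ]
        abel
  rw [← Nat.card_eq_of_bijective Φ hΦ, Nat.card_prod, card_boxGroup,
    Module.natCard_eq_pow_finrank (K := K j), natCard_eq_card_elems]

open scoped Classical in
theorem prod_Ioi_eq (hK : Monotone K) (j : Fin n) :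
    ∏ i ∈ Finset.Ioi j, (elems (K i)).card =
      (elems (K j)).card ^ ((Finset.Ioi j).filter fun i => K i = K j).card *
        ∏ i ∈ strictUpper K j, (elems (K i)).card := by
  rw [← Finset.prod_filter_mul_prod_filter_not _ (fun i => K i = K j)]
  congr 1
  · rw [← Finset.prod_const]
    exact Finset.prod_congr rfl fun i hi => by rw [(Finset.mem_filter.1 hi).2]
  · refine Finset.prod_congr ?_ fun _ _ => rfl
    ext i
    rw [Finset.mem_filter, Finset.mem_Ioi, mem_strictUpper]
    constructor
    · rintro ⟨h1, h2⟩
      exact lt_of_le_of_ne (hK h1.le) (Ne.symm h2)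
    · intro h
      refine ⟨?_, h.ne'⟩
      by_contra h'
      exact h.not_ge (hK (not_lt.1 h'))

open scoped Classical in
theorem finrank_residue (hK : Monotone K) {j : Fin n} {H : AddSubgroup (Fin n → F)}
    (hH : H ∈ tailGroups K j) : finrank (K j) (residue j H hH.2.2.1) =
      ((Finset.Ioi j).filter fun i => K i = K j).card := by
  have h1 := card_eq_pow_residue hH.1 hH.2.1 hH.2.2.1
  have h1 := (hH.2.2.2.trans (prod_Ioi_eq hK j)).symm.trans h1
  have hpos : 0 < ∏ i ∈ strictUpper K j, (elems (K i)).card :=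
    Finset.prod_pos fun i _ => (one_lt_card_elems _).le
  exact (Nat.pow_right_injective (one_lt_card_elems (K j))
    (Nat.eq_of_mul_eq_mul_right hpos h1)).symm

open scoped Classical in
-- Taking residues is a bijection from these groups to the K j-subspaces whose dimension is the
-- number of coordinates of level j beyond j.
theorem card_tailGroups (hK : Monotone K) (j : Fin n) {m : ℕ}
    (hm : Fintype.card (Level K j) = m) :
    Nat.card (tailGroups K j) =
      gaussBinom (K j) m ((Finset.Ioi j).filter fun i => K i = K j).card := by
  set c := ((Finset.Ioi j).filter fun i => K i = K j).card with hc
  have h1 : Nat.card {W : Submodule (K j) (Level K j → K j) // finrank (K j) W = c} =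
      gaussBinom (K j) m c := by
    let e : (Level K j → K j) ≃ₗ[K j] (Fin m → K j) :=
      LinearEquiv.funCongrLeft (K j) (K j) (Fintype.equivFinOfCardEq hm).symm
    refine Nat.card_congr (Equiv.subtypeEquiv (Submodule.orderIsoMapComap e).toEquiv fun W => ?_)
    have : finrank (K j) (W.map e.toLinearMap) = finrank (K j) W := LinearEquiv.finrank_map_eq e W
    rw [← this]
    rfl
  rw [← h1]
  refine Nat.card_eq_of_bijective
    (fun H : tailGroups K j => ⟨residue j H.1 H.2.2.2.1, finrank_residue hK H.2⟩) ⟨?_, ?_⟩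
  · rintro ⟨H, hH⟩ ⟨H', hH'⟩ h
    have h := congrArg Subtype.val h
    dsimp only at h
    refine Subtype.ext (le_antisymm (fun v hv => ?_) fun v hv => ?_)
    · have hvK : ∀ i, v i ∈ K i := fun i => (mem_box.1 (hH.2.1 hv) i).1
      rw [mem_iff_mem_residue hH' (hH.2.1 hv) (w := restrict j v hvK) fun _ => rfl, ← h,
        ← mem_iff_mem_residue hH (hH.2.1 hv) fun _ => rfl]
      exact hv
    · have hvK : ∀ i, v i ∈ K i := fun i => (mem_box.1 (hH'.2.1 hv) i).1
      rw [mem_iff_mem_residue hH (hH'.2.1 hv) (w := restrict j v hvK) fun _ => rfl, h,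
        ← mem_iff_mem_residue hH' (hH'.2.1 hv) fun _ => rfl]
      exact hv
  · rintro ⟨W, hW⟩
    let H : AddSubgroup (Fin n → F) :=
      { carrier := {v | v ∈ box K (upper K j) ∧ ∃ w ∈ W, ∀ b : Level K j, v b.1 = w b}
        zero_mem' := ⟨zero_mem_box, 0, W.zero_mem, fun _ => rfl⟩
        add_mem' := by
          rintro v v' ⟨hv, w, hw, h⟩ ⟨hv', w', hw', h'⟩
          exact ⟨(boxGroup K (upper K j)).add_mem hv hv', w + w', W.add_mem hw hw',
            fun b => by simp [h, h']⟩
        neg_mem' := by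
          rintro v ⟨hv, w, hw, h⟩
          exact ⟨(boxGroup K (upper K j)).neg_mem hv, -w, W.neg_mem hw, fun b => by simp [h]⟩ }
    have hsm : ∀ c ∈ K j, ∀ v ∈ H, c • v ∈ H := by
      rintro c hc v ⟨hv, w, hw, h⟩
      refine ⟨smul_mem_box (fun i hi => mem_upper.1 hi) hc hv, (⟨c, hc⟩ : K j) • w,
        W.smul_mem _ hw, fun b => ?_⟩
      rw [Pi.smul_apply, h, Pi.smul_apply]
      rfl
    have hlow : boxGroup K (strictUpper K j) ≤ H := by
      intro v hv
      refine ⟨box_mono (fun i hi => mem_upper.2 (mem_strictUpper.1 hi).le) hv, 0, W.zero_mem,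
        fun b => ?_⟩
      rw [(mem_box.1 hv b.1).2 (by simp [b.2])]
      rfl
    have hup : H ≤ boxGroup K (upper K j) := fun v hv => hv.1
    have hres : residue j H hsm = W := by
      ext w
      rw [mem_residue]
      constructor
      · rintro ⟨v, ⟨_, w', hw', h'⟩, h⟩
        have : w = w' := funext fun b => Subtype.ext ((h b).symm.trans (h' b))
        rwa [this]
      · intro hw
        exact ⟨extend j w, ⟨extend_mem_box w, w, hw, extend_level w⟩, extend_level w⟩
    have hcard := card_eq_pow_residue hlow hup hsm
    rw [hres, hW, hc, ← prod_Ioi_eq hK] at hcard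
    exact ⟨⟨H, hlow, hup, hsm, hcard⟩, Subtype.ext hres⟩

end Groups

end AffineCartesian

namespace AffineCartesian

/-! ### Linear automorphisms acting on a single level. -/

section LevelMap

open scoped Classical

variable {F : Type*} [Field F] {n : ℕ} {K : Fin n → Subfield F}

/-- The linear map acting by a matrix on the coordinates of level `a`. -/
noncomputable def levelMap (a : Fin n) (G : Matrix (Level K a) (Level K a) F) :
    (Fin n → F) →ₗ[F] (Fin n → F) where
  toFun v i := if h : K i = K a then G.mulVec (fun b => v b.1) ⟨i, h⟩ else v i
  map_add' v w := by
    funext i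
    by_cases h : K i = K a
    · simp only [h, dif_pos, Pi.add_apply]
      exact congrFun (Matrix.mulVec_add G (fun b => v b.1) fun b => w b.1) _
    · simp [h]
  map_smul' c v := by
    funext i
    by_cases h : K i = K a
    · simp only [h, dif_pos, Pi.smul_apply, RingHom.id_apply]
      exact congrFun (Matrix.mulVec_smul G c fun b => v b.1) _
    · simp [h]

theorem levelMap_level (a : Fin n) (G : Matrix (Level K a) (Level K a) F) (v : Fin n → F)
    (b : Level K a) : levelMap a G v b.1 = G.mulVec (fun b => v b.1) b := by
  simp [levelMap, b.2]

theorem levelMap_of_ne (a : Fin n) (G : Matrix (Level K a) (Level K a) F) (v : Fin n → F)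
    {i : Fin n} (h : K i ≠ K a) : levelMap a G v i = v i := by
  simp [levelMap, h]

theorem levelMap_comp (a : Fin n) {G G' : Matrix (Level K a) (Level K a) F}
    (h : G * G' = 1) : levelMap a G ∘ₗ levelMap a G' = LinearMap.id := by
  refine LinearMap.ext fun v => funext fun i => ?_
  rw [LinearMap.comp_apply, LinearMap.id_apply]
  by_cases hi : K i = K a
  · have h1 : (fun b : Level K a => levelMap a G' v b.1) = G'.mulVec fun b => v b.1 :=
      funext fun b => levelMap_level a G' v b
    have := levelMap_level a G (levelMap a G' v) ⟨i, hi⟩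
    rw [h1, Matrix.mulVec_mulVec, h, Matrix.one_mulVec] at this
    exact this
  · rw [levelMap_of_ne _ _ _ hi, levelMap_of_ne _ _ _ hi]

/-- The linear automorphism acting by `g` on the coordinates of level `a`. -/
noncomputable def levelEquiv (a : Fin n) (g : (Level K a → K a) ≃ₗ[K a] (Level K a → K a)) :
    (Fin n → F) ≃ₗ[F] (Fin n → F) :=
  LinearEquiv.ofLinearMap
    (levelMap a ((LinearMap.toMatrix' g.toLinearMap).map (K a).subtype))
    (levelMap a ((LinearMap.toMatrix' g.symm.toLinearMap).map (K a).subtype))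
    (levelMap_comp a (by
      rw [← Matrix.map_mul, ← LinearMap.toMatrix'_comp, LinearEquiv.comp_coe,
        LinearEquiv.symm_trans_self, LinearEquiv.refl_toLinearMap, LinearMap.toMatrix'_id,
        Matrix.map_one _ (map_zero _) (map_one _)]))
    (levelMap_comp a (by
      rw [← Matrix.map_mul, ← LinearMap.toMatrix'_comp, LinearEquiv.comp_coe,
        LinearEquiv.self_trans_symm, LinearEquiv.refl_toLinearMap, LinearMap.toMatrix'_id,
        Matrix.map_one _ (map_zero _) (map_one _)]))

theorem levelEquiv_of_ne (a : Fin n) (g : (Level K a → K a) ≃ₗ[K a] (Level K a → K a))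
    (v : Fin n → F) {i : Fin n} (h : K i ≠ K a) : levelEquiv a g v i = v i :=
  levelMap_of_ne _ _ _ h

theorem levelEquiv_level (a : Fin n) (g : (Level K a → K a) ≃ₗ[K a] (Level K a → K a))
    {v : Fin n → F} {w : Level K a → K a} (hw : ∀ b : Level K a, v b.1 = w b) (b : Level K a) :
    levelEquiv a g v b.1 = g w b := by
  have h1 : levelEquiv a g v b.1 =
      ((LinearMap.toMatrix' g.toLinearMap).map (K a).subtype).mulVec (fun b => v b.1) b := by
    rw [← levelMap_level]
    rfl
  have h2 : (fun b : Level K a => v b.1) = (K a).subtype ∘ w := funext hw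
  rw [h1, h2, ← RingHom.map_mulVec, LinearMap.toMatrix'_mulVec]
  rfl

theorem levelEquiv_eq_self {a : Fin n} (g : (Level K a → K a) ≃ₗ[K a] (Level K a → K a))
    {v : Fin n → F} (hv : ∀ b : Level K a, v b.1 = 0) : levelEquiv a g v = v := by
  funext i
  by_cases hi : K i = K a
  · have := levelEquiv_level a g (v := v) (w := 0) (fun b => hv b) ⟨i, hi⟩
    rw [map_zero] at this
    exact this.trans (hv ⟨i, hi⟩).symm
  · exact levelEquiv_of_ne _ _ _ hi

end LevelMap

/-! ### Transitivity on pairs of a group and a direction. -/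

section Orbits

open Module

variable {F : Type*} [Field F] [Fintype F] {n : ℕ} {K : Fin n → Subfield F}

theorem levelEquiv_mem_box {a : Fin n} (g : (Level K a → K a) ≃ₗ[K a] (Level K a → K a))
    (v : Fin n → F) : levelEquiv a g v ∈ box K Finset.univ ↔ v ∈ box K Finset.univ := by
  have key : ∀ (g : (Level K a → K a) ≃ₗ[K a] (Level K a → K a)) (v : Fin n → F),
      v ∈ box K Finset.univ → levelEquiv a g v ∈ box K Finset.univ := by
    intro g v hv
    rw [mem_box_univ] at *
    intro i
    by_cases hi : K i = K a
    · have := levelEquiv_level a g (v := v) (w := restrict a v hv) (fun _ => rfl) ⟨i, hi⟩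
      dsimp only at this
      rw [this, hi]
      exact (g _ _).2
    · rw [levelEquiv_of_ne _ _ _ hi]
      exact hv i
  refine ⟨fun h => ?_, key g v⟩
  have h1 := key g.symm _ h
  have h2 : levelEquiv a g.symm (levelEquiv a g v) = v := (levelEquiv a g).symm_apply_apply v
  rwa [h2] at h1

theorem map_eq_of_residue {j : Fin n} {H H' : AddSubgroup (Fin n → F)}
    (hH : H ∈ tailGroups K j) (hH' : H' ∈ tailGroups K j)
    (g : (Level K j → K j) ≃ₗ[K j] (Level K j → K j))
    (hg : ∀ w ∈ residue j H hH.2.2.1, g w ∈ residue j H' hH'.2.2.1) {v : Fin n → F} (hv : v ∈ H) :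
    levelEquiv j g v ∈ H' := by
  have hvu := hH.2.1 hv
  have hvK : ∀ i, v i ∈ K i := fun i => (mem_box.1 hvu i).1
  have h1 : ∀ b : Level K j, levelEquiv j g v b.1 = g (restrict j v hvK) b :=
    levelEquiv_level j g fun _ => rfl
  rw [mem_iff_mem_residue hH' ((map_mem_box_upper (levelEquiv_mem_box g) j v).2 hvu) h1]
  exact hg _ ((mem_iff_mem_residue hH hvu fun _ => rfl).1 hv)

theorem map_eq_of_forall_mem {j : Fin n} {H H' : AddSubgroup (Fin n → F)}
    (hH : H ∈ tailGroups K j) (hH' : H' ∈ tailGroups K j) {M : (Fin n → F) ≃ₗ[F] (Fin n → F)}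
    (h : ∀ v ∈ H, M v ∈ H') : H.map (M : (Fin n → F) →+ (Fin n → F)) = H' := by
  refine AddSubgroup.eq_of_le_of_card_ge ?_ ?_
  · rintro _ ⟨v, hv, rfl⟩
    exact h v hv
  · rw [hH'.2.2.2, ← hH.2.2.2]
    exact (Nat.card_congr (H.equivMapOfInjective _ M.injective).toEquiv).le

/-- A vector outside a subspace together with a basis of it is independent, so both configurations
are matched by extending to bases. -/
theorem exists_equiv_submodule {L V : Type*} [Field L] [AddCommGroup V] [Module L V]
    [FiniteDimensional L V] {W W' : Submodule L V} (h : finrank L W = finrank L W') {δ δ' : V}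
    (hδ : δ ∉ W) (hδ' : δ' ∉ W') : ∃ g : V ≃ₗ[L] V, (∀ w ∈ W, g w ∈ W') ∧ g δ = δ' := by
  let b := finBasis L W
  let b' : Basis (Fin (finrank L W)) L W' := (finBasis L W').reindex (finCongr h.symm)
  have hspan : ∀ {U : Submodule L V} (c : Basis (Fin (finrank L W)) L U),
      Submodule.span L (Set.range fun i => (c i : V)) = U := by
    intro U c
    have h1 : (Set.range fun i => (c i : V)) = U.subtype '' Set.range c := by
      rw [← Set.range_comp]
      rfl
    rw [h1, ← Submodule.map_span, c.span_eq, Submodule.map_top, Submodule.range_subtype]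
  have hli : ∀ {U : Submodule L V} (c : Basis (Fin (finrank L W)) L U) {ε : V}, ε ∉ U →
      LinearIndependent L (Fin.cons ε fun i => (c i : V) : Fin (finrank L W + 1) → V) := by
    intro U c ε hε
    refine LinearIndependent.finCons (c.linearIndependent.map' U.subtype U.ker_subtype) ?_
    change ε ∉ Submodule.span L (Set.range fun i => (c i : V))
    rwa [hspan c]
  obtain ⟨g, hg⟩ := exists_linearEquiv_apply_eq (hli b hδ) (hli b' hδ')
  refine ⟨g, fun w hw => ?_, by simpa using hg 0⟩
  rw [← hspan b] at hw
  have h1 : W.map g.toLinearMap ≤ W' := by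
    rw [← hspan b, Submodule.map_span, Submodule.span_le]
    rintro _ ⟨_, ⟨i, rfl⟩, rfl⟩
    have := hg i.succ
    simp only [Fin.cons_succ] at this
    rw [LinearEquiv.coe_coe, this]
    exact (b' i).2
  rw [hspan b] at hw
  exact h1 ⟨w, hw, rfl⟩

/-- Everything happens on the residues of level j. The discrepancy in strictly higher levels lies in
H', which is why M δ is only matched modulo H'. -/
theorem exists_map_tailGroup_of_eq (hK : Monotone K) {j k : Fin n} (hkj : K k = K j)
    {H H' : AddSubgroup (Fin n → F)} (hH : H ∈ tailGroups K j) (hH' : H' ∈ tailGroups K j)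
    {δ δ' : Fin n → F} (hδ : δ ∈ directions K k H) (hδ' : δ' ∈ directions K k H') :
    ∃ M : (Fin n → F) ≃ₗ[F] (Fin n → F),
      (∀ v, M v ∈ box K Finset.univ ↔ v ∈ box K Finset.univ) ∧
      H.map (M : (Fin n → F) →+ (Fin n → F)) = H' ∧ M δ - δ' ∈ H' := by
  classical
  have hup : upper K k = upper K j := by ext i; rw [mem_upper, mem_upper, hkj]
  rw [mem_directions, hup] at hδ hδ'
  have hdK : ∀ i, δ i ∈ K i := fun i => (mem_box.1 hδ.1 i).1
  have hdK' : ∀ i, δ' i ∈ K i := fun i => (mem_box.1 hδ'.1 i).1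
  have h1 : restrict j δ hdK ∉ residue j H hH.2.2.1 := by
    rw [← mem_iff_mem_residue hH hδ.1 fun _ => rfl]
    exact hδ.2.2
  have h1' : restrict j δ' hdK' ∉ residue j H' hH'.2.2.1 := by
    rw [← mem_iff_mem_residue hH' hδ'.1 fun _ => rfl]
    exact hδ'.2.2
  obtain ⟨g, hg, hgδ⟩ := exists_equiv_submodule
    ((finrank_residue hK hH).trans (finrank_residue hK hH').symm) h1 h1'
  refine ⟨levelEquiv j g, levelEquiv_mem_box g, map_eq_of_forall_mem hH hH' fun v hv =>
    map_eq_of_residue hH hH' g hg hv, hH'.1 ?_⟩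
  refine sub_mem_strictUpper ((map_mem_box_upper (levelEquiv_mem_box g) j δ).2 hδ.1) hδ'.1
    fun b => ?_
  rw [levelEquiv_level j g (w := restrict j δ hdK) (fun _ => rfl), hgδ]
  rfl

theorem exists_ne_zero_of_notMem_strictUpper {k : Fin n} {δ : Fin n → F}
    (hδ : δ ∈ box K (upper K k)) (hδ' : δ ∉ box K (strictUpper K k)) :
    ∃ b : Level K k, δ b.1 ≠ 0 := by
  by_contra h
  push Not at h
  refine hδ' ?_
  have := sub_mem_strictUpper hδ (zero_mem_box (K := K)) fun b => h b
  rwa [sub_zero] at this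

/-- An automorphism moving one direction of level `k` to another which acts trivially on the
vectors of higher level. -/
theorem exists_map_direction {k : Fin n} {δ δ' : Fin n → F}
    (hδ : δ ∈ box K (upper K k)) (hδs : δ ∉ box K (strictUpper K k))
    (hδ' : δ' ∈ box K (upper K k)) (hδs' : δ' ∉ box K (strictUpper K k)) :
    ∃ M : (Fin n → F) ≃ₗ[F] (Fin n → F),
      (∀ v, M v ∈ box K Finset.univ ↔ v ∈ box K Finset.univ) ∧
      (∀ v ∈ box K (strictUpper K k), M v = v) ∧ M δ = δ' := by
  have hdK : ∀ i, δ i ∈ K i := fun i => (mem_box.1 hδ i).1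
  have hdK' : ∀ i, δ' i ∈ K i := fun i => (mem_box.1 hδ' i).1
  obtain ⟨b₀, hb₀⟩ := exists_ne_zero_of_notMem_strictUpper hδ hδs
  obtain ⟨b₁, hb₁⟩ := exists_ne_zero_of_notMem_strictUpper hδ' hδs'
  have hr : restrict k δ hdK ∉ (⊥ : Submodule (K k) (Level K k → K k)) := fun h =>
    hb₀ (congrArg Subtype.val (congrFun ((Submodule.mem_bot _).1 h) b₀))
  have hr' : restrict k δ' hdK' ∉ (⊥ : Submodule (K k) (Level K k → K k)) := fun h =>
    hb₁ (congrArg Subtype.val (congrFun ((Submodule.mem_bot _).1 h) b₁))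
  obtain ⟨g, -, hg⟩ := exists_equiv_submodule rfl hr hr'
  set ε := levelEquiv k g δ with hε
  have hεb : ∀ b : Level K k, ε b.1 = δ' b.1 := fun b => by
    rw [hε, levelEquiv_level k g (w := restrict k δ hdK) (fun _ => rfl), hg]
    rfl
  have hεu : ε ∈ box K (upper K k) := (map_mem_box_upper (levelEquiv_mem_box g) k δ).2 hδ
  set z := δ' - ε with hz
  have hzs : z ∈ box K (strictUpper K k) := sub_mem_strictUpper hδ' hεu fun b => (hεb b).symm
  have hlev : ∀ v ∈ box K (strictUpper K k), ∀ b : Level K k, v b.1 = 0 := fun v hv b =>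
    (mem_box.1 hv b.1).2 (by simp [b.2])
  let φ : Dual F (Fin n → F) := (δ' b₁.1)⁻¹ • LinearMap.proj b₁.1
  have hφ : ∀ v, φ v = (δ' b₁.1)⁻¹ * v b₁.1 := fun v => rfl
  have hφz : φ z = 0 := by rw [hφ, hlev z hzs, mul_zero]
  -- After `levelEquiv` only a vector z of higher level is missing. The functional φ reads off a
  -- coordinate of level k that is nonzero on δ' and vanishes on z, normalised so that z is added
  -- exactly once.
  let M₂ := LinearEquiv.transvection hφz
  have hM₂ : ∀ v, M₂ v = v + φ v • z := fun v => LinearEquiv.transvection.apply hφz v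
  have hφK : ∀ v : Fin n → F, v b₁.1 ∈ K b₁.1 → φ v • z ∈ box K Finset.univ := by
    intro v hv
    refine box_mono (Finset.subset_univ _) (smul_mem_box (a := k)
      (fun i hi => (mem_strictUpper.1 hi).le) ?_ hzs)
    rw [hφ]
    exact (K k).mul_mem ((K k).inv_mem (b₁.2.le (hdK' b₁.1))) (b₁.2.le hv)
  have hM₂b : ∀ v, M₂ v b₁.1 = v b₁.1 := fun v => by
    rw [hM₂, Pi.add_apply, Pi.smul_apply, hlev z hzs, smul_zero, add_zero]
  have hM₂box : ∀ v, M₂ v ∈ box K Finset.univ ↔ v ∈ box K Finset.univ := by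
    intro v
    constructor
    · intro h
      have h1 : v b₁.1 ∈ K b₁.1 := by
        rw [← hM₂b v]
        exact (mem_box.1 h _).1
      have := (boxGroup K Finset.univ).sub_mem h (hφK v h1)
      rwa [hM₂, add_sub_cancel_right] at this
    · intro h
      rw [hM₂]
      exact (boxGroup K Finset.univ).add_mem h (hφK v (mem_box.1 h _).1)
  refine ⟨(levelEquiv k g).trans M₂, fun v => ?_, fun v hv => ?_, ?_⟩
  · rw [LinearEquiv.trans_apply, hM₂box, levelEquiv_mem_box]
  · rw [LinearEquiv.trans_apply, levelEquiv_eq_self g (hlev v hv), hM₂, hφ, hlev v hv, mul_zero,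
      zero_smul, add_zero]
  · rw [LinearEquiv.trans_apply, ← hε, hM₂, hφ, hεb, inv_mul_cancel₀ hb₁, one_smul, hz]
    abel

/-- If K k < K j, the groups are matched first. The direction is then corrected by an automorphism
fixing all vectors of level above k, and H' consists of such vectors. The nonemptiness assumptions
supply auxiliary directions for the first step. -/
theorem exists_map_tailGroup (hK : Monotone K) {j k : Fin n} (hkj : k ≤ j)
    {H H' : AddSubgroup (Fin n → F)} (hH : H ∈ tailGroups K j) (hH' : H' ∈ tailGroups K j)
    {δ δ' : Fin n → F} (hδ : δ ∈ directions K k H) (hδ' : δ' ∈ directions K k H')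
    (hne : (directions K j H).Nonempty) (hne' : (directions K j H').Nonempty) :
    ∃ M : (Fin n → F) ≃ₗ[F] (Fin n → F),
      (∀ v, M v ∈ box K Finset.univ ↔ v ∈ box K Finset.univ) ∧
      H.map (M : (Fin n → F) →+ (Fin n → F)) = H' ∧ M δ - δ' ∈ H' := by
  rcases (hK hkj).eq_or_lt with heq | hlt
  · exact exists_map_tailGroup_of_eq hK heq hH hH' hδ hδ'
  · obtain ⟨ε, hε⟩ := hne
    obtain ⟨ε', hε'⟩ := hne'
    obtain ⟨M₁, hM₁, hHM, -⟩ := exists_map_tailGroup_of_eq hK rfl hH hH' hε hε'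
    rw [mem_directions] at hδ hδ'
    obtain ⟨M₂, hM₂, hfix, hM₂δ⟩ := exists_map_direction
      ((map_mem_box_upper hM₁ k δ).2 hδ.1)
      (fun h => hδ.2.1 ((map_mem_box_strictUpper hK hM₁ k δ).1 h)) hδ'.1 hδ'.2.1
    have hle : H' ≤ boxGroup K (strictUpper K k) := hH'.2.1.trans
      (box_mono fun i hi => mem_strictUpper.2 (hlt.trans_le (mem_upper.1 hi)))
    refine ⟨M₁.trans M₂, fun v => ?_, map_eq_of_forall_mem hH hH' fun v hv => ?_, ?_⟩
    · rw [LinearEquiv.trans_apply, hM₂, hM₁]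
    · have h1 : M₁ v ∈ H' := by
        rw [← hHM]
        exact ⟨v, hv, rfl⟩
      rw [LinearEquiv.trans_apply, hfix _ (hle h1)]
      exact h1
    · rw [LinearEquiv.trans_apply, hM₂δ, sub_self]
      exact H'.zero_mem

end Orbits

end AffineCartesian

namespace AffineCartesian

/-! ### Orbits of standard supports as unions of cosets, and their number. -/

section Supports

open Module

variable {F : Type*} [Field F] [Fintype F] {n : ℕ} {K : Fin n → Subfield F}

/-- One of the two groups that a direction must avoid contains the other, so in each case only one
condition is effective. -/
theorem directions_union {j k : Fin n} (hkj : K k ≤ K j) {H : AddSubgroup (Fin n → F)}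
    (hH : H ∈ tailGroups K j) :
    (K k = K j ∧ boxGroup K (strictUpper K k) ≤ H) ∨
      (K k < K j ∧ H ≤ boxGroup K (strictUpper K k)) := by
  rcases hkj.eq_or_lt with h | h
  · refine Or.inl ⟨h, ?_⟩
    have : strictUpper K k = strictUpper K j := by ext i; rw [mem_strictUpper, mem_strictUpper, h]
    rw [this]
    exact hH.1
  · exact Or.inr ⟨h, hH.2.1.trans
      (box_mono fun i hi => mem_strictUpper.2 (h.trans_le (mem_upper.1 hi)))⟩

theorem smul_mem_strictUpper_iff {k : Fin n} {c : F} (hc : c ∈ K k) (hc0 : c ≠ 0)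
    {δ : Fin n → F} : c • δ ∈ box K (strictUpper K k) ↔ δ ∈ box K (strictUpper K k) := by
  have h : ∀ i ∈ strictUpper K k, K k ≤ K i := fun i hi => (mem_strictUpper.1 hi).le
  refine ⟨fun h' => ?_, smul_mem_box h hc⟩
  have := smul_mem_box h ((K k).inv_mem hc) h'
  rwa [smul_smul, inv_mul_cancel₀ hc0, one_smul] at this

theorem smul_add_mem_directions {j k : Fin n} (hkj : K k ≤ K j) {H : AddSubgroup (Fin n → F)}
    (hH : H ∈ tailGroups K j) {δ : Fin n → F} (hδ : δ ∈ directions K k H) {c : F} (hc : c ∈ K k)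
    (hc0 : c ≠ 0) {h : Fin n → F} (hh : h ∈ H) : c • δ + h ∈ directions K k H := by
  rw [mem_directions] at *
  have hup : h ∈ box K (upper K k) :=
    box_mono (fun i hi => mem_upper.2 (hkj.trans (mem_upper.1 hi))) (hH.2.1 hh)
  have hcH : c • δ ∉ H := fun h' => hδ.2.2 (by
    have := hH.2.2.1 c⁻¹ (hkj ((K k).inv_mem hc)) _ h'
    rwa [smul_smul, inv_mul_cancel₀ hc0, one_smul] at this)
  refine ⟨(boxGroup K (upper K k)).add_mem
    (smul_mem_box (fun i hi => mem_upper.1 hi) hc hδ.1) hup, fun h' => ?_, fun h' => ?_⟩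
  · rcases directions_union hkj hH with ⟨-, hle⟩ | ⟨-, hle⟩
    · exact hcH (by simpa using H.sub_mem (hle h') hh)
    · have := (boxGroup K (strictUpper K k)).sub_mem h' (hle hh)
      rw [add_sub_cancel_right] at this
      exact hδ.2.1 ((smul_mem_strictUpper_iff hc hc0).1 this)
  · exact hcH (by simpa using H.sub_mem h' hh)

theorem card_directions_add_of_eq {j k : Fin n} (hkj : K k = K j) {H : AddSubgroup (Fin n → F)}
    (hH : H ∈ tailGroups K j) :
    (directions K k H).card + ∏ i ∈ Finset.Ioi j, (elems (K i)).card =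
      ∏ i ∈ upper K j, (elems (K i)).card := by
  classical
  have hup : upper K k = upper K j := by ext i; rw [mem_upper, mem_upper, hkj]
  rw [← card_box_eq_prod (I := upper K j), ← hH.2.2.2]
  have h1 : directions K k H = (box K (upper K j)).filter fun v => v ∉ H := by
    ext δ
    rw [mem_directions, Finset.mem_filter, hup]
    refine and_congr_right fun _ => and_iff_right_of_imp fun h h' => h ?_
    rcases directions_union hkj.le hH with ⟨-, hle⟩ | ⟨hlt, -⟩
    · exact hle h'
    · exact absurd hkj hlt.ne
  have h2 : Nat.card H = ((box K (upper K j)).filter fun v => v ∈ H).card := by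
    rw [Nat.card_eq_fintype_card]
    refine Fintype.card_of_subtype _ fun v => ?_
    rw [Finset.mem_filter]
    exact and_iff_right_of_imp fun h => hH.2.1 h
  rw [h1, h2, add_comm]
  exact Finset.card_filter_add_card_filter_not _

theorem card_directions_add_of_lt {j k : Fin n} (hkj : K k < K j) {H : AddSubgroup (Fin n → F)}
    (hH : H ∈ tailGroups K j) :
    (directions K k H).card + ∏ i ∈ strictUpper K k, (elems (K i)).card =
      ∏ i ∈ upper K k, (elems (K i)).card := by
  classical
  rw [← card_box_eq_prod, ← card_box_eq_prod]
  have h1 : directions K k H =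
      (box K (upper K k)).filter fun v => v ∉ box K (strictUpper K k) := by
    ext δ
    rw [mem_directions, Finset.mem_filter]
    refine and_congr_right fun _ => and_iff_left_of_imp fun h h' => h ?_
    rcases directions_union hkj.le hH with ⟨heq, -⟩ | ⟨-, hle⟩
    · exact absurd heq hkj.ne
    · exact hle h'
  have h2 : box K (strictUpper K k) =
      (box K (upper K k)).filter fun v => v ∈ box K (strictUpper K k) := by
    ext v
    rw [Finset.mem_filter]
    exact (and_iff_right_of_imp fun h =>
      box_mono (fun i hi => mem_upper.2 (mem_strictUpper.1 hi).le) h).symm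
  have h3 := Finset.card_filter_add_card_filter_not (s := box K (upper K k))
    (fun v => v ∈ box K (strictUpper K k))
  rw [← h2] at h3
  rw [h1]
  omega

/-- The box over `upper K j` has the coordinate j itself in addition to those beyond j, so it is
larger than H by a factor of at least |K j|. -/
theorem directions_nonempty (hK : Monotone K) {j : Fin n} {H : AddSubgroup (Fin n → F)}
    (hH : H ∈ tailGroups K j) : (directions K j H).Nonempty := by
  have h1 := card_directions_add_of_eq rfl hH
  have hsub : insert j (Finset.Ioi j) ⊆ upper K j := by
    intro i hi
    rw [Finset.mem_insert, Finset.mem_Ioi] at hi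
    exact mem_upper.2 (hK (hi.elim (fun h => h.ge) le_of_lt))
  have h2 : ∏ i ∈ insert j (Finset.Ioi j), (elems (K i)).card ≤
      ∏ i ∈ upper K j, (elems (K i)).card :=
    Finset.prod_le_prod_of_subset_of_one_le' hsub fun i _ _ => (one_lt_card_elems _).le
  rw [Finset.prod_insert (by simp)] at h2
  have h3 : 0 < ∏ i ∈ Finset.Ioi j, (elems (K i)).card :=
    Finset.prod_pos fun i _ => (one_lt_card_elems _).le
  have h4 := one_lt_card_elems (K j)
  rw [← Finset.card_pos]
  nlinarith

open scoped Classical in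
/-- The points of the product of the `K i` whose coordinates up to `j` vanish, except that the
coordinate `k` lies in `T`. -/
noncomputable def stdSupp (K : Fin n → Subfield F) (j k : Fin n) (T : Finset F) :
    Finset (Fin n → F) :=
  (box K Finset.univ).filter fun x => (∀ i ≤ j, i ≠ k → x i = 0) ∧ x k ∈ T

open scoped Classical in
/-- The images of the sets `stdSupp K j k T`, where `T` has `w` elements, under automorphisms. -/
def orbitSupports (K : Fin n → Subfield F) (j k : Fin n) (w : ℕ) : Set (Finset (Fin n → F)) :=
  {S | ∃ σ ∈ boxAut K Finset.univ, ∃ T ⊆ elems (K k), T.card = w ∧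
    S = (stdSupp K j k T).image σ}

/-- The unions of `w` cosets of some `H` along a line over `K k`. -/
def cosetSupports (K : Fin n → Subfield F) (j k : Fin n) (w : ℕ) : Set (Finset (Fin n → F)) :=
  {S | ∃ H ∈ tailGroups K j, ∃ x ∈ box K Finset.univ, ∃ δ ∈ directions K k H,
    ∃ T ⊆ elems (K k), T.card = w ∧ S = cosets H x δ T}

theorem stdSupp_eq_cosets {j k : Fin n} (hkj : k ≤ j) {T : Finset F} (hT : T ⊆ elems (K k)) :
    stdSupp K j k T = cosets (boxGroup K (Finset.Ioi j)) 0 (Pi.single k 1) T := by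
  ext x
  simp only [stdSupp, Finset.mem_filter, mem_cosets, mem_boxGroup, mem_box,
    Finset.mem_Ioi, not_lt, sub_zero]
  constructor
  · rintro ⟨hx, h0, hk⟩
    refine ⟨x k, hk, fun i => ?_⟩
    by_cases hi : i = k
    · subst hi
      simp [(K i).zero_mem]
    · simpa [hi, hx i] using fun h => h0 i h hi
  · rintro ⟨τ, hτ, h⟩
    have hxk : x k = τ := by
      have := (h k).2 hkj
      simpa [sub_eq_zero] using this
    refine ⟨fun i => ?_, fun i hi hik => ?_, hxk ▸ hτ⟩
    · by_cases hi : i = k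
      · subst hi
        rw [hxk]
        simpa using hT hτ
      · simpa [hi] using (h i).1
    · simpa [hik] using (h i).2 hi

open scoped Classical in
theorem image_cosets (σ : (Fin n → F) ≃ᵃ[F] (Fin n → F)) (H : AddSubgroup (Fin n → F))
    (x δ : Fin n → F) (T : Finset F) : (cosets H x δ T).image σ =
      cosets (H.map (σ.linear : (Fin n → F) →+ (Fin n → F))) (σ x) (σ.linear δ) T := by
  have key : ∀ (y : Fin n → F) (τ : F), σ y - σ x - τ • σ.linear δ = σ.linear (y - x - τ • δ) := by
    intro y τ
    have := σ.toAffineMap.linearMap_vsub y x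
    simp only [vsub_eq_sub] at this
    rw [map_sub, map_smul]
    congr 1
    exact this.symm
  ext y
  rw [Finset.mem_image, mem_cosets]
  constructor
  · rintro ⟨y, hy, rfl⟩
    obtain ⟨τ, hτ, h⟩ := mem_cosets.1 hy
    exact ⟨τ, hτ, _, h, (key y τ).symm⟩
  · rintro ⟨τ, hτ, v, hv, h⟩
    refine ⟨σ.symm y, mem_cosets.2 ⟨τ, hτ, ?_⟩, σ.apply_symm_apply y⟩
    have h1 := key (σ.symm y) τ
    rw [σ.apply_symm_apply] at h1
    have h2 : σ.linear v = σ.linear (σ.symm y - x - τ • δ) := by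
      rw [← h1]
      exact h
    rwa [← σ.linear.injective h2]

theorem linear_mem_box {σ : (Fin n → F) ≃ᵃ[F] (Fin n → F)} (hσ : σ ∈ boxAut K Finset.univ)
    (v : Fin n → F) : σ.linear v ∈ box K Finset.univ ↔ v ∈ box K Finset.univ := by
  have h : σ v = σ.linear v + σ 0 := by
    have := σ.map_vadd 0 v
    simpa using this
  have h0 : σ 0 ∈ boxGroup K Finset.univ := (hσ.1 0).2 zero_mem_box
  rw [← hσ.1 v, h]
  exact ((boxGroup K Finset.univ).add_mem_cancel_right h0).symm

/-- The standard support is built from the box beyond j and the k-th unit vector. By transitivity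
this pair can be moved to any (H, δ) up to an error in H, which does not affect the cosets. -/
theorem orbitSupports_eq_cosetSupports (hK : Monotone K) {j k : Fin n} (hkj : k ≤ j) (w : ℕ) :
    orbitSupports K j k w = cosetSupports K j k w := by
  classical
  ext S
  constructor
  · rintro ⟨σ, hσ, T, hT, hTw, rfl⟩
    have hM := linear_mem_box hσ
    refine ⟨_, map_mem_tailGroups hK hM (boxGroup_Ioi_mem hK j), σ 0, (hσ.1 0).2 zero_mem_box,
      _, map_mem_directions hK hM (single_mem_directions hkj), T, hT, hTw, ?_⟩
    rw [stdSupp_eq_cosets hkj hT, ← image_cosets]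
  · rintro ⟨H, hH, x, hx, δ, hδ, T, hT, hTw, rfl⟩
    have hH₀ := boxGroup_Ioi_mem hK j
    obtain ⟨M, hM, hMH, hMδ⟩ := exists_map_tailGroup hK hkj hH₀ hH (single_mem_directions hkj) hδ
      (directions_nonempty hK hH₀) (directions_nonempty hK hH)
    let σ : (Fin n → F) ≃ᵃ[F] (Fin n → F) :=
      M.toAffineEquiv.trans (AffineEquiv.constVAdd F (Fin n → F) x)
    have hσx : ∀ v, σ v = x + M v := fun v => rfl
    have hσ : σ ∈ boxAut K Finset.univ := by
      refine ⟨fun v => ?_, fun v i hi => absurd (Finset.mem_univ i) hi⟩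
      rw [hσx, ← hM v]
      exact (boxGroup K Finset.univ).add_mem_cancel_left hx
    have hσl : σ.linear = M := LinearEquiv.ext fun v => by
      have h := σ.map_vadd 0 v
      rw [vadd_eq_add, add_zero, hσx, hσx, map_zero, add_zero, vadd_eq_add, add_comm] at h
      exact (add_right_cancel h).symm
    refine ⟨σ, hσ, T, hT, hTw, ?_⟩
    have himg := image_cosets σ (boxGroup K (Finset.Ioi j)) 0 (Pi.single k 1) T
    rw [hσl, hMH, hσx, map_zero, add_zero] at himg
    rw [stdSupp_eq_cosets hkj hT]
    trans cosets H x (M (Pi.single k 1)) T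
    · ext y
      rw [mem_cosets, mem_cosets]
      refine exists_congr fun τ => and_congr_right fun hτ => ?_
      have hτK : τ ∈ K j := hK hkj (by simpa using hT hτ)
      have h1 : y - x - τ • M (Pi.single k 1) =
          (y - x - τ • δ) + -(τ • (M (Pi.single k 1) - δ)) := by
        rw [smul_sub]
        abel
      rw [h1]
      exact (H.add_mem_cancel_right (H.neg_mem (hH.2.2.1 τ hτK _ hMδ))).symm
    · rw [← himg]

/-- H is recovered from the set as the vectors all of whose K j-multiples are periods. A further
such v would be a nonzero multiple of δ modulo H. If K k = K j, its multiples sweep the whole line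
and force T = K k. If K k < K j, then v and H have level above k, whereas δ does not. -/
theorem mem_iff_forall_add_mem_cosets {j k : Fin n} (hkj : K k ≤ K j)
    {H : AddSubgroup (Fin n → F)} (hH : H ∈ tailGroups K j) {x δ : Fin n → F}
    (hδ : δ ∈ directions K k H) {T : Finset F} (hT : T ⊆ elems (K k)) (hT0 : T.Nonempty)
    (hT1 : K k = K j → T ≠ elems (K k)) {v : Fin n → F} :
    v ∈ H ↔ v ∈ box K (upper K j) ∧
      ∀ c ∈ K j, ∀ s ∈ cosets H x δ T, s + c • v ∈ cosets H x δ T := by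
  constructor
  · intro hv
    refine ⟨hH.2.1 hv, fun c hc s hs => ?_⟩
    obtain ⟨τ, hτ, h⟩ := mem_cosets.1 hs
    refine mem_cosets.2 ⟨τ, hτ, ?_⟩
    have : s + c • v - x - τ • δ = (s - x - τ • δ) + c • v := by abel
    rw [this]
    exact H.add_mem h (hH.2.2.1 c hc v hv)
  · rintro ⟨hv, h⟩
    have hHk : ∀ c ∈ K k, ∀ v ∈ H, c • v ∈ H := fun c hc => hH.2.2.1 c (hkj hc)
    have hδ' := mem_directions.1 hδ
    obtain ⟨τ₀, hτ₀⟩ := hT0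
    have hk₀ : τ₀ ∈ K k := by simpa using hT hτ₀
    have hs₀ : x + τ₀ • δ ∈ cosets H x δ T :=
      (add_smul_mem_cosets hHk hδ'.2.2 hT hk₀).2 hτ₀
    have h1 := h 1 (K j).one_mem _ hs₀
    rw [one_smul] at h1
    obtain ⟨τ₁, hτ₁, h1⟩ := mem_cosets.1 h1
    have hk₁ : τ₁ ∈ K k := by simpa using hT hτ₁
    set h₁ := x + τ₀ • δ + v - x - τ₁ • δ with hh₁
    have hvδ : v = (τ₁ - τ₀) • δ + h₁ := by
      rw [hh₁, sub_smul]
      abel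
    by_cases hne : τ₁ = τ₀
    · rw [hvδ, hne, sub_self, zero_smul, zero_add]
      exact h1
    · have h0 : τ₁ - τ₀ ≠ 0 := sub_ne_zero.2 hne
      have hk : τ₁ - τ₀ ∈ K k := (K k).sub_mem hk₁ hk₀
      exfalso
      rcases directions_union hkj hH with ⟨heq, -⟩ | ⟨hlt, hle⟩
      · refine hT1 heq (Finset.Subset.antisymm hT fun τ hτ => ?_)
        have hτk : τ ∈ K k := by simpa using hτ
        have hck : (τ - τ₀) / (τ₁ - τ₀) ∈ K k := (K k).div_mem ((K k).sub_mem hτk hk₀) hk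
        have h2 := h _ (hkj hck) _ hs₀
        obtain ⟨τ', hτ', h2⟩ := mem_cosets.1 h2
        have h3 : x + τ₀ • δ + ((τ - τ₀) / (τ₁ - τ₀)) • v - x - τ' • δ =
            (τ - τ') • δ + ((τ - τ₀) / (τ₁ - τ₀)) • h₁ := by
          rw [hvδ, smul_add, smul_smul, div_mul_cancel₀ _ h0, sub_smul, sub_smul]
          abel
        rw [h3] at h2
        have h4 := (H.add_mem_cancel_right (hHk _ hck _ h1)).1 h2
        rwa [eq_of_sub_smul_mem hHk hδ'.2.2 hτk (by simpa using hT hτ') h4]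
      · have hvs : v ∈ boxGroup K (strictUpper K k) :=
          box_mono (fun i hi => mem_strictUpper.2 (hlt.trans_le (mem_upper.1 hi))) hv
        have h2 := (boxGroup K (strictUpper K k)).sub_mem hvs (hle h1)
        rw [hvδ, add_sub_cancel_right] at h2
        exact hδ'.2.1 ((smul_mem_strictUpper_iff hk h0).1 h2)

open scoped Classical in
theorem card_image_cosets_of_mem {j k : Fin n} (hkj : K k ≤ K j) {H : AddSubgroup (Fin n → F)}
    (hH : H ∈ tailGroups K j) {w : ℕ} (hw : 2 ≤ w) :
    (((box K Finset.univ) ×ˢ (directions K k H) ×ˢ (elems (K k)).powersetCard w).image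
      fun p => cosets H p.1 p.2.1 p.2.2).card *
      (((elems (K k)).card * ∏ i ∈ Finset.Ioi j, (elems (K i)).card) *
          (((elems (K k)).card - 1) * ∏ i ∈ Finset.Ioi j, (elems (K i)).card)) =
      (box K Finset.univ).card * ((directions K k H).card * (elems (K k)).card.choose w) := by
  have hA : ∀ x ∈ box K Finset.univ, ∀ δ ∈ directions K k H, ∀ c ∈ K k, ∀ h ∈ H,
      x + c • δ + h ∈ box K Finset.univ := by
    intro x hx δ hδ c hc h hh
    have h1 : c • δ ∈ boxGroup K Finset.univ := box_mono (Finset.subset_univ _)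
      (smul_mem_box (fun i hi => mem_upper.1 hi) hc (mem_directions.1 hδ).1)
    have h2 : h ∈ boxGroup K Finset.univ := box_mono (Finset.subset_univ _) (hH.2.1 hh)
    have h3 : x ∈ boxGroup K Finset.univ := hx
    exact AddSubgroup.add_mem _ (AddSubgroup.add_mem _ h3 h1) h2
  have hN : Nat.card H = ∏ i ∈ Finset.Ioi j, (elems (K i)).card := hH.2.2.2
  rw [← hN]
  have key := card_image_cosets (fun c hc => hH.2.2.1 c (hkj hc)) hA
    (fun δ hδ => (mem_directions.1 hδ).2.2)
    (fun δ hδ c hc hc0 h hh => smul_add_mem_directions hkj hH hδ hc hc0 hh) hw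
  rw [← key]
  congr!

/-- The number of supports, in terms of the numbers of groups and directions. -/
theorem ncard_cosetSupports {j k : Fin n} (hkj : K k ≤ K j) {w D : ℕ} (hw : 2 ≤ w)
    (hw' : K k = K j → w < (elems (K k)).card)
    (hD : ∀ H ∈ tailGroups K j, (directions K k H).card = D) :
    (cosetSupports K j k w).ncard *
        (((elems (K k)).card * ∏ i ∈ Finset.Ioi j, (elems (K i)).card) *
          (((elems (K k)).card - 1) * ∏ i ∈ Finset.Ioi j, (elems (K i)).card)) =
      Nat.card (tailGroups K j) *
        ((box K Finset.univ).card * (D * (elems (K k)).card.choose w)) := by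
  classical
  let 𝓗 : Finset (AddSubgroup (Fin n → F)) := (Set.toFinite (tailGroups K j)).toFinset
  have h𝓗 : ∀ H, H ∈ 𝓗 ↔ H ∈ tailGroups K j := fun H => Set.Finite.mem_toFinset _
  let im : AddSubgroup (Fin n → F) → Finset (Finset (Fin n → F)) := fun H =>
    ((box K Finset.univ) ×ˢ (directions K k H) ×ˢ (elems (K k)).powersetCard w).image
      fun p => cosets H p.1 p.2.1 p.2.2
  have him : ∀ H S, S ∈ im H ↔ ∃ x ∈ box K Finset.univ, ∃ δ ∈ directions K k H,
      ∃ T ⊆ elems (K k), T.card = w ∧ S = cosets H x δ T := by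
    intro H S
    simp only [im, Finset.mem_image, Finset.mem_product, Finset.mem_powersetCard, Prod.exists]
    constructor
    · rintro ⟨x, δ, T, ⟨hx, hδ, hT, hTw⟩, rfl⟩
      exact ⟨x, hx, δ, hδ, T, hT, hTw, rfl⟩
    · rintro ⟨x, hx, δ, hδ, T, hT, hTw, rfl⟩
      exact ⟨x, δ, T, ⟨hx, hδ, hT, hTw⟩, rfl⟩
  have hunion : cosetSupports K j k w = ((𝓗.biUnion im : Finset _) : Set _) := by
    ext S
    simp only [cosetSupports, Set.mem_ofPred_eq, Finset.coe_biUnion, Set.mem_iUnion,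
      Finset.mem_coe, h𝓗, him, exists_prop]
  -- The right-hand side does not mention H, so different groups yield disjoint families of
  -- supports.
  have hrec : ∀ H ∈ tailGroups K j, ∀ S ∈ im H, ∀ v, v ∈ H ↔ v ∈ box K (upper K j) ∧
      ∀ c ∈ K j, ∀ s ∈ S, s + c • v ∈ S := by
    intro H hH S hS v
    obtain ⟨x, hx, δ, hδ, T, hT, hTw, rfl⟩ := (him H S).1 hS
    refine mem_iff_forall_add_mem_cosets hkj hH hδ hT (Finset.card_pos.1 (by omega)) fun h h' => ?_
    have := hw' h
    rw [h'] at hTw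
    omega
  have hdisj : ∀ H ∈ 𝓗, ∀ H' ∈ 𝓗, H ≠ H' → Disjoint (im H) (im H') := by
    intro H hH H' hH' hne
    rw [Finset.disjoint_left]
    intro S hS hS'
    refine hne (AddSubgroup.ext fun v => ?_)
    rw [hrec H ((h𝓗 H).1 hH) S hS, hrec H' ((h𝓗 H').1 hH') S hS']
  have hcard : ∀ H ∈ 𝓗, (im H).card *
      (((elems (K k)).card * ∏ i ∈ Finset.Ioi j, (elems (K i)).card) *
          (((elems (K k)).card - 1) * ∏ i ∈ Finset.Ioi j, (elems (K i)).card)) =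
      (box K Finset.univ).card * (D * (elems (K k)).card.choose w) := by
    intro H hH
    have hH := (h𝓗 H).1 hH
    exact hD H hH ▸ card_image_cosets_of_mem hkj hH hw
  rw [hunion, Set.ncard_coe_finset, Finset.card_biUnion hdisj, Finset.sum_mul,
    Finset.sum_congr rfl hcard, Finset.sum_const, smul_eq_mul, Nat.card_coe_set_eq,
    Set.ncard_eq_toFinset_card (tailGroups K j)]

/-- For a single coset the multiple of the direction is absorbed into the base point. -/
theorem mem_cosetSupports_singleton (hK : Monotone K) {j : Fin n} {S : Finset (Fin n → F)} :
    S ∈ cosetSupports K j j 1 ↔ ∃ H ∈ tailGroups K j, ∃ x ∈ box K Finset.univ,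
      S = cosets H x 0 ({0} : Finset F) := by
  constructor
  · rintro ⟨H, hH, x, hx, δ, hδ, T, hT, hTw, rfl⟩
    obtain ⟨τ, rfl⟩ := Finset.card_eq_one.1 hTw
    have hτ : τ ∈ K j := by simpa using hT (Finset.mem_singleton_self τ)
    refine ⟨H, hH, x + τ • δ, (boxGroup K Finset.univ).add_mem hx
      (box_mono (Finset.subset_univ _) (smul_mem_box (fun i hi => mem_upper.1 hi) hτ
        (mem_directions.1 hδ).1)), ?_⟩
    ext y
    simp [mem_cosets, sub_sub]
  · rintro ⟨H, hH, x, hx, rfl⟩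
    obtain ⟨δ, hδ⟩ := directions_nonempty hK hH
    refine ⟨H, hH, x, hx, δ, hδ, {0}, by simp [(K j).zero_mem], by simp, ?_⟩
    ext y
    simp [mem_cosets]

/-- One coset does not determine a direction, so this case is counted by Lagrange: each H has as
many cosets in the box as its index there. -/
theorem ncard_cosetSupports_singleton (hK : Monotone K) (j : Fin n) :
    (cosetSupports K j j 1).ncard * ∏ i ∈ Finset.Ioi j, (elems (K i)).card =
      Nat.card (tailGroups K j) * (box K Finset.univ).card := by
  classical
  let 𝓗 : Finset (AddSubgroup (Fin n → F)) := (Set.toFinite (tailGroups K j)).toFinset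
  have h𝓗 : ∀ H, H ∈ 𝓗 ↔ H ∈ tailGroups K j := fun H => Set.Finite.mem_toFinset _
  let co : AddSubgroup (Fin n → F) → (Fin n → F) → Finset (Fin n → F) := fun H x =>
    cosets H x 0 ({0} : Finset F)
  have hco : ∀ H x y, y ∈ co H x ↔ y - x ∈ H := fun H x y => by simp [co, mem_cosets]
  let im : AddSubgroup (Fin n → F) → Finset (Finset (Fin n → F)) := fun H =>
    (box K Finset.univ).image (co H)
  have hunion : cosetSupports K j j 1 = ((𝓗.biUnion im : Finset _) : Set _) := by
    ext S
    rw [mem_cosetSupports_singleton hK]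
    simp only [Finset.coe_biUnion, Set.mem_iUnion, Finset.mem_coe, h𝓗, im, Finset.mem_image,
      exists_prop, co, eq_comm]
  have hdisj : ∀ H ∈ 𝓗, ∀ H' ∈ 𝓗, H ≠ H' → Disjoint (im H) (im H') := by
    intro H _ H' _ hne
    rw [Finset.disjoint_left]
    intro S hS hS'
    obtain ⟨x, -, rfl⟩ := Finset.mem_image.1 hS
    obtain ⟨x', -, heq⟩ := Finset.mem_image.1 hS'
    have hx : x - x' ∈ H' := by
      rw [← hco, heq, hco, sub_self]
      exact H.zero_mem
    refine hne (AddSubgroup.ext fun v => ?_)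
    have h1 : x + v ∈ co H x ↔ v ∈ H := by rw [hco, add_sub_cancel_left]
    have h2 : x + v ∈ co H' x' ↔ v ∈ H' := by
      rw [hco, show x + v - x' = (x - x') + v by abel]
      exact H'.add_mem_cancel_left hx
    rw [← h1, ← h2, heq]
  have hcard : ∀ H ∈ 𝓗, (im H).card * ∏ i ∈ Finset.Ioi j, (elems (K i)).card =
      (box K Finset.univ).card := by
    intro H hH
    have hH := (h𝓗 H).1 hH
    rw [← hH.2.2.2, Finset.card_eq_sum_card_image (co H) (box K Finset.univ)]
    rw [Finset.sum_const_nat]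
    intro S hS
    obtain ⟨x, hx, rfl⟩ := Finset.mem_image.1 hS
    have : Nat.card H = (Finset.univ.filter (· ∈ H)).card := by
      rw [Nat.card_eq_fintype_card, Fintype.card_subtype]
    rw [this]
    symm
    refine Finset.card_bij (fun h _ => x + h) ?_ (fun _ _ _ _ h => add_left_cancel h) ?_
    · intro h hh
      have hh : h ∈ H := by simpa using hh
      refine Finset.mem_filter.2 ⟨(boxGroup K Finset.univ).add_mem hx
        (box_mono (Finset.subset_univ _) (hH.2.1 hh)), ?_⟩
      ext y
      rw [hco, hco, show y - x = (y - (x + h)) + h by abel]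
      exact (H.add_mem_cancel_right hh).symm
    · intro y hy
      refine ⟨y - x, ?_, by abel⟩
      have := (Finset.mem_filter.1 hy).2
      simp only [Finset.mem_filter, Finset.mem_univ, true_and]
      rw [← hco, ← this, hco, sub_self]
      exact H.zero_mem
  rw [hunion, Set.ncard_coe_finset, Finset.card_biUnion hdisj, Finset.sum_mul,
    Finset.sum_congr rfl hcard, Finset.sum_const, smul_eq_mul, Nat.card_coe_set_eq,
    Set.ncard_eq_toFinset_card (tailGroups K j)]

/-- With two cosets, the first description yields two points differing by a nonzero K k-multiple of
δ. In the second description all differences have level above k. -/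
theorem disjoint_cosetSupports {j k k' : Fin n} (hkk : K k < K k') (hkj : K k' ≤ K j) {w : ℕ}
    (hw : 2 ≤ w) : Disjoint (cosetSupports K j k w) (cosetSupports K j k' w) := by
  rw [Set.disjoint_left]
  rintro S ⟨H, hH, x, hx, δ, hδ, T, hT, hTw, rfl⟩ ⟨H', hH', x', hx', δ', hδ', T', hT', hTw', heq⟩
  obtain ⟨t₁, ht₁, t₂, ht₂, hne⟩ := Finset.one_lt_card.1 (by omega : 1 < T.card)
  have hk₁ : t₁ ∈ K k := by simpa using hT ht₁
  have hk₂ : t₂ ∈ K k := by simpa using hT ht₂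
  have hHk : ∀ c ∈ K k, ∀ v ∈ H, c • v ∈ H := fun c hc => hH.2.2.1 c (hkj (hkk.le hc))
  have hδd := mem_directions.1 hδ
  have m₁ := (add_smul_mem_cosets (x := x) hHk hδd.2.2 hT hk₁).2 ht₁
  have m₂ := (add_smul_mem_cosets (x := x) hHk hδd.2.2 hT hk₂).2 ht₂
  rw [heq, mem_cosets] at m₁ m₂
  obtain ⟨a₁, ha₁, m₁⟩ := m₁
  obtain ⟨a₂, ha₂, m₂⟩ := m₂
  have ha₁' : a₁ ∈ K k' := by simpa using hT' ha₁
  have ha₂' : a₂ ∈ K k' := by simpa using hT' ha₂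
  have hle : ∀ i ∈ upper K k', i ∈ strictUpper K k := fun i hi =>
    mem_strictUpper.2 (hkk.trans_le (mem_upper.1 hi))
  have h1 : (a₁ - a₂) • δ' ∈ boxGroup K (strictUpper K k) :=
    box_mono hle (smul_mem_box (fun i hi => mem_upper.1 hi) ((K k').sub_mem ha₁' ha₂')
      (mem_directions.1 hδ').1)
  have h2 : H' ≤ boxGroup K (strictUpper K k) := fun v hv =>
    box_mono (fun i hi => hle i (mem_upper.2 (hkj.trans (mem_upper.1 hi)))) (hH'.2.1 hv)
  have h3 : (t₁ - t₂) • δ = (a₁ - a₂) • δ' +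
      ((x + t₁ • δ - x' - a₁ • δ') - (x + t₂ • δ - x' - a₂ • δ')) := by
    rw [sub_smul, sub_smul]
    abel
  have h4 : (t₁ - t₂) • δ ∈ boxGroup K (strictUpper K k) := by
    rw [h3]
    exact AddSubgroup.add_mem _ h1 (h2 (H'.sub_mem m₁ m₂))
  exact hδd.2.1 ((smul_mem_strictUpper_iff ((K k).sub_mem hk₁ hk₂) (sub_ne_zero.2 hne)).1 h4)

end Supports

end AffineCartesian

namespace AffineCartesian

/-! ### Minimum weight words and their supports. -/

section Words

variable {F : Type*} [Field F] {n : ℕ}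

/-- The factors of the product of the subfields `K i`. -/
abbrev cart (K : Fin n → Subfield F) : Fin n → Set F := fun i => (K i : Set F)

theorem smul_mem_minWeightWords {ι : Type*} {C : Submodule F (ι → F)} {c : ι → F} {γ : F}
    (hγ : γ ≠ 0) (hc : c ∈ minWeightWords C) : γ • c ∈ minWeightWords C := by
  have hs : Function.support (γ • c) = Function.support c :=
    Function.support_const_smul_of_ne_zero γ c hγ
  refine ⟨C.smul_mem γ hc.1, smul_ne_zero hγ hc.2.1, ?_⟩
  unfold weight
  rw [hs]
  exact hc.2.2

/-- Codewords of minimum weight with the same support are proportional. -/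
theorem exists_eq_smul_of_support_eq {ι : Type*} [Finite ι] {C : Submodule F (ι → F)}
    {c c' : ι → F} (hc : c ∈ minWeightWords C) (hc' : c' ∈ minWeightWords C)
    (h : Function.support c = Function.support c') : ∃ γ : F, γ ≠ 0 ∧ c' = γ • c := by
  obtain ⟨i, hi⟩ := Function.support_nonempty_iff.2 hc.2.1
  have hi' : i ∈ Function.support c' := h ▸ hi
  rw [Function.mem_support] at hi hi'
  refine ⟨c' i / c i, div_ne_zero hi' hi, ?_⟩
  by_contra hne
  -- This codeword is supported inside the support of c and vanishes at i, so it is too short to be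
  -- nonzero.
  have hmem : c' - (c' i / c i) • c ∈ C := C.sub_mem hc'.1 (C.smul_mem _ hc.1)
  refine absurd (hc.2.2 _ hmem (sub_ne_zero.2 hne)) (not_le.2 ?_)
  refine Set.ncard_lt_ncard (Set.ssubset_iff_of_subset ?_ |>.2 ⟨i, hi, ?_⟩) (Set.toFinite _)
  · intro x hx
    by_contra hx0
    have hx0' : x ∉ Function.support c' := h ▸ hx0
    rw [Function.notMem_support] at hx0 hx0'
    simp [hx0, hx0'] at hx
  · simp [div_mul_cancel₀ _ hi]

/-- A set of minimum weight words closed under nonzero scalars is counted by its supports. -/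
theorem ncard_eq_mul_ncard_supports [Finite F] {ι κ : Type*} [Finite ι] {C : Submodule F (ι → F)}
    {X : Set (ι → F)} (hX : X ⊆ minWeightWords C)
    (hsmul : ∀ γ : F, γ ≠ 0 → ∀ c ∈ X, γ • c ∈ X) (S : (ι → F) → κ)
    (hS : ∀ c c', S c = S c' ↔ Function.support c = Function.support c') :
    X.ncard = (Nat.card F - 1) * (S '' X).ncard := by
  classical
  have := Fintype.ofFinite F
  have hfin : X.Finite := Set.toFinite X
  lift X to Finset (ι → F) using hfin
  rw [← Finset.coe_image, Set.ncard_coe_finset, Set.ncard_coe_finset,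
    Finset.card_eq_sum_card_image S X, mul_comm, Finset.sum_const_nat]
  intro s hs
  obtain ⟨c, hc, rfl⟩ := Finset.mem_image.1 hs
  have h1 : (X.filter fun c' => S c' = S c) =
      (Finset.univ.erase (0 : F)).image fun γ => γ • c := by
    ext c'
    simp only [Finset.mem_filter, Finset.mem_image, Finset.mem_erase, Finset.mem_univ, and_true]
    constructor
    · rintro ⟨hc', h⟩
      obtain ⟨γ, hγ, rfl⟩ := exists_eq_smul_of_support_eq (hX hc) (hX hc') ((hS _ _).1 h.symm)
      exact ⟨γ, hγ, rfl⟩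
    · rintro ⟨γ, hγ, rfl⟩
      exact ⟨hsmul γ hγ c hc, (hS _ _).2 (Function.support_const_smul_of_ne_zero γ c hγ)⟩
  rw [h1, Finset.card_image_of_injective _ (smul_left_injective F (hX hc).2.1),
    Finset.card_erase_of_mem (Finset.mem_univ _), Finset.card_univ, Nat.card_eq_fintype_card]

end Words

/-! ### Codewords as polynomial functions, and the minimum distance. -/

section Code

variable {F : Type*} [Field F] [Fintype F] {n : ℕ} {K : Fin n → Subfield F} {u : ℕ}

theorem size_cart (i : Fin n) : size (cart K) i = (elems (K i)).card := by
  rw [size, ← Set.ncard_coe_finset]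
  congr 1
  ext x
  simp

theorem mem_points_cart {x : Fin n → F} : x ∈ points (cart K) ↔ x ∈ box K Finset.univ := by
  rw [mem_box_univ]
  simp [points]

theorem pow_card_elems_sub_one {k : Subfield F} {x : F} (hx : x ∈ k) (h0 : x ≠ 0) :
    x ^ ((elems k).card - 1) = 1 := by
  classical
  have := FiniteField.pow_card_sub_one_eq_one (⟨x, hx⟩ : k) (by simpa [Subtype.ext_iff] using h0)
  rw [← Nat.card_eq_fintype_card, natCard_eq_card_elems] at this
  simpa using congrArg Subtype.val this

/-- On a subfield with `d` elements every power agrees with one of exponent less than `d`. -/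
theorem exists_pow_eq (k : Subfield F) (e : ℕ) :
    ∃ r ≤ e, r < (elems k).card ∧ ∀ x ∈ k, x ^ r = x ^ e := by
  have h1 := one_lt_card_elems k
  rcases Nat.eq_zero_or_pos e with rfl | he
  · exact ⟨0, le_rfl, by omega, fun _ _ => rfl⟩
  -- Positive exponents are reduced to the range from 1 to d - 1, not from 0, so that the power
  -- still vanishes at 0.
  refine ⟨(e - 1) % ((elems k).card - 1) + 1, ?_, ?_, fun x hx => ?_⟩
  · have := Nat.mod_le (e - 1) ((elems k).card - 1)
    omega
  · have := Nat.mod_lt (e - 1) (by omega : (elems k).card - 1 > 0)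
    omega
  · by_cases h0 : x = 0
    · rw [h0, zero_pow (by omega), zero_pow (by omega)]
    · have hdm := Nat.mod_add_div (e - 1) ((elems k).card - 1)
      have : e = (e - 1) % ((elems k).card - 1) + 1 +
          ((elems k).card - 1) * ((e - 1) / ((elems k).card - 1)) := by omega
      conv_rhs => rw [this, pow_add, pow_mul, pow_card_elems_sub_one hx h0, one_pow, mul_one]

/-- The codewords are the values of the polynomial functions of degree at most `u`. -/
theorem mem_code_iff {c : points (cart K) → F} : c ∈ code (cart K) u ↔
    ∃ φ : (Fin n → F) → F, PolyFun u φ ∧ ∀ P, c P = φ P := by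
  constructor
  · rintro ⟨f, hf, rfl⟩
    have := (mem_reducedPoly _ (fun i => by
      rw [size_cart]
      exact (one_lt_card_elems _).le) u f).1 hf
    exact ⟨fun x => MvPolynomial.eval x f, ⟨f, this.1, fun _ => rfl⟩, evalMap_apply _ f⟩
  · rintro ⟨φ, hφ, hc⟩
    obtain ⟨p, hp, h⟩ := hφ.eq_sum
    choose r hr hrd hrp using fun i e => exists_pow_eq (K i) e
    let red : (Fin n →₀ ℕ) → (Fin n →₀ ℕ) := fun s => Finsupp.equivFunOnFinite.symm fun i => r i (s i)
    have hred : ∀ s i, red s i = r i (s i) := fun s i => rfl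
    refine ⟨∑ s ∈ p.support, MvPolynomial.monomial (red s) (p.coeff s), ?_, ?_⟩
    · refine Submodule.sum_mem _ fun s hs => Submodule.mem_inf.2 ⟨?_, ?_⟩
      · rw [MvPolynomial.mem_restrictTotalDegree]
        refine (MvPolynomial.totalDegree_monomial_le _ _).trans ?_
        rw [Finsupp.sum_fintype _ _ fun _ => rfl]
        exact (Finset.sum_le_sum fun i _ => hr i (s i)).trans (hp s hs)
      · rw [MvPolynomial.mem_restrictSupport_iff]
        intro t ht
        have : t = red s := by
          simpa using MvPolynomial.support_monomial_subset ht
        subst this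
        intro i
        rw [size_cart]
        exact hrd i (s i)
    · ext P
      have hP := mem_box_univ.1 (mem_points_cart.1 P.2)
      rw [hc, h, evalMap_apply, map_sum]
      refine Finset.sum_congr rfl fun s _ => ?_
      rw [MvPolynomial.eval_monomial, Finsupp.prod_fintype _ _ fun _ => pow_zero _]
      congr 1
      exact Finset.prod_congr rfl fun i _ => hrp i (s i) _ (hP i)

/-- The support of a word, as a set of points of the affine space. -/
noncomputable def wordSupp (c : points (cart K) → F) : Finset (Fin n → F) :=
  (Set.toFinite (Subtype.val '' Function.support c)).toFinset

theorem mem_wordSupp {c : points (cart K) → F} {x : Fin n → F} :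
    x ∈ wordSupp c ↔ ∃ h : x ∈ points (cart K), c ⟨x, h⟩ ≠ 0 := by
  simp [wordSupp]

theorem wordSupp_eq_iff {c c' : points (cart K) → F} :
    wordSupp c = wordSupp c' ↔ Function.support c = Function.support c' := by
  rw [wordSupp, wordSupp, Set.Finite.toFinset_inj]
  exact Set.image_eq_image Subtype.val_injective

theorem card_wordSupp (c : points (cart K) → F) : (wordSupp c).card = weight c := by
  rw [weight, wordSupp, ← Set.ncard_eq_toFinset_card,
    Set.ncard_image_of_injective _ Subtype.val_injective]

theorem wordSupp_eq_supp {c : points (cart K) → F} {φ : (Fin n → F) → F}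
    (h : ∀ P : points (cart K), c P = φ P) : wordSupp c = supp K Finset.univ φ := by
  ext x
  rw [mem_wordSupp, mem_supp, ← mem_points_cart]
  exact ⟨fun ⟨hx, h'⟩ => ⟨hx, h ⟨x, hx⟩ ▸ h'⟩, fun ⟨hx, h'⟩ => ⟨hx, (h ⟨x, hx⟩).symm ▸ h'⟩⟩

theorem minProd_le_weight {c : points (cart K) → F} (hc : c ∈ code (cart K) u) (h0 : c ≠ 0) :
    minProd (dims K Finset.univ) u ≤ weight c := by
  obtain ⟨φ, hφ, h⟩ := mem_code_iff.1 hc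
  rw [← card_wordSupp, wordSupp_eq_supp h]
  refine hφ.minProd_le_card ?_
  obtain ⟨P, hP⟩ := Function.support_nonempty_iff.2 h0
  exact ⟨P, mem_supp.2 ⟨mem_points_cart.1 P.2, h P ▸ hP⟩⟩

/-- The minimum distance is attained by products of linear forms in single variables. -/
theorem exists_weight_eq_minProd (K : Fin n → Subfield F) (u : ℕ) :
    ∃ c ∈ code (cart K) u, weight c = minProd (dims K Finset.univ) u := by
  classical
  obtain ⟨P, hP⟩ := exists_optimal (d := dims K Finset.univ) one_le_dims u
  have hle : ∀ i, P i ≤ (elems (K i)).card := fun i =>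
    (hP.1.1 i).2.trans (dims_of_mem (Finset.mem_univ i)).le
  choose T hT hTc using fun i => Finset.exists_subset_card_eq (hle i)
  let φ : (Fin n → F) → F := fun x => ∏ i, ∏ ω ∈ elems (K i) \ T i, (x i - ω)
  have hφ : PolyFun u φ := by
    refine (PolyFun.prod Finset.univ (fun i x => ∏ ω ∈ elems (K i) \ T i, (x i - ω))
      (fun i => ∑ ω ∈ elems (K i) \ T i, 1) fun i _ => PolyFun.prod _ _ _ fun ω _ =>
        (PolyFun.coord i).sub (PolyFun.const ω)).mono ?_
    have h1 : ∀ i, (∑ ω ∈ elems (K i) \ T i, 1) + P i = dims K Finset.univ i := by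
      intro i
      rw [← Finset.card_eq_sum_ones, Finset.card_sdiff_of_subset (hT i), hTc i,
        dims_of_mem (Finset.mem_univ i)]
      have := hle i
      omega
    have h2 := hP.1.2
    rw [← Finset.sum_congr rfl fun i _ => h1 i, Finset.sum_add_distrib] at h2
    omega
  refine ⟨fun Q => φ Q, mem_code_iff.2 ⟨φ, hφ, fun _ => rfl⟩, ?_⟩
  rw [← card_wordSupp, wordSupp_eq_supp (φ := φ) fun _ => rfl, ← hP.2]
  have h3 : supp K Finset.univ φ = Fintype.piFinset T := by
    ext x
    rw [mem_supp, mem_box_univ, Fintype.mem_piFinset]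
    simp only [φ, Finset.prod_ne_zero_iff, Finset.mem_univ, true_imp_iff, Finset.mem_sdiff,
      mem_elems, sub_ne_zero, ← forall_and]
    refine forall_congr' fun i => ⟨fun ⟨h1, h2⟩ => ?_, fun h => ⟨by simpa using hT i h, ?_⟩⟩
    · by_contra h3
      exact h2 _ ⟨h1, h3⟩ rfl
    · rintro ω hω rfl
      exact hω.2 h
  rw [h3, Fintype.card_piFinset]
  exact Finset.prod_congr rfl fun i _ => hTc i

theorem minProd_dims_pos (K : Fin n → Subfield F) (u : ℕ) : 0 < minProd (dims K Finset.univ) u := by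
  obtain ⟨P, hP⟩ := exists_optimal (d := dims K Finset.univ) one_le_dims u
  exact hP.minProd_pos

theorem mem_minWeightWords_iff {c : points (cart K) → F} : c ∈ minWeightWords (code (cart K) u) ↔
    c ∈ code (cart K) u ∧ weight c = minProd (dims K Finset.univ) u := by
  have hne : ∀ c : points (cart K) → F, weight c = minProd (dims K Finset.univ) u → c ≠ 0 := by
    rintro c hc rfl
    have := minProd_dims_pos K u
    simp [weight] at hc
    omega
  constructor
  · rintro ⟨hc, h0, hmin⟩
    obtain ⟨c', hc', hw⟩ := exists_weight_eq_minProd K u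
    exact ⟨hc, ((hmin c' hc' (hne c' hw)).trans hw.le).antisymm (minProd_le_weight hc h0)⟩
  · rintro ⟨hc, hw⟩
    exact ⟨hc, hne c hw, fun c' hc' h0 => hw.le.trans (minProd_le_weight hc' h0)⟩

/-- In degree 0 all words are constant, so the only support is the whole box. -/
theorem ncard_minWeightWords_zero (K : Fin n → Subfield F) :
    (minWeightWords (code (cart K) 0)).ncard = Nat.card F - 1 := by
  have h1 := ncard_eq_mul_ncard_supports (X := minWeightWords (code (cart K) 0)) le_rfl
    (fun γ hγ c hc => smul_mem_minWeightWords hγ hc) wordSupp fun c c' => wordSupp_eq_iff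
  have h2 : wordSupp '' minWeightWords (code (cart K) 0) = {box K Finset.univ} := by
    refine Set.eq_singleton_iff_nonempty_unique_mem.2 ⟨?_, ?_⟩
    · obtain ⟨c, hc, hw⟩ := exists_weight_eq_minProd K 0
      exact ⟨_, c, mem_minWeightWords_iff.2 ⟨hc, hw⟩, rfl⟩
    · rintro _ ⟨c, hc, rfl⟩
      obtain ⟨φ, hφ, h⟩ := mem_code_iff.1 hc.1
      rw [wordSupp_eq_supp h]
      obtain ⟨P, hP⟩ := Function.support_nonempty_iff.2 hc.2.1
      ext x
      rw [mem_supp, hφ.eq_const x P, ← h]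
      exact and_iff_left hP
  rw [h1, h2, Set.ncard_singleton, mul_one]

end Code

end AffineCartesian

namespace AffineCartesian

section Coordinates

variable {F : Type*} [Field F] {n : ℕ}

theorem smul_mem_orbitWords {A : Fin n → Set F} {j k : Fin n} {ℓ : ℕ} {γ : F} (hγ : γ ≠ 0)
    {c : points A → F} (hc : c ∈ orbitWords A j ℓ k) : γ • c ∈ orbitWords A j ℓ k := by
  simp only [orbitWords, orbitWordsOf, Set.mem_iUnion] at *
  obtain ⟨Ω, hΩ, γ', hγ', σ, hσ, rfl⟩ := hc
  exact ⟨Ω, hΩ, γ * γ', mul_ne_zero hγ hγ', σ, hσ, smul_smul _ _ _⟩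

/-- A permutation of the coordinates, as an affine map. -/
def permAffine (F : Type*) [Field F] (π : Equiv.Perm (Fin n)) : (Fin n → F) ≃ᵃ[F] (Fin n → F) :=
  (LinearEquiv.funCongrLeft F F π).toAffineEquiv

theorem permAffine_apply (π : Equiv.Perm (Fin n)) (x : Fin n → F) (i : Fin n) :
    permAffine F π x i = x (π i) := rfl

end Coordinates

/-! ### Supports of the words γ • (h ∘ σ) and of all minimum weight words. -/

section Orbits

variable {F : Type*} [Field F] [Fintype F] {n : ℕ} {K : Fin n → Subfield F} {u : ℕ}

theorem exists_affineGroup {σ : (Fin n → F) ≃ᵃ[F] (Fin n → F)} (hσ : σ ∈ boxAut K Finset.univ) :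
    ∃ φ ∈ affineGroup (cart K), ∀ P : points (cart K), (φ P : Fin n → F) = σ P := by
  have hmem : ∀ x, σ x ∈ points (cart K) ↔ x ∈ points (cart K) := fun x => by
    rw [mem_points_cart, mem_points_cart, hσ.1]
  refine ⟨fun P => ⟨σ P, (hmem _).2 P.2⟩, ⟨⟨⟨LinearMap.toMatrix' σ.linear.toLinearMap,
    LinearMap.toMatrix' σ.linear.symm.toLinearMap, ?_, ?_⟩, σ 0, fun P => ?_⟩, fun P => ?_⟩,
    fun P => rfl⟩
  · rw [← LinearMap.toMatrix'_comp]
    simp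
  · rw [← LinearMap.toMatrix'_comp]
    simp
  · have := σ.map_vadd 0 (P : Fin n → F)
    rw [vadd_eq_add, vadd_eq_add, add_zero] at this
    rw [← Matrix.toLin'_apply, Matrix.toLin'_toMatrix']
    exact this
  · refine ⟨⟨σ⁻¹ P, (hmem _).1 ?_⟩, Subtype.ext (apply_inv_self σ P)⟩
    rw [apply_inv_self]
    exact P.2

/-- Surjectivity of φ is what shows that σ x in the box forces x into the box: σ x is also the image
of a point of the box, and σ is injective. -/
theorem exists_boxAut {φ : points (cart K) → points (cart K)} (hφ : φ ∈ affineGroup (cart K)) :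
    ∃ σ ∈ boxAut K Finset.univ, ∀ P : points (cart K), (φ P : Fin n → F) = σ P := by
  obtain ⟨⟨M, b, h⟩, hsurj⟩ := hφ
  let e : (Fin n → F) ≃ₗ[F] (Fin n → F) := LinearEquiv.ofLinearMap
    (Matrix.toLin' (M : Matrix (Fin n) (Fin n) F))
    (Matrix.toLin' ((M⁻¹ : GL (Fin n) F) : Matrix (Fin n) (Fin n) F))
    (by rw [← Matrix.toLin'_mul, ← Units.val_mul]; simp)
    (by rw [← Matrix.toLin'_mul, ← Units.val_mul]; simp)
  let σ : (Fin n → F) ≃ᵃ[F] (Fin n → F) :=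
    e.toAffineEquiv.trans (AffineEquiv.constVAdd F (Fin n → F) b)
  have hσ : ∀ P : points (cart K), (φ P : Fin n → F) = σ P := by
    intro P
    rw [h P, add_comm]
    rfl
  refine ⟨σ, ⟨fun x => ?_, fun x i hi => absurd (Finset.mem_univ i) hi⟩, hσ⟩
  rw [← mem_points_cart, ← mem_points_cart]
  constructor
  · intro hx
    obtain ⟨P, hP⟩ := hsurj ⟨σ x, hx⟩
    have h1 : σ P = σ x := by rw [← hσ, hP]
    rw [← σ.injective h1]
    exact P.2
  · intro hx
    rw [← hσ ⟨x, hx⟩]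
    exact (φ _).2

theorem polyFun_hPoly (K : Fin n → Subfield F) (j k : Fin n) (Ω : Finset F) :
    PolyFun (∑ i ∈ (Finset.Iic j).erase k, ((elems (K i)).card - 1) + Ω.card)
      fun x => MvPolynomial.eval x (hPoly (cart K) j k Ω) := by
  have h1 : ∀ x, MvPolynomial.eval x (hPoly (cart K) j k Ω) =
      (∏ i ∈ (Finset.Iic j).erase k, (1 - x i ^ ((elems (K i)).card - 1))) *
        ∏ ω ∈ Ω, (x k - ω) := by
    intro x
    simp [hPoly, size_cart]
  simp only [h1]
  refine (PolyFun.prod _ _ _ fun i _ => ?_).mul ?_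
  · refine (PolyFun.const 1).sub ?_
    simpa using (PolyFun.coord i).pow ((elems (K i)).card - 1)
  · rw [Finset.card_eq_sum_ones]
    exact PolyFun.prod _ _ _ fun ω _ => (PolyFun.coord k).sub (PolyFun.const ω)

open scoped Classical in
-- On K i the factor 1 - x ^ (d i - 1) is the indicator function of 0.
theorem supp_hPoly (j k : Fin n) (Ω : Finset F) :
    supp K Finset.univ (fun x => MvPolynomial.eval x (hPoly (cart K) j k Ω)) =
      stdSupp K j k (elems (K k) \ Ω) := by
  ext x
  rw [mem_supp, stdSupp, Finset.mem_filter]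
  refine and_congr_right fun hx => ?_
  rw [mem_box_univ] at hx
  simp only [hPoly, size_cart, map_mul, MvPolynomial.eval_prod, map_sub, map_one, map_pow,
    MvPolynomial.eval_X, MvPolynomial.eval_C, mul_ne_zero_iff, Finset.prod_ne_zero_iff,
    Finset.mem_erase, Finset.mem_Iic, Finset.mem_sdiff, mem_elems, hx k, true_and]
  refine and_congr ⟨fun h i hi hik => ?_, fun h i hi => ?_⟩ ⟨fun h hk => ?_, fun h ω hω => ?_⟩
  · by_contra h0
    exact h i ⟨hik, hi⟩ (by rw [pow_card_elems_sub_one (hx i) h0, sub_self])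
  · have := one_lt_card_elems (K i)
    rw [h i hi.2 hi.1, zero_pow (by omega), sub_zero]
    exact one_ne_zero
  · exact h _ hk (sub_self _)
  · rw [sub_ne_zero]
    rintro rfl
    exact h hω

open scoped Classical in
/-- The supports of the words `γ • (h ∘ σ)`. -/
theorem wordSupp_smul_comp {j k : Fin n} {Ω : Finset F} {γ : F} (hγ : γ ≠ 0)
    {φ : points (cart K) → points (cart K)} {σ : (Fin n → F) ≃ᵃ[F] (Fin n → F)}
    (hσ : σ ∈ boxAut K Finset.univ) (h : ∀ P : points (cart K), (φ P : Fin n → F) = σ P) :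
    wordSupp (γ • (evalMap (cart K) (hPoly (cart K) j k Ω) ∘ φ)) =
      (stdSupp K j k (elems (K k) \ Ω)).image (σ⁻¹ : (Fin n → F) ≃ᵃ[F] (Fin n → F)) := by
  rw [wordSupp_eq_supp (φ := fun x => γ * MvPolynomial.eval (σ x) (hPoly (cart K) j k Ω))]
  · ext x
    rw [mem_supp, Finset.mem_image, mul_ne_zero_iff, ← hσ.1 x, ← supp_hPoly]
    constructor
    · rintro ⟨hx, -, h⟩
      exact ⟨σ x, mem_supp.2 ⟨hx, h⟩, inv_apply_self σ x⟩
    · rintro ⟨y, hy, rfl⟩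
      rw [apply_inv_self]
      exact ⟨(mem_supp.1 hy).1, hγ, (mem_supp.1 hy).2⟩
  · intro P
    rw [Pi.smul_apply, Function.comp_apply, evalMap_apply, h, smul_eq_mul]

/-- Composing with σ moves the support by the inverse of σ, and Ω is replaced by its complement in K
k. -/
theorem image_wordSupp_orbitWords {j k : Fin n} {ℓ : ℕ}
    (hk : (elems (K j)).card - ℓ ≤ (elems (K k)).card) :
    wordSupp '' orbitWords (cart K) j ℓ k = orbitSupports K j k ((elems (K j)).card - ℓ) := by
  classical
  ext S
  simp only [orbitWords, orbitWordsOf, Set.mem_image, Set.mem_iUnion, Set.mem_ofPred_eq, exists_prop,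
    size_cart, orbitSupports]
  constructor
  · rintro ⟨c, ⟨Ω, ⟨hΩ, hc⟩, γ, hγ, φ, hφ, rfl⟩, rfl⟩
    obtain ⟨σ, hσ, h⟩ := exists_boxAut hφ
    refine ⟨σ⁻¹, inv_mem hσ, elems (K k) \ Ω, Finset.sdiff_subset, ?_, ?_⟩
    · have hsub : Ω ⊆ elems (K k) := fun x hx => mem_elems.2 (hΩ hx)
      rw [Finset.card_sdiff_of_subset hsub, hc]
      omega
    · rw [wordSupp_smul_comp hγ hσ h]
  · rintro ⟨σ, hσ, T, hT, hTw, rfl⟩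
    obtain ⟨φ, hφ, h⟩ := exists_affineGroup (inv_mem hσ)
    refine ⟨_, ⟨elems (K k) \ T, ⟨fun x hx => ?_, ?_⟩, 1, one_ne_zero, φ, hφ, rfl⟩, ?_⟩
    · exact mem_elems.1 (Finset.sdiff_subset hx)
    · rw [Finset.card_sdiff_of_subset hT, hTw]
    · rw [wordSupp_smul_comp one_ne_zero (inv_mem hσ) h, Finset.sdiff_sdiff_eq_self hT, inv_inv]

open scoped Classical in
theorem card_stdSupp {j k : Fin n} (hkj : k ≤ j) {T : Finset F} (hT : T ⊆ elems (K k)) :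
    (stdSupp K j k T).card = T.card * ∏ i ∈ Finset.Ioi j, (elems (K i)).card := by
  have h1 : stdSupp K j k T = Fintype.piFinset fun i =>
      if i ∈ Finset.Ioi j then elems (K i) else if i = k then T else {0} := by
    ext x
    rw [stdSupp, Finset.mem_filter, mem_box_univ, Fintype.mem_piFinset]
    constructor
    · rintro ⟨h1, h2, h3⟩ i
      split_ifs with h h'
      · exact mem_elems.2 (h1 i)
      · exact h' ▸ h3
      · rw [Finset.mem_Ioi, not_lt] at h
        exact Finset.mem_singleton.2 (h2 i h h')
    · intro h
      have hk := h k
      rw [if_neg (by simpa using hkj), if_pos rfl] at hk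
      have h0 : ∀ i ≤ j, i ≠ k → x i = 0 := by
        intro i hi hik
        have := h i
        rwa [if_neg (by simpa using hi), if_neg hik, Finset.mem_singleton] at this
      refine ⟨fun i => ?_, h0, hk⟩
      by_cases hi : i ≤ j
      · by_cases hik : i = k
        · exact hik ▸ mem_elems.1 (hT hk)
        · rw [h0 i hi hik]
          exact (K i).zero_mem
      · have := h i
        rw [if_pos (by simpa using hi)] at this
        exact mem_elems.1 this
  rw [h1, Fintype.card_piFinset]
  have h2 : ∀ i, (if i ∈ Finset.Ioi j then elems (K i) else if i = k then T else {0}).card =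
      (if i = k then T.card else 1) * if i ∈ Finset.Ioi j then (elems (K i)).card else 1 := by
    intro i
    split_ifs with h h' h'
    · subst h'
      exact absurd (Finset.mem_Ioi.1 h) hkj.not_gt
    all_goals simp
  rw [Finset.prod_congr rfl fun i _ => h2 i, Finset.prod_mul_distrib, Finset.prod_ite_eq',
    Finset.prod_ite_mem]
  simp

theorem dims_univ : dims K Finset.univ = fun i => (elems (K i)).card :=
  funext fun i => dims_of_mem (Finset.mem_univ i)

theorem monotone_card_elems (hK : Monotone K) : Monotone fun i => (elems (K i)).card :=
  fun _ _ h => Finset.card_le_card fun _ hx => mem_elems.2 (hK h (mem_elems.1 hx))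

theorem minProd_eq (hK : Monotone K) {j : Fin n} {ℓ : ℕ} (hℓ : ℓ < (elems (K j)).card)
    (hu : u = ∑ i ∈ Finset.Iio j, ((elems (K i)).card - 1) + ℓ) :
    minProd (dims K Finset.univ) u =
      ((elems (K j)).card - ℓ) * ∏ i ∈ Finset.Ioi j, (elems (K i)).card := by
  have h := optimal_thresholdTuple (monotone_card_elems hK) (fun i => (one_lt_card_elems _).le) j
    hℓ hu
  rw [dims_univ, ← h.2]
  have h2 : ∀ i, thresholdTuple (fun i => (elems (K i)).card) j ((elems (K j)).card - ℓ) i =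
      (if i = j then (elems (K j)).card - ℓ else 1) *
        if i ∈ Finset.Ioi j then (elems (K i)).card else 1 := by
    intro i
    rcases lt_trichotomy i j with h | h | h
    · simp [thresholdTuple, h, h.ne, h.not_gt]
    · simp [thresholdTuple, h]
    · simp [thresholdTuple, h, h.ne', h.not_gt]
  rw [Finset.prod_congr rfl fun i _ => h2 i, Finset.prod_mul_distrib, Finset.prod_ite_eq',
    Finset.prod_ite_mem]
  simp

/-- The degree bound of h is ∑ (d i - 1) over i ≤ j, i ≠ k, plus d k - (d j - ℓ), which equals u.
Its support has the least possible size (d j - ℓ) * ∏ d i, the product over i > j. -/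
theorem orbitWords_subset (hK : Monotone K) {j k : Fin n} (hkj : k ≤ j) {ℓ : ℕ}
    (hℓ : ℓ < (elems (K j)).card) (hk : (elems (K j)).card - ℓ ≤ (elems (K k)).card)
    (hu : u = ∑ i ∈ Finset.Iio j, ((elems (K i)).card - 1) + ℓ) :
    orbitWords (cart K) j ℓ k ⊆ minWeightWords (code (cart K) u) := by
  classical
  intro c hc
  have hS : wordSupp c ∈ orbitSupports K j k ((elems (K j)).card - ℓ) :=
    image_wordSupp_orbitWords hk ▸ Set.mem_image_of_mem _ hc
  refine mem_minWeightWords_iff.2 ⟨?_, ?_⟩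
  · simp only [orbitWords, orbitWordsOf, Set.mem_iUnion, Set.mem_ofPred_eq, size_cart] at hc
    obtain ⟨Ω, ⟨-, hΩ⟩, γ, -, φ, hφ, rfl⟩ := hc
    obtain ⟨σ, hσ, h⟩ := exists_boxAut hφ
    refine mem_code_iff.2 ⟨_, (((polyFun_hPoly K j k Ω).comp_affineEquiv σ).const_mul γ).mono ?_,
      fun P => ?_⟩
    · have h1 : ∑ i ∈ Finset.Iic j, ((elems (K i)).card - 1) =
          ∑ i ∈ Finset.Iio j, ((elems (K i)).card - 1) + ((elems (K j)).card - 1) := by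
        rw [← Finset.Iio_insert, Finset.sum_insert (by simp), add_comm]
      rw [← Finset.add_sum_erase _ _ (Finset.mem_Iic.2 hkj)] at h1
      have := one_lt_card_elems (K k)
      have := one_lt_card_elems (K j)
      omega
    · rw [Pi.smul_apply, Function.comp_apply, evalMap_apply, h, smul_eq_mul]
  · obtain ⟨σ, hσ, T, hT, hTw, h⟩ := hS
    rw [← card_wordSupp, h, Finset.card_image_of_injective _ σ.injective, card_stdSupp hkj hT, hTw,
      minProd_eq hK hℓ hu]

theorem ncard_orbitWords (hK : Monotone K) {j k : Fin n} (hkj : k ≤ j) {ℓ : ℕ}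
    (hℓ : ℓ < (elems (K j)).card) (hk : (elems (K j)).card - ℓ ≤ (elems (K k)).card) :
    (orbitWords (cart K) j ℓ k).ncard =
      (Nat.card F - 1) * (orbitSupports K j k ((elems (K j)).card - ℓ)).ncard := by
  rw [← image_wordSupp_orbitWords hk]
  exact ncard_eq_mul_ncard_supports (orbitWords_subset hK hkj hℓ hk rfl)
    (fun γ hγ c hc => smul_mem_orbitWords hγ hc) _ fun _ _ => wordSupp_eq_iff

theorem ncard_minWeightWords (K : Fin n → Subfield F) (u : ℕ) :
    (minWeightWords (code (cart K) u)).ncard =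
      (Nat.card F - 1) * (wordSupp '' minWeightWords (code (cart K) u)).ncard :=
  ncard_eq_mul_ncard_supports le_rfl (fun _ hγ _ hc => smul_mem_minWeightWords hγ hc) _
    fun _ _ => wordSupp_eq_iff

theorem permAffine_mem_boxAut {π : Equiv.Perm (Fin n)} (hπ : ∀ i, K (π i) = K i) :
    permAffine F π ∈ boxAut K Finset.univ := by
  refine ⟨fun x => ?_, fun x i hi => absurd (Finset.mem_univ i) hi⟩
  rw [mem_box_univ, mem_box_univ]
  refine ⟨fun h i => ?_, fun h i => ?_⟩
  · have := h (π.symm i)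
    rwa [permAffine_apply, π.apply_symm_apply, ← hπ, π.apply_symm_apply] at this
  · rw [permAffine_apply, ← hπ]
    exact h _

theorem constVAdd_mem_boxAut {t : Fin n → F} (ht : t ∈ box K Finset.univ) :
    AffineEquiv.constVAdd F (Fin n → F) t ∈ boxAut K Finset.univ :=
  ⟨fun _ => (boxGroup K Finset.univ).add_mem_cancel_left ht,
    fun _ i hi => absurd (Finset.mem_univ i) hi⟩

theorem eq_of_card_elems_eq (hK : Monotone K) {a b : Fin n}
    (h : (elems (K a)).card = (elems (K b)).card) : K a = K b := by
  wlog hab : a ≤ b generalizing a b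
  · exact (this h.symm (le_of_not_ge hab)).symm
  have hsub : elems (K a) ⊆ elems (K b) := fun x hx => mem_elems.2 (hK hab (mem_elems.1 hx))
  have := Finset.eq_of_subset_of_card_le hsub h.ge
  ext x
  rw [← mem_elems, this, mem_elems]

/-- Minimum weight words have the supports of the words `γ • (h ∘ σ)`. -/
theorem exists_wordSupp_mem_orbitSupports (hK : Monotone K) {j : Fin n} {ℓ : ℕ} (hℓ₀ : 0 < ℓ)
    (hℓ : ℓ < (elems (K j)).card)
    (hu : u = ∑ i ∈ Finset.Iio j, ((elems (K i)).card - 1) + ℓ) {c : points (cart K) → F}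
    (hc : c ∈ minWeightWords (code (cart K) u)) :
    ∃ k ≤ j, (elems (K j)).card - ℓ ≤ (elems (K k)).card ∧
      wordSupp c ∈ orbitSupports K j k ((elems (K j)).card - ℓ) := by
  classical
  obtain ⟨hc, hw⟩ := mem_minWeightWords_iff.1 hc
  obtain ⟨φ, hφ, h⟩ := mem_code_iff.1 hc
  rw [← card_wordSupp, wordSupp_eq_supp h] at hw
  rw [wordSupp_eq_supp h]
  obtain ⟨σ, hσ, T, hT, -, hopt, hsupp⟩ := hφ.hasProductSupport hK hw
  rw [dims_univ] at hopt
  obtain ⟨π, hπ, k, hkj, hk, hP⟩ := hopt.exists_perm_eq (monotone_card_elems hK)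
    (fun i => (one_lt_card_elems _).le) j hℓ₀ hℓ hu
  refine ⟨k, hkj, hk, ?_⟩
  -- In a chain of fields the size determines the field, so a permutation preserving d is an
  -- automorphism of the box.
  have hKπ : ∀ i, K (π i) = K i := fun i => eq_of_card_elems_eq hK (congrFun hπ i)
  have hTπ : ∀ i, T (π i) ⊆ elems (K i) := fun i => hKπ i ▸ hT (π i)
  have hTone : ∀ i, ∃ t, i ≤ j → i ≠ k → T (π i) = {t} := by
    intro i
    by_cases hi : i ≤ j ∧ i ≠ k
    · have := hP i
      rw [if_pos hi.1, if_neg hi.2] at this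
      obtain ⟨t, ht⟩ := Finset.card_eq_one.1 this
      exact ⟨t, fun _ _ => ht⟩
    · exact ⟨0, fun h1 h2 => absurd ⟨h1, h2⟩ hi⟩
  choose t₀ ht₀ using hTone
  -- The translation by t moves the one-point factors to 0.
  let t : Fin n → F := fun i => if i ≤ j ∧ i ≠ k then t₀ i else 0
  have htv : ∀ i, i ≤ j → i ≠ k → T (π i) = {t i} := fun i h1 h2 => by
    simp only [t, if_pos (And.intro h1 h2)]
    exact ht₀ i h1 h2
  have ht0 : ∀ i, ¬ (i ≤ j ∧ i ≠ k) → t i = 0 := fun i hi => if_neg hi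
  have ht : t ∈ box K Finset.univ := by
    rw [mem_box_univ]
    intro i
    by_cases hi : i ≤ j ∧ i ≠ k
    · refine mem_elems.1 (hTπ i ?_)
      rw [htv i hi.1 hi.2]
      exact Finset.mem_singleton_self _
    · rw [ht0 i hi]
      exact (K i).zero_mem
  have hgt : ∀ i, ¬ i ≤ j → T (π i) = elems (K i) := fun i hi => by
    refine Finset.eq_of_subset_of_card_le (hTπ i) ?_
    have := hP i
    rw [if_neg hi] at this
    exact this.ge
  have hTk : (T (π k)).card = (elems (K j)).card - ℓ := by
    have := hP k
    rwa [if_pos hkj, if_pos rfl] at this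
  have hp := permAffine_mem_boxAut hKπ
  have hv := constVAdd_mem_boxAut ht
  refine ⟨σ * (permAffine F π)⁻¹ * AffineEquiv.constVAdd F (Fin n → F) t,
    mul_mem (mul_mem hσ (inv_mem hp)) hv, T (π k), hTπ k, hTk, ?_⟩
  have key : ∀ z, (σ * (permAffine F π)⁻¹ * AffineEquiv.constVAdd F (Fin n → F) t) z ∈
      supp K Finset.univ φ ↔ z ∈ stdSupp K j k (T (π k)) := by
    intro z
    set y := AffineEquiv.constVAdd F (Fin n → F) t z with hy
    set x := (permAffine F π)⁻¹ y with hx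
    have hyi : ∀ i, y i = t i + z i := fun i => rfl
    have hxy : ∀ i, y i = x (π i) := fun i => by
      rw [← permAffine_apply π x i, hx, apply_inv_self]
    have hbx : x ∈ box K Finset.univ ↔ z ∈ box K Finset.univ := by
      rw [hx, (inv_mem hp : (permAffine F π)⁻¹ ∈ boxAut K Finset.univ).1, hy, hv.1]
    change σ x ∈ _ ↔ _
    rw [mem_supp, hσ.1, hbx, stdSupp, Finset.mem_filter]
    refine and_congr_right fun hz => ?_
    rw [hsupp x (hbx.2 hz), ← π.forall_congr_right (q := fun i => x i ∈ T i)]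
    simp only [← hxy, hyi]
    rw [mem_box_univ] at hz
    constructor
    · intro h
      refine ⟨fun i hi hik => ?_, ?_⟩
      · have := h i
        rw [htv i hi hik, Finset.mem_singleton] at this
        simpa using this
      · have := h k
        rwa [ht0 k (by simp), zero_add] at this
    · rintro ⟨h1, h2⟩ i
      by_cases hi : i ≤ j
      · by_cases hik : i = k
        · subst hik
          rwa [ht0 i (by simp), zero_add]
        · rw [htv i hi hik, h1 i hi hik, add_zero]
          exact Finset.mem_singleton_self _
      · rw [hgt i hi, ht0 i (fun h => hi h.1), zero_add]
        exact mem_elems.2 (hz i)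
  ext x
  rw [Finset.mem_image]
  constructor
  · intro hx
    refine ⟨(σ * (permAffine F π)⁻¹ * AffineEquiv.constVAdd F (Fin n → F) t)⁻¹ x, ?_,
      apply_inv_self _ _⟩
    rwa [← key, apply_inv_self]
  · rintro ⟨z, hz, rfl⟩
    exact (key z).2 hz

/-- The supports depend only on the field of the distinguished coordinate. -/
theorem orbitSupports_subset {j k k' : Fin n} (hkj : k ≤ j) (hkj' : k' ≤ j) (hkk : K k = K k')
    (w : ℕ) : orbitSupports K j k w ⊆ orbitSupports K j k' w := by
  classical
  rintro _ ⟨σ, hσ, T, hT, hTw, rfl⟩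
  have hKπ : ∀ i, K (Equiv.swap k k' i) = K i := by
    intro i
    rcases eq_or_ne i k with rfl | h1
    · rw [Equiv.swap_apply_left, hkk]
    · rcases eq_or_ne i k' with rfl | h2
      · rw [Equiv.swap_apply_right, hkk]
      · rw [Equiv.swap_apply_of_ne_of_ne h1 h2]
  have hp := permAffine_mem_boxAut hKπ
  refine ⟨σ * permAffine F (Equiv.swap k k'), mul_mem hσ hp, T, hkk ▸ hT, hTw, ?_⟩
  have hstd : ∀ (a b : Fin n), a ≤ j → b ≤ j → (∀ i, K (Equiv.swap a b i) = K i) →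
      ∀ x ∈ stdSupp K j a T, permAffine F (Equiv.swap a b) x ∈ stdSupp K j b T := by
    intro a b ha hb hK x hx
    rw [stdSupp, Finset.mem_filter] at *
    refine ⟨((permAffine_mem_boxAut hK).1 x).2 hx.1, fun i hi hib => ?_, ?_⟩
    · rw [permAffine_apply]
      rcases eq_or_ne i a with rfl | h1
      · rw [Equiv.swap_apply_left]
        exact hx.2.1 b hb hib.symm
      · rw [Equiv.swap_apply_of_ne_of_ne h1 hib]
        exact hx.2.1 i hi h1
    · rw [permAffine_apply, Equiv.swap_apply_right]
      exact hx.2.2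
  have hinv : ∀ x : Fin n → F,
      permAffine F (Equiv.swap k k') (permAffine F (Equiv.swap k k') x) = x := by
    intro x
    ext i
    rw [permAffine_apply, permAffine_apply, Equiv.swap_apply_self]
  ext y
  simp only [Finset.mem_image]
  constructor
  · rintro ⟨x, hx, rfl⟩
    exact ⟨_, hstd k k' hkj hkj' hKπ x hx, congrArg σ (hinv x)⟩
  · rintro ⟨x, hx, rfl⟩
    refine ⟨permAffine F (Equiv.swap k k') x, ?_, rfl⟩
    rw [Equiv.swap_comm] at hKπ ⊢
    exact hstd k' k hkj' hkj hKπ x hx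

theorem orbitSupports_congr {j k k' : Fin n} (hkj : k ≤ j) (hkj' : k' ≤ j) (hkk : K k = K k')
    (w : ℕ) : orbitSupports K j k w = orbitSupports K j k' w :=
  (orbitSupports_subset hkj hkj' hkk w).antisymm (orbitSupports_subset hkj' hkj hkk.symm w)

theorem wordSupp_image_minWeightWords (hK : Monotone K) {j : Fin n} {ℓ : ℕ} (hℓ₀ : 0 < ℓ)
    (hℓ : ℓ < (elems (K j)).card)
    (hu : u = ∑ i ∈ Finset.Iio j, ((elems (K i)).card - 1) + ℓ) {S : Finset (Fin n → F)} :
    S ∈ wordSupp '' minWeightWords (code (cart K) u) ↔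
      ∃ k ≤ j, (elems (K j)).card - ℓ ≤ (elems (K k)).card ∧
        S ∈ orbitSupports K j k ((elems (K j)).card - ℓ) := by
  constructor
  · rintro ⟨c, hc, rfl⟩
    exact exists_wordSupp_mem_orbitSupports hK hℓ₀ hℓ hu hc
  · rintro ⟨k, hkj, hk, hS⟩
    rw [← image_wordSupp_orbitWords hk] at hS
    exact Set.image_mono (orbitWords_subset hK hkj hℓ hk hu) hS

end Orbits

end AffineCartesian

namespace AffineCartesian

section Levels

variable {F : Type*} [Field F] {n : ℕ}

open scoped Classical in
theorem card_level_eq_add (K : Fin n → Subfield F) (j : Fin n) : Fintype.card (Level K j) =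
    ((Finset.Iic j).filter fun i => K i = K j).card +
      ((Finset.Ioi j).filter fun i => K i = K j).card := by
  have h : Fintype.card (Level K j) = (Finset.univ.filter fun i => K i = K j).card :=
    Fintype.card_subtype _
  rw [h, ← Finset.card_union_of_disjoint]
  · congr 1
    ext i
    simp only [Finset.mem_filter, Finset.mem_univ, true_and, Finset.mem_union, Finset.mem_Iic,
      Finset.mem_Ioi, ← or_and_right]
    exact (and_iff_right (le_or_gt i j)).symm
  · rw [Finset.disjoint_left]
    intro i hi hi'
    exact (Finset.mem_Iic.1 (Finset.mem_filter.1 hi).1).not_gt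
      (Finset.mem_Ioi.1 (Finset.mem_filter.1 hi').1)

end Levels

/-! ### The numbers of supports in terms of Gaussian binomials. -/

section Counts

variable {F : Type*} [Field F] [Fintype F] {n : ℕ} {K : Fin n → Subfield F}

theorem card_box_univ_eq (K : Fin n → Subfield F) (j : Fin n) : (box K Finset.univ).card =
    (∏ i ∈ Finset.Iic j, (elems (K i)).card) * ∏ i ∈ Finset.Ioi j, (elems (K i)).card := by
  rw [card_box_eq_prod, ← Finset.prod_union]
  · congr 1
    ext i
    simp [le_or_gt]
  · rw [Finset.disjoint_left]
    intro i hi hi'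
    exact (Finset.mem_Iic.1 hi).not_gt (Finset.mem_Ioi.1 hi')

open scoped Classical in
-- By symmetry the dimension, which counts the coordinates of the level beyond j, may be replaced by
-- the codimension, which counts those up to j.
theorem card_tailGroups_eq (hK : Monotone K) (j : Fin n) {m e : ℕ}
    (hm : Fintype.card (Level K j) = m)
    (he : ((Finset.Iic j).filter fun i => K i = K j).card = e) :
    Nat.card (tailGroups K j) = gaussBinom (K j) m e := by
  have h := card_level_eq_add K j
  rw [hm, he] at h
  rw [card_tailGroups hK j hm, ← gaussBinom_symm (n := m) (k := e) (by omega)]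
  congr 1
  omega

open scoped Classical in
theorem prod_upper_eq (K : Fin n → Subfield F) (k : Fin n) :
    ∏ i ∈ upper K k, (elems (K i)).card =
    (elems (K k)).card ^ Fintype.card (Level K k) *
      ∏ i ∈ strictUpper K k, (elems (K i)).card := by
  have h : Fintype.card (Level K k) = (Finset.univ.filter fun i => K i = K k).card :=
    Fintype.card_subtype _
  rw [h, ← Finset.prod_const, ← Finset.prod_filter_mul_prod_filter_not _ (fun i => K i = K k)]
  congr 1
  · refine Finset.prod_congr ?_ fun i hi => ?_
    · ext i
      simp only [Finset.mem_filter, mem_upper, Finset.mem_univ, true_and]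
      exact and_iff_right_of_imp fun h => h.ge
    · rw [(Finset.mem_filter.1 hi).2]
  · refine Finset.prod_congr ?_ fun _ _ => rfl
    ext i
    simp only [Finset.mem_filter, mem_upper, mem_strictUpper]
    exact ⟨fun h => lt_of_le_of_ne h.1 (Ne.symm h.2), fun h => ⟨h.le, h.ne'⟩⟩

open scoped Classical in
theorem prod_upper_eq_mul_prod_Ioi (hK : Monotone K) (j : Fin n) :
    ∏ i ∈ upper K j, (elems (K i)).card =
      (elems (K j)).card ^ ((Finset.Iic j).filter fun i => K i = K j).card *
        ∏ i ∈ Finset.Ioi j, (elems (K i)).card := by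
  rw [prod_upper_eq K, prod_Ioi_eq hK, card_level_eq_add, pow_add, mul_assoc]

open scoped Classical in
theorem prod_strictUpper_eq (hK : Monotone K) {j k : Fin n} (hkj : K k < K j) :
    ∏ i ∈ strictUpper K k, (elems (K i)).card =
      (∏ i ∈ (Finset.Iic j).filter fun i => K k < K i, (elems (K i)).card) *
        ∏ i ∈ Finset.Ioi j, (elems (K i)).card := by
  rw [← Finset.prod_union]
  · refine Finset.prod_congr ?_ fun _ _ => rfl
    ext i
    simp only [mem_strictUpper, Finset.mem_union, Finset.mem_filter, Finset.mem_Iic, Finset.mem_Ioi]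
    rcases le_or_gt i j with h | h
    · simp [h, h.not_gt]
    · simp [h, h.not_ge, hkj.trans_le (hK h.le)]
  · rw [Finset.disjoint_left]
    intro i hi hi'
    exact (Finset.mem_Iic.1 (Finset.mem_filter.1 hi).1).not_gt (Finset.mem_Ioi.1 hi')

theorem prod_Ioi_pos (K : Fin n → Subfield F) (j : Fin n) :
    0 < ∏ i ∈ Finset.Ioi j, (elems (K i)).card :=
  Finset.prod_pos fun _ _ => (one_lt_card_elems _).le

open scoped Classical in
theorem ncard_orbitSupports_singleton (hK : Monotone K) (j : Fin n) {m e : ℕ}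
    (hm : Fintype.card (Level K j) = m)
    (he : ((Finset.Iic j).filter fun i => K i = K j).card = e) :
    (orbitSupports K j j 1).ncard =
      (∏ i ∈ Finset.Iic j, (elems (K i)).card) * gaussBinom (K j) m e := by
  have h := ncard_cosetSupports_singleton hK j
  rw [card_tailGroups_eq hK j hm he, card_box_univ_eq K j] at h
  rw [orbitSupports_eq_cosetSupports hK le_rfl]
  refine Nat.eq_of_mul_eq_mul_right (prod_Ioi_pos K j) (h.trans ?_)
  ring

open scoped Classical in
theorem ncard_orbitSupports_of_eq (hK : Monotone K) {j k : Fin n} (hkj : k ≤ j) (hkk : K k = K j)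
    {w m e : ℕ} (hw : 2 ≤ w) (hw' : w < (elems (K k)).card)
    (hm : Fintype.card (Level K j) = m)
    (he : ((Finset.Iic j).filter fun i => K i = K j).card = e + 1) :
    (orbitSupports K j k w).ncard =
      (∏ i ∈ (Finset.Iic j).erase k, (elems (K i)).card) * gaussBinom (K j) m e *
        gaussBinom (K k) (m - e) 1 * (elems (K k)).card.choose w := by
  have hlev := card_level_eq_add K j
  rw [hm, he] at hlev
  have hone := one_lt_card_elems (K k)
  have hD : ∀ H ∈ tailGroups K j, (directions K k H).card =
      ((elems (K k)).card ^ (e + 1) - 1) * ∏ i ∈ Finset.Ioi j, (elems (K i)).card := by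
    intro H hH
    have h := card_directions_add_of_eq hkk hH
    rw [prod_upper_eq_mul_prod_Ioi hK, he, ← hkk] at h
    rw [Nat.sub_mul, one_mul]
    omega
  have h := ncard_cosetSupports hkk.le hw (fun _ => hw') hD
  have g1 := gaussBinom_succ_mul (L := K j) (n := m) (k := e) (by omega)
  have g2 := gaussBinom_one_mul (L := K k) (n := m - e) (by omega)
  rw [natCard_eq_card_elems, ← hkk] at g1
  rw [natCard_eq_card_elems] at g2
  rw [card_tailGroups_eq hK j hm he, card_box_univ_eq K j,
    ← Finset.mul_prod_erase _ _ (Finset.mem_Iic.2 hkj), ← hkk] at h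
  rw [orbitSupports_eq_cosetSupports hK hkj, ← hkk]
  have hN := prod_Ioi_pos K j
  have hpos : 0 < ((elems (K k)).card * ∏ i ∈ Finset.Ioi j, (elems (K i)).card) *
      (((elems (K k)).card - 1) * ∏ i ∈ Finset.Ioi j, (elems (K i)).card) :=
    Nat.mul_pos (Nat.mul_pos (by omega) hN) (Nat.mul_pos (by omega) hN)
  refine Nat.eq_of_mul_eq_mul_right hpos (h.trans ?_)
  generalize (elems (K k)).card - 1 = p at *
  generalize (elems (K k)).card ^ (e + 1) - 1 = Q at *
  generalize ∏ i ∈ Finset.Ioi j, (elems (K i)).card = N at *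
  generalize ∏ i ∈ (Finset.Iic j).erase k, (elems (K i)).card = R at *
  generalize (elems (K k)).card.choose w = C at *
  -- The groups contribute [m, e+1] and the directions the factor d ^ (e+1) - 1. Their product
  -- equals [m, e] * [m-e, 1] * (d - 1), and d - 1 cancels against the rescalings of a direction.
  rw [← g2] at g1
  linear_combination ((elems (K k)).card * R * N * N * C) * g1

open scoped Classical in
-- Here directions need only avoid the strictly higher levels. The higher-level coordinates up to j
-- therefore remain as an extra product, while those beyond j cancel.
theorem ncard_orbitSupports_of_lt (hK : Monotone K) {j k : Fin n} (hkk : K k < K j)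
    {w m e m' : ℕ} (hw : 2 ≤ w) (hm : Fintype.card (Level K j) = m)
    (he : ((Finset.Iic j).filter fun i => K i = K j).card = e)
    (hm' : Fintype.card (Level K k) = m') :
    (orbitSupports K j k w).ncard =
      (∏ i ∈ (Finset.Iic j).erase k, (elems (K i)).card) *
        (∏ i ∈ (Finset.Iic j).filter fun i => K k < K i, (elems (K i)).card) *
        gaussBinom (K j) m e * gaussBinom (K k) m' 1 * (elems (K k)).card.choose w := by
  have hkj : k ≤ j := le_of_lt (hK.reflect_lt hkk)
  have hone := one_lt_card_elems (K k)
  have hD : ∀ H ∈ tailGroups K j, (directions K k H).card =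
      ((elems (K k)).card ^ m' - 1) *
        ((∏ i ∈ (Finset.Iic j).filter fun i => K k < K i, (elems (K i)).card) *
          ∏ i ∈ Finset.Ioi j, (elems (K i)).card) := by
    intro H hH
    have h := card_directions_add_of_lt hkk hH
    rw [prod_upper_eq K, hm'] at h
    rw [← prod_strictUpper_eq hK hkk, Nat.sub_mul, one_mul]
    omega
  have h := ncard_cosetSupports hkk.le hw (fun h => absurd h hkk.ne) hD
  have hm'1 : 1 ≤ m' := by
    rw [← hm']
    exact Fintype.card_pos_iff.2 ⟨⟨k, rfl⟩⟩
  have g2 := gaussBinom_one_mul (L := K k) hm'1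
  rw [natCard_eq_card_elems] at g2
  rw [card_tailGroups_eq hK j hm he, card_box_univ_eq K j,
    ← Finset.mul_prod_erase _ _ (Finset.mem_Iic.2 hkj), ← g2] at h
  rw [orbitSupports_eq_cosetSupports hK hkj]
  have hN := prod_Ioi_pos K j
  have hpos : 0 < ((elems (K k)).card * ∏ i ∈ Finset.Ioi j, (elems (K i)).card) *
      (((elems (K k)).card - 1) * ∏ i ∈ Finset.Ioi j, (elems (K i)).card) :=
    Nat.mul_pos (Nat.mul_pos (by omega) hN) (Nat.mul_pos (by omega) hN)
  refine Nat.eq_of_mul_eq_mul_right hpos (h.trans ?_)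
  ring

end Counts

/-! ### Arithmetic of consecutive blocks of coordinates. -/

section Blocks

variable {l : ℕ} {μ : Fin l → ℕ}

theorem partialSum_mono (μ : Fin l → ℕ) : Monotone (partialSum μ) := fun _ _ h =>
  Finset.sum_le_sum_of_subset fun i hi => by
    simp only [Finset.mem_filter, Finset.mem_univ, true_and] at *
    omega

theorem block_eq_iff {i : Fin (∑ t, μ t)} {t : Fin l} :
    block μ i = t ↔ partialSum μ t ≤ i ∧ i < partialSum μ (t + 1) := by
  have h := block_spec μ i
  refine ⟨fun h' => h' ▸ h, fun h' => ?_⟩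
  by_contra hne
  rcases lt_or_gt_of_ne hne with hlt | hlt
  · have := partialSum_mono μ (show (block μ i).val + 1 ≤ t.val from hlt)
    omega
  · have := partialSum_mono μ (show t.val + 1 ≤ (block μ i).val from hlt)
    omega

theorem block_monotone (μ : Fin l → ℕ) : Monotone (block μ) := by
  intro a b hab
  by_contra h
  have h1 := partialSum_mono μ (show (block μ b).val + 1 ≤ (block μ a).val from not_le.1 h)
  have h2 := block_spec μ a
  have h3 := block_spec μ b
  have : a.val ≤ b.val := hab
  omega

theorem block_blockEnd (hμ : ∀ t, 0 < μ t) (t : Fin l) : block μ (blockEnd μ hμ t) = t := by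
  rw [block_eq_iff]
  have h1 := partialSum_succ μ t
  have h2 := hμ t
  simp only [blockEnd]
  omega

theorem card_filter_block_eq (t : Fin l) :
    (Finset.univ.filter fun i => block μ i = t).card = μ t := by
  have h1 := partialSum_succ μ t
  have h2 := partialSum_le μ (t + 1)
  have : ((Finset.univ.filter fun i => block μ i = t).map Fin.valEmbedding) =
      Finset.Ico (partialSum μ t) (partialSum μ (t + 1)) := by
    ext x
    simp only [Finset.mem_map, Finset.mem_filter, Finset.mem_univ, true_and, block_eq_iff,
      Fin.valEmbedding_apply, Finset.mem_Ico]
    exact ⟨fun ⟨i, hi, h⟩ => h ▸ hi, fun h => ⟨⟨x, by omega⟩, h, rfl⟩⟩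
  rw [← Finset.card_map Fin.valEmbedding, this, Nat.card_Ico]
  omega

theorem card_filter_Iic_block_eq (j : Fin (∑ t, μ t)) :
    ((Finset.Iic j).filter fun i => block μ i = block μ j).card =
      j + 1 - partialSum μ (block μ j) := by
  have h1 := block_spec μ j
  have : (((Finset.Iic j).filter fun i => block μ i = block μ j).map Fin.valEmbedding) =
      Finset.Ico (partialSum μ (block μ j)) (j + 1) := by
    ext x
    simp only [Finset.mem_map, Finset.mem_filter, Finset.mem_Iic, block_eq_iff,
      Fin.valEmbedding_apply, Finset.mem_Ico]
    constructor
    · rintro ⟨i, ⟨h2, h3⟩, rfl⟩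
      have : i.val ≤ j.val := h2
      omega
    · rintro ⟨h2, h3⟩
      have := j.2
      exact ⟨⟨x, by omega⟩, ⟨Fin.mk_le_of_le_val (by omega), by simp only; omega⟩, rfl⟩
  rw [← Finset.card_map Fin.valEmbedding, this, Nat.card_Ico]

theorem block_lt_iff {i k : Fin (∑ t, μ t)} :
    block μ k < block μ i ↔ partialSum μ (block μ k + 1) ≤ i := by
  have h1 := block_spec μ i
  constructor
  · intro h
    have := partialSum_mono μ (show (block μ k).val + 1 ≤ (block μ i).val from h)
    omega
  · intro h
    by_contra h'
    have := partialSum_mono μ (show (block μ i).val + 1 ≤ (block μ k).val + 1 from by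
      have : (block μ i).val ≤ (block μ k).val := not_lt.1 h'
      omega)
    omega

end Blocks

/-! ### Existence and uniqueness of j and ℓ. -/

section Decomposition

/-- Every `1 ≤ u ≤ ∑ (d i - 1)` is a proper initial sum of the `d i - 1` plus a part of the next. -/
theorem existsUnique_decomposition {n : ℕ} (d : Fin n → ℕ) {u : ℕ} (h1 : 1 ≤ u)
    (hu : u ≤ ∑ i, (d i - 1)) : ∃! p : Fin n × ℕ,
      u = (∑ i ∈ Finset.Iio p.1, (d i - 1)) + p.2 ∧ 0 < p.2 ∧ p.2 ≤ d p.1 - 1 := by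
  have hstep : ∀ j : Fin n, ∑ i ∈ Finset.Iic j, (d i - 1) =
      (∑ i ∈ Finset.Iio j, (d i - 1)) + (d j - 1) := fun j => by
    rw [← Finset.Iio_insert, Finset.sum_insert (by simp), add_comm]
  have hmono : ∀ {a b : Fin n}, a < b →
      ∑ i ∈ Finset.Iic a, (d i - 1) ≤ ∑ i ∈ Finset.Iio b, (d i - 1) := fun {a b} h =>
    Finset.sum_le_sum_of_subset fun i hi =>
      Finset.mem_Iio.2 ((Finset.mem_Iic.1 hi).trans_lt h)
  have hex : ∃ j, u ≤ ∑ i ∈ Finset.Iic j, (d i - 1) := by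
    rcases n with - | n
    · simp at hu
      omega
    · refine ⟨Fin.last n, hu.trans (Finset.sum_le_sum_of_subset fun i _ => ?_)⟩
      exact Finset.mem_Iic.2 (Fin.le_last i)
  classical
  have hne : (Finset.univ.filter fun j => u ≤ ∑ i ∈ Finset.Iic j, (d i - 1)).Nonempty := by
    obtain ⟨j, hj⟩ := hex
    exact ⟨j, by simpa using hj⟩
  -- The index j is the first one at which the cumulative sum reaches u.
  obtain ⟨j, hj, hmin⟩ := Finset.exists_min_image _ id hne
  have hj : u ≤ ∑ i ∈ Finset.Iic j, (d i - 1) := by simpa using hj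
  have hlt : ∑ i ∈ Finset.Iio j, (d i - 1) < u := by
    by_contra h
    rw [not_lt] at h
    by_cases h0 : j.val = 0
    · have : Finset.Iio j = ∅ := by
        ext i
        simp only [Finset.mem_Iio, Finset.notMem_empty, iff_false, not_lt]
        exact Fin.le_def.2 (by omega)
      rw [this, Finset.sum_empty] at h
      omega
    · have hj' := j.2
      let a : Fin n := ⟨j.val - 1, by omega⟩
      have ha : Finset.Iio j = Finset.Iic a := by
        ext i
        simp only [Finset.mem_Iio, Finset.mem_Iic, Fin.lt_def, Fin.le_def, a]
        omega
      have := hmin a (by simpa [← ha] using h)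
      have : j.val ≤ j.val - 1 := this
      omega
  refine ⟨(j, u - ∑ i ∈ Finset.Iio j, (d i - 1)), ?_, ?_⟩
  · have := hstep j
    simp only
    omega
  · rintro ⟨a, b⟩ ⟨h2, h3, h4⟩
    simp only at h2 h3 h4
    have ha := hstep a
    have hj1 := hstep j
    have : a = j := by
      by_contra hne
      rcases lt_or_gt_of_ne hne with h | h
      · have := hmono h
        omega
      · have := hmono h
        omega
    subst this
    rw [Prod.mk.injEq]
    exact ⟨rfl, by omega⟩

end Decomposition

end AffineCartesian

namespace AffineCartesian

/-! ### Specialisation to products of powers of nested subfields. -/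

section BlockFields

variable {F : Type*} [Field F] {l : ℕ} {E : Fin l → Subfield F} {μ : Fin l → ℕ}

/-- The field of the coordinate `i` of the product `E₁ ^ μ₁ × ⋯ × E_l ^ μ_l`. -/
abbrev blockField (E : Fin l → Subfield F) (μ : Fin l → ℕ) (i : Fin (∑ t, μ t)) : Subfield F :=
  E (block μ i)

theorem blockField_monotone (hE : StrictMono E) : Monotone (blockField E μ) :=
  hE.monotone.comp (block_monotone μ)

open scoped Classical in
theorem card_level_blockField (hE : StrictMono E) (k : Fin (∑ t, μ t)) :
    Fintype.card (Level (blockField E μ) k) = μ (block μ k) := by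
  have h : Fintype.card (Level (blockField E μ) k) =
      (Finset.univ.filter fun i => blockField E μ i = blockField E μ k).card :=
    Fintype.card_subtype _
  rw [h, ← card_filter_block_eq (μ := μ)]
  congr 1
  ext i
  simp [hE.injective.eq_iff]

open scoped Classical in
theorem card_filter_Iic_blockField (hE : StrictMono E) (j : Fin (∑ t, μ t)) :
    ((Finset.Iic j).filter fun i => blockField E μ i = blockField E μ j).card =
      j + 1 - partialSum μ (block μ j) := by
  rw [← card_filter_Iic_block_eq]
  congr 1
  ext i
  simp [hE.injective.eq_iff]

end BlockFields

section BlockCounts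

variable {F : Type*} [Field F] [Fintype F] {l : ℕ} {E : Fin l → Subfield F} {μ : Fin l → ℕ}

theorem size_factors (E : Fin l → Subfield F) (μ : Fin l → ℕ) :
    size (factors E μ) = fun i => (elems (blockField E μ i)).card :=
  funext fun i => size_cart (K := blockField E μ) i

/-- Here d j - ℓ = 1, so T is a single point τ. As K k ≤ K j, a translation exchanges the fixed
value τ at k for the same value at j, and all k ≤ j give the supports of j. -/
theorem ncard_minWeightWords_of_eq (hE : StrictMono E) {u : ℕ} {j : Fin (∑ t, μ t)} {ℓ : ℕ}
    (hu : u = ∑ i ∈ Finset.Iio j, ((elems (blockField E μ i)).card - 1) + ℓ) (hℓ₀ : 0 < ℓ)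
    (hℓ : ℓ = (elems (blockField E μ j)).card - 1) :
    (minWeightWords (code (factors E μ) u)).ncard =
      (Nat.card F - 1) * (∏ i ∈ Finset.Iic j, (elems (blockField E μ i)).card) *
        gaussBinom (E (block μ j)) (μ (block μ j)) (j + 1 - partialSum μ (block μ j)) := by
  classical
  have hK := blockField_monotone (μ := μ) hE
  have hone := one_lt_card_elems (blockField E μ j)
  have hw : (elems (blockField E μ j)).card - ℓ = 1 := by omega
  have himg : wordSupp '' minWeightWords (code (cart (blockField E μ)) u) =
      orbitSupports (blockField E μ) j j 1 := by
    ext S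
    rw [wordSupp_image_minWeightWords hK hℓ₀ (by omega) hu, hw]
    refine ⟨?_, fun h => ⟨j, le_rfl, hone.le, h⟩⟩
    rintro ⟨k, hkj, -, σ, hσ, T, hT, hTw, rfl⟩
    obtain ⟨τ, rfl⟩ := Finset.card_eq_one.1 hTw
    have hτ : τ ∈ blockField E μ k := by simpa using hT
    have ht : (Pi.single k τ - Pi.single j τ : Fin (∑ t, μ t) → F) ∈
        boxGroup (blockField E μ) Finset.univ := by
      have hsingle : ∀ a, τ ∈ blockField E μ a →
          (Pi.single a τ : Fin (∑ t, μ t) → F) ∈ boxGroup (blockField E μ) Finset.univ := by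
        intro a ha
        refine mem_box_univ.2 fun i => ?_
        rcases eq_or_ne i a with rfl | h
        · simpa using ha
        · simp [h]
      exact AddSubgroup.sub_mem _ (hsingle k hτ) (hsingle j (hK hkj hτ))
    have hv := constVAdd_mem_boxAut ht
    refine ⟨σ * AffineEquiv.constVAdd F _ (Pi.single k τ - Pi.single j τ), mul_mem hσ hv, {τ},
      by simpa using hK hkj hτ, by simp, ?_⟩
    have hstd : ∀ z, AffineEquiv.constVAdd F _ (Pi.single k τ - Pi.single j τ) z ∈
        stdSupp (blockField E μ) j k {τ} ↔ z ∈ stdSupp (blockField E μ) j j {τ} := by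
      intro z
      rw [stdSupp, stdSupp, Finset.mem_filter, Finset.mem_filter, hv.1]
      refine and_congr_right fun _ => ?_
      have hone : ∀ (a : Fin (∑ t, μ t)) (y : Fin (∑ t, μ t) → F), a ≤ j →
          ((∀ i ≤ j, i ≠ a → y i = 0) ∧ y a ∈ ({τ} : Finset F) ↔
            ∀ i ≤ j, y i = (Pi.single a τ : Fin (∑ t, μ t) → F) i) := by
        intro a y ha
        constructor
        · rintro ⟨h1, h2⟩ i hi
          rcases eq_or_ne i a with rfl | h
          · simpa using h2
          · simpa [h] using h1 i hi h
        · intro h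
          exact ⟨fun i hi hia => by simpa [hia] using h i hi, by simpa using h a ha⟩
      rw [hone k _ hkj, hone j _ le_rfl]
      refine forall₂_congr fun i _ => ?_
      rw [AffineEquiv.constVAdd_apply, vadd_eq_add, Pi.add_apply, Pi.sub_apply, sub_add_eq_add_sub,
        sub_eq_iff_eq_add, add_left_cancel_iff]
    ext y
    simp only [Finset.mem_image]
    constructor
    · rintro ⟨x, hx, rfl⟩
      refine ⟨(AffineEquiv.constVAdd F _ (Pi.single k τ - Pi.single j τ))⁻¹ x, ?_, ?_⟩
      · rwa [← hstd, apply_inv_self]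
      · exact congrArg σ (apply_inv_self _ x)
    · rintro ⟨x, hx, rfl⟩
      exact ⟨_, (hstd x).2 hx, rfl⟩
  have h := ncard_minWeightWords (blockField E μ) u
  rw [himg, ncard_orbitSupports_singleton hK j (card_level_blockField hE j)
    (card_filter_Iic_blockField hE j), ← mul_assoc] at h
  exact h

/-- Supports depend only on the field of k, so one representative per block suffices: j in its own
block and the last coordinate in each earlier one. Different blocks are disjoint because d j - ℓ ≥
2. -/
theorem ncard_minWeightWords_eq_add (hE : StrictMono E) (hμ : ∀ t, 0 < μ t) {u : ℕ}
    {j : Fin (∑ t, μ t)} {ℓ : ℕ}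
    (hu : u = ∑ i ∈ Finset.Iio j, ((elems (blockField E μ i)).card - 1) + ℓ) (hℓ₀ : 0 < ℓ)
    (hℓ : ℓ < (elems (blockField E μ j)).card - 1) {k₀ : Fin (∑ t, μ t)}
    (hk₀ : IsLeast {k | k ≤ j ∧
      (elems (blockField E μ j)).card - ℓ ≤ (elems (blockField E μ k)).card} k₀) :
    (minWeightWords (code (factors E μ) u)).ncard =
      (orbitWords (factors E μ) j ℓ j).ncard + ∑ t ∈ Finset.Ico (block μ k₀) (block μ j),
        (orbitWords (factors E μ) j ℓ (blockEnd μ hμ t)).ncard := by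
  have hK := blockField_monotone (μ := μ) hE
  set w := (elems (blockField E μ j)).card - ℓ with hw
  have hle : ∀ t < block μ j, blockEnd μ hμ t ≤ j := fun t ht =>
    ((block_monotone μ).reflect_lt ((block_blockEnd hμ t).symm ▸ ht)).le
  have hcard : ∀ t ∈ Finset.Ico (block μ k₀) (block μ j),
      w ≤ (elems (blockField E μ (blockEnd μ hμ t))).card := by
    intro t ht
    refine hk₀.1.2.trans (Finset.card_le_card fun x hx => ?_)
    rw [mem_elems] at hx ⊢
    simp only [blockField, block_blockEnd] at hx ⊢
    exact hE.monotone (Finset.mem_Ico.1 ht).1 hx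
  have hj : (orbitWords (factors E μ) j ℓ j).ncard =
      (Nat.card F - 1) * (orbitSupports (blockField E μ) j j w).ncard :=
    ncard_orbitWords hK le_rfl (by omega) (by omega)
  have ht : ∀ t ∈ Finset.Ico (block μ k₀) (block μ j),
      (orbitWords (factors E μ) j ℓ (blockEnd μ hμ t)).ncard =
        (Nat.card F - 1) * (orbitSupports (blockField E μ) j (blockEnd μ hμ t) w).ncard :=
    fun t ht => ncard_orbitWords hK (hle t (Finset.mem_Ico.1 ht).2) (by omega) (hcard t ht)
  let rep : Fin l → Fin (∑ t, μ t) := fun t => if t = block μ j then j else blockEnd μ hμ t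
  have hrepj : rep (block μ j) = j := if_pos rfl
  have hrep : ∀ t, block μ (rep t) = t := by
    intro t
    by_cases h : t = block μ j
    · rw [h, hrepj]
    · simp only [rep, if_neg h, block_blockEnd]
  have hrep' : ∀ t ∈ Finset.Ico (block μ k₀) (block μ j), rep t = blockEnd μ hμ t :=
    fun t ht => if_neg (Finset.mem_Ico.1 ht).2.ne
  have hrepcard : ∀ t ∈ insert (block μ j) (Finset.Ico (block μ k₀) (block μ j)),
      rep t ≤ j ∧ w ≤ (elems (blockField E μ (rep t))).card := by
    intro t ht
    rcases Finset.mem_insert.1 ht with rfl | ht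
    · rw [hrepj]
      exact ⟨le_rfl, by omega⟩
    · rw [hrep' t ht]
      exact ⟨hle t (Finset.mem_Ico.1 ht).2, hcard t ht⟩
  have hunion : wordSupp '' minWeightWords (code (cart (blockField E μ)) u) =
      ⋃ t ∈ ((insert (block μ j) (Finset.Ico (block μ k₀) (block μ j)) : Finset (Fin l)) :
        Set (Fin l)), orbitSupports (blockField E μ) j (rep t) w := by
    ext S
    rw [wordSupp_image_minWeightWords hK hℓ₀ (by omega) hu]
    simp only [Set.mem_iUnion, exists_prop, Finset.mem_coe]
    constructor
    · rintro ⟨k, hkj, hk, hS⟩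
      have hmem : block μ k ∈ insert (block μ j) (Finset.Ico (block μ k₀) (block μ j)) := by
        rw [Finset.mem_insert, Finset.mem_Ico]
        rcases (block_monotone μ hkj).eq_or_lt with h | h
        · exact Or.inl h
        · exact Or.inr ⟨block_monotone μ (hk₀.2 ⟨hkj, hk⟩), h⟩
      refine ⟨block μ k, hmem, ?_⟩
      rwa [orbitSupports_congr (hrepcard _ hmem).1 hkj]
      simp only [blockField, hrep]
    · rintro ⟨t, ht, hS⟩
      exact ⟨rep t, (hrepcard t ht).1, (hrepcard t ht).2, hS⟩
  have hdisj : ((insert (block μ j) (Finset.Ico (block μ k₀) (block μ j)) : Finset (Fin l)) :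
      Set (Fin l)).PairwiseDisjoint fun t => orbitSupports (blockField E μ) j (rep t) w := by
    have key : ∀ t ∈ insert (block μ j) (Finset.Ico (block μ k₀) (block μ j)),
        ∀ t' ∈ insert (block μ j) (Finset.Ico (block μ k₀) (block μ j)), t < t' →
        Disjoint (orbitSupports (blockField E μ) j (rep t) w)
          (orbitSupports (blockField E μ) j (rep t') w) := by
      intro t ht t' ht' hlt
      rw [orbitSupports_eq_cosetSupports hK (hrepcard t ht).1,
        orbitSupports_eq_cosetSupports hK (hrepcard t' ht').1]
      refine disjoint_cosetSupports ?_ (hK (hrepcard t' ht').1) (by omega)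
      simp only [blockField, hrep]
      exact hE hlt
    intro t ht t' ht' hne
    rcases lt_or_gt_of_ne hne with h | h
    · exact key t ht t' ht' h
    · exact (key t' ht' t ht h).symm
  have h := ncard_minWeightWords (blockField E μ) u
  rw [hunion, (Finset.finite_toSet _).ncard_biUnion (fun _ _ => Set.toFinite _) hdisj,
    finsum_mem_coe_finset, Finset.sum_insert (by simp), hrepj, mul_add, Finset.mul_sum] at h
  rw [hj, Finset.sum_congr rfl ht]
  refine h.trans (congrArg _ (Finset.sum_congr rfl fun t ht => ?_))
  rw [hrep' t ht]

theorem ncard_orbitWords_of_eq (hE : StrictMono E) {j k : Fin (∑ t, μ t)} {ℓ : ℕ} (hℓ₀ : 0 < ℓ)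
    (hℓ : ℓ < (elems (blockField E μ j)).card - 1) (hkj : k ≤ j)
    (hk : (elems (blockField E μ j)).card - ℓ ≤ (elems (blockField E μ k)).card)
    (hb : block μ k = block μ j) :
    (orbitWords (factors E μ) j ℓ k).ncard =
      (Nat.card F - 1) * (∏ i ∈ (Finset.Iic j).erase k, (elems (blockField E μ i)).card) *
        gaussBinom (E (block μ j)) (μ (block μ j)) (j - partialSum μ (block μ j)) *
        gaussBinom (E (block μ k)) (partialSum μ (block μ j + 1) - j) 1 *
        (elems (blockField E μ k)).card.choose ((elems (blockField E μ j)).card - ℓ) := by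
  have hK := blockField_monotone (μ := μ) hE
  have hkk : blockField E μ k = blockField E μ j := congrArg E hb
  have hs := block_spec μ j
  have hs' := partialSum_succ μ (block μ j)
  have h := ncard_orbitSupports_of_eq hK hkj hkk
    (w := (elems (blockField E μ j)).card - ℓ) (e := j - partialSum μ (block μ j)) (by omega)
    (by rw [hkk]; omega) (card_level_blockField hE j)
    ((card_filter_Iic_blockField hE j).trans (by omega))
  rw [show μ (block μ j) - (j - partialSum μ (block μ j)) = partialSum μ (block μ j + 1) - j by
    omega] at h
  refine (ncard_orbitWords hK hkj (by omega) hk).trans ?_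
  rw [h]
  simp only [mul_assoc]

theorem ncard_orbitWords_of_lt (hE : StrictMono E) {j k : Fin (∑ t, μ t)} {ℓ : ℕ}
    (hℓ : ℓ < (elems (blockField E μ j)).card - 1)
    (hk : (elems (blockField E μ j)).card - ℓ ≤ (elems (blockField E μ k)).card)
    (hb : block μ k < block μ j) :
    (orbitWords (factors E μ) j ℓ k).ncard =
      (Nat.card F - 1) * (∏ i ∈ (Finset.Iic j).erase k, (elems (blockField E μ i)).card) *
        (∏ i ∈ Finset.Iic j with partialSum μ (block μ k + 1) ≤ i.val,
          (elems (blockField E μ i)).card) *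
        gaussBinom (E (block μ j)) (μ (block μ j)) (j + 1 - partialSum μ (block μ j)) *
        gaussBinom (E (block μ k)) (μ (block μ k)) 1 *
        (elems (blockField E μ k)).card.choose ((elems (blockField E μ j)).card - ℓ) := by
  classical
  have hK := blockField_monotone (μ := μ) hE
  have hkj : k ≤ j := ((block_monotone μ).reflect_lt hb).le
  have h := ncard_orbitSupports_of_lt hK (j := j) (k := k) (hE hb)
    (w := (elems (blockField E μ j)).card - ℓ) (by omega) (card_level_blockField hE j)
    (card_filter_Iic_blockField hE j) (card_level_blockField hE k)
  have hfilter : ((Finset.Iic j).filter fun i => blockField E μ k < blockField E μ i) =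
      (Finset.Iic j).filter fun i => partialSum μ (block μ k + 1) ≤ i.val := by
    ext i
    simp only [Finset.mem_filter, hE.lt_iff_lt, block_lt_iff]
  refine (ncard_orbitWords hK hkj (by omega) hk).trans ?_
  rw [h, hfilter]
  simp only [mul_assoc]

end BlockCounts

end AffineCartesian

open AffineCartesian in
theorem theorem1p1 {F : Type*} [Field F] [Finite F] {l : ℕ}
    (E : Fin l → Subfield F) (hE : StrictMono E)
    (μ : Fin l → ℕ) (hμ : ∀ t, 0 < μ t) :
    letI A := factors E μ
    letI d := size A
    letI q := Nat.card F
    letI s := partialSum μ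
    letI tt := block μ
    (minWeightWords (code A 0)).ncard = q - 1 ∧
    ∀ u : ℕ, 1 ≤ u → u ≤ ∑ i, (d i - 1) →
      (∃! p : Fin (∑ t, μ t) × ℕ,
        u = (∑ i ∈ Finset.Iio p.1, (d i - 1)) + p.2 ∧ 0 < p.2 ∧ p.2 ≤ d p.1 - 1) ∧
      ∀ (j : Fin (∑ t, μ t)) (ℓ : ℕ),
        u = (∑ i ∈ Finset.Iio j, (d i - 1)) + ℓ → 0 < ℓ → ℓ ≤ d j - 1 →
        (ℓ = d j - 1 →
          (minWeightWords (code A u)).ncard =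
            (q - 1) * (∏ i ∈ Finset.Iic j, d i) *
              gaussBinom (E (tt j)) (μ (tt j)) (j + 1 - s (tt j))) ∧
        (ℓ < d j - 1 →
          (∀ k₀ : Fin (∑ t, μ t), IsLeast {k | k ≤ j ∧ d j - ℓ ≤ d k} k₀ →
            (minWeightWords (code A u)).ncard =
              (orbitWords A j ℓ j).ncard +
                ∑ t ∈ Finset.Ico (tt k₀) (tt j), (orbitWords A j ℓ (blockEnd μ hμ t)).ncard) ∧
          ∀ k ≤ j, d j - ℓ ≤ d k →
            (tt k = tt j →
              (orbitWords A j ℓ k).ncard =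
                (q - 1) * (∏ i ∈ (Finset.Iic j).erase k, d i) *
                  gaussBinom (E (tt j)) (μ (tt j)) (j - s (tt j)) *
                  gaussBinom (E (tt k)) (s (tt j + 1) - j) 1 *
                  (d k).choose (d j - ℓ)) ∧
            (tt k < tt j →
              (orbitWords A j ℓ k).ncard =
                (q - 1) * (∏ i ∈ (Finset.Iic j).erase k, d i) *
                  (∏ i ∈ Finset.Iic j with s (tt k + 1) ≤ i.val, d i) *
                  gaussBinom (E (tt j)) (μ (tt j)) (j + 1 - s (tt j)) *
                  gaussBinom (E (tt k)) (μ (tt k)) 1 *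
                  (d k).choose (d j - ℓ))) := by

  have := Fintype.ofFinite F
  refine ⟨ncard_minWeightWords_zero (blockField E μ), fun u hu₁ hu =>
    ⟨existsUnique_decomposition _ hu₁ hu, fun j ℓ hdec hℓ₀ hℓ => ?_⟩⟩
  rw [size_factors] at *
  exact ⟨fun h => ncard_minWeightWords_of_eq hE hdec hℓ₀ h,
    fun h => ⟨fun k₀ hk₀ => ncard_minWeightWords_eq_add hE hμ hdec hℓ₀ h hk₀,
      fun k hkj hk => ⟨fun hb => ncard_orbitWords_of_eq hE hℓ₀ h hkj hk hb,
        fun hb => ncard_orbitWords_of_lt hE h hk hb⟩⟩⟩
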